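/- **Proposition 3.1.** Let $\mathbf k$ be a field and $d,s\ge 0$ integers. Let $\mathcal P_d$ be the category of homogeneous strict polynomial functors of degree $d$ over $\mathbf k$ (functors from finite dimensional vector spaces to finite dimensional vector spaces, given by structure maps $D^d(\mathrm{Hom}(V,W))\to\mathrm{Hom}(F(V),F(W))$ compatible with identities and composition, where $D^d(X)=(X^{\otimes d})^{\Sigma_d}$), and let $\mathcal{DP}_d$ be its bounded derived category. Write $D^d_V\in\mathcal P_d$ for the functor $W\mapsto D^d(\mathrm{Hom}(V,W))$, and $F^\#(V)=F(V^*)^*$ for the Kuhn dual of $F\in\mathcal P_d$; it extends to complexes, by dualizing termwise and placing the dual of the term of degree $n$ in degree $-n$. For $A\in\mathcal P_s$ let $\mathbf C_A:\mathcal P_d\to\mathcal P_{ds}$, $\mathbf C_A(F)(V)=F(A(V))$. For $F\in\mathcal{DP}_{ds}$ put $$\mathbf K^r_A(F)(V)=\mathrm{RHom}_{\mathcal P_{ds}}(\mathbf C_A(D^d_V),F),\qquad \mathbf K^l_A(F)=\bigl(\mathbf K^r_{A^\#}(F^\#)\bigr)^\#,$$ where $\mathbf K^r_A$ is the right derived functor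 of $F\mapsto\bigl(V\mapsto \mathrm{Hom}_{\mathcal P_{ds}}(\mathbf C_A(D^d_V),F)\bigr)$. Let $U=\bigoplus_{j\in\mathbb Z}U^j$ be a graded vector space of finite total dimension, and let $(U^*)^j=(U^{-j})^*$. For $F\in\mathcal P_d$ the functor $F_U(V)=F(U^*\otimes V)$ is graded: its component $F_U^j(V)$ of degree $j$ is the image of $F(e_j\otimes\mathrm{id}_V)$, where $e_j\in D^d(\mathrm{End}(U^*))$ is the projection of $(U^*)^{\otimes d}$ onto its component of total degree $j$. For $F\in\mathcal{DP}_d$ the object $F_U=\bigoplus_j F_U^j[-j]\in\mathcal{DP}_d$ is obtained by applying the exact functors $F\mapsto F_U^j$ termwise and placing the component of degree $j$ in cohomological degree $j$. Likewise $A(U)$ is the graded space whose component of degree $j$ is the image of $A(e_j)$, for $e_j\in D^s(\mathrm{End}(U))$ the projection of $U^{\otimes s}$ onto its component of total degree $j$. Assume that for $A\in\mathcal P_s$ there is an isomorphism $A(V\otimes W)\simeq A(V)\otimes A(W)$ of strict polynomial bifunctors in $V,W$ (natural with respect to $D^s(\mathrm{Hom}(V,V'))$ and $D^s(\mathrm{Hom}(W,W'))$).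 Then for every graded space $U$ as above there are isomorphisms, natural in $F\in\mathcal{DP}_{ds}$, $$\mathbf K^r_A(F_U)\simeq\bigl(\mathbf K^r_A(F)\bigr)_{A(U)},\qquad \mathbf K^l_A(F_U)\simeq\bigl(\mathbf K^l_A(F)\bigr)_{A(U)}$$ in the derived category of $\mathcal P_d$. -/

import Mathlib

open CategoryTheory TensorProduct

universe u

noncomputable section

namespace StrictPoly

section DividedPowers

variable (k : Type u) [Field k] (d : ℕ)

/-- The action of a permutation of the tensor factors on `X^{⊗ d}`. -/
def permT {X : Type u} [AddCommGroup X] [Module k X] {d : ℕ} (σ : Equiv.Perm (Fin d)) :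
    (⨂[k] _ : Fin d, X) →ₗ[k] (⨂[k] _ : Fin d, X) :=
  (PiTensorProduct.reindex k (fun _ => X) σ).toLinearMap

theorem permT_tprod {X : Type u} [AddCommGroup X] [Module k X] {d : ℕ} (σ : Equiv.Perm (Fin d))
    (f : Fin d → X) :
    permT k σ (PiTensorProduct.tprod k f) = PiTensorProduct.tprod k fun i => f (σ.symm i) :=
  PiTensorProduct.reindex_tprod σ f

/-- The divided power `D^d(X) = Γ^d(X)` of a vector space, realised as the space of symmetric
tensors `(X^{⊗ d})^{Σ_d}`. -/
def divPow (X : Type u) [AddCommGroup X] [Module k X] : Submodule k (⨂[k] _ : Fin d, X) where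
  carrier := {x | ∀ σ : Equiv.Perm (Fin d), permT k σ x = x}
  add_mem' hx hy σ := by rw [map_add, hx σ, hy σ]
  zero_mem' σ := map_zero _
  smul_mem' c x hx σ := by rw [map_smul, hx σ]

variable {k} {X Y Z : Type u} [AddCommGroup X] [Module k X] [AddCommGroup Y] [Module k Y]
  [AddCommGroup Z] [Module k Z]

/-- The functoriality of `D^d` for linear maps. -/
def divPowMap (f : X →ₗ[k] Y) : divPow k d X →ₗ[k] divPow k d Y :=
  (PiTensorProduct.map fun _ => f).restrict fun x hx σ => by
    have h := PiTensorProduct.map_reindex (fun _ : Fin d => f) σ x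
    exact h.symm.trans (congrArg _ (hx σ))

theorem map₂_reindex (b : X →ₗ[k] Y →ₗ[k] Z) (σ : Equiv.Perm (Fin d))
    (x : ⨂[k] _ : Fin d, X) (y : ⨂[k] _ : Fin d, Y) :
    permT k σ (PiTensorProduct.map₂ (fun _ => b) x y) =
      PiTensorProduct.map₂ (fun _ => b) (permT k σ x) (permT k σ y) := by
  induction x using PiTensorProduct.induction_on with
  | add x x' hx hx' => simp only [map_add, LinearMap.add_apply, hx, hx']
  | smul_tprod r f =>
    induction y using PiTensorProduct.induction_on with
    | add y y' hy hy' => simp only [map_add, hy, hy']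
    | smul_tprod r' g =>
      simp only [map_smul, LinearMap.smul_apply, PiTensorProduct.map₂_tprod_tprod, permT_tprod]

/-- A bilinear map `X × Y → Z` induces a bilinear map `D^d(X) × D^d(Y) → D^d(Z)`, determined by
`x^{⊗ d}, y^{⊗ d} ↦ b(x, y)^{⊗ d}`. -/
def divPowMap₂ (b : X →ₗ[k] Y →ₗ[k] Z) : divPow k d X →ₗ[k] divPow k d Y →ₗ[k] divPow k d Z :=
  LinearMap.mk₂ k
    (fun x y => ⟨PiTensorProduct.map₂ (fun _ => b) x.1 y.1, fun σ => by
      rw [map₂_reindex, x.2 σ, y.2 σ]⟩)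
    (fun _ _ _ => Subtype.ext (by simp)) (fun _ _ _ => Subtype.ext (by simp))
    (fun _ _ _ => Subtype.ext (by simp)) (fun _ _ _ => Subtype.ext (by simp))

@[simp] theorem divPowMap_coe (f : X →ₗ[k] Y) (x : divPow k d X) :
    (divPowMap d f x : ⨂[k] _ : Fin d, Y) = PiTensorProduct.map (fun _ => f) x.1 := rfl

@[simp] theorem divPowMap₂_coe (b : X →ₗ[k] Y →ₗ[k] Z) (x : divPow k d X) (y : divPow k d Y) :
    (divPowMap₂ d b x y : ⨂[k] _ : Fin d, Z) = PiTensorProduct.map₂ (fun _ => b) x.1 y.1 := rfl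

/-- The element `x^{⊗ d}` of `D^d(X)`. -/
def divPowDiag (x : X) : divPow k d X :=
  ⟨PiTensorProduct.tprod k fun _ => x, fun σ => by
    rw [permT_tprod]⟩

@[simp] theorem divPowDiag_coe (x : X) :
    (divPowDiag (k := k) d x : ⨂[k] _ : Fin d, X) = PiTensorProduct.tprod k fun _ => x := rfl

end DividedPowers

section DivCat

/-- The category `Γ^d 𝒱` of divided powers: its objects are the finite dimensional vector
spaces. -/
structure DivCat (k : Type u) [Field k] (d : ℕ) where
  space : FGModuleCat.{u} k

variable {k : Type u} [Field k] {d : ℕ}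

/-- The morphisms of `Γ^d 𝒱` from `V` to `W` are the elements of `D^d(Hom(V, W))`. -/
instance : CategoryStruct (DivCat.{u} k d) where
  Hom V W := divPow k d (V.space →ₗ[k] W.space)
  id _ := divPowDiag d LinearMap.id
  comp {V W X} f g := divPowMap₂ d (LinearMap.llcomp k V.space W.space X.space) g f

theorem DivCat.id_coe (V : DivCat.{u} k d) :
    (𝟙 V : divPow k d (V.space →ₗ[k] V.space)) = divPowDiag d LinearMap.id := rfl

theorem DivCat.comp_def {V W X : DivCat.{u} k d} (f : V ⟶ W) (g : W ⟶ X) :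
    f ≫ g = divPowMap₂ d (LinearMap.llcomp k V.space W.space X.space) g f := rfl

theorem map₂_assoc {X₁ X₂ X₃ X₁₂ X₂₃ X₁₂₃ : Type u} [AddCommGroup X₁] [Module k X₁]
    [AddCommGroup X₂] [Module k X₂] [AddCommGroup X₃] [Module k X₃] [AddCommGroup X₁₂]
    [Module k X₁₂] [AddCommGroup X₂₃] [Module k X₂₃] [AddCommGroup X₁₂₃] [Module k X₁₂₃]
    (b : X₁ →ₗ[k] X₂ →ₗ[k] X₁₂) (b' : X₁₂ →ₗ[k] X₃ →ₗ[k] X₁₂₃)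
    (c : X₂ →ₗ[k] X₃ →ₗ[k] X₂₃) (c' : X₁ →ₗ[k] X₂₃ →ₗ[k] X₁₂₃)
    (h : ∀ x y z, b' (b x y) z = c' x (c y z))
    (x : ⨂[k] _ : Fin d, X₁) (y : ⨂[k] _ : Fin d, X₂) (z : ⨂[k] _ : Fin d, X₃) :
    PiTensorProduct.map₂ (fun _ => b') (PiTensorProduct.map₂ (fun _ => b) x y) z =
      PiTensorProduct.map₂ (fun _ => c') x (PiTensorProduct.map₂ (fun _ => c) y z) := by
  induction x using PiTensorProduct.induction_on with
  | add x x' hx hx' => simp only [map_add, LinearMap.add_apply, hx, hx']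
  | smul_tprod r f =>
    induction y using PiTensorProduct.induction_on with
    | add y y' hy hy' => simp only [map_add, LinearMap.add_apply, hy, hy']
    | smul_tprod r' g =>
      induction z using PiTensorProduct.induction_on with
      | add z z' hz hz' => simp only [map_add, hz, hz']
      | smul_tprod r'' w =>
        simp only [map_smul, LinearMap.smul_apply, PiTensorProduct.map₂_tprod_tprod, h]

theorem map₂_diag_left {X Y Z : Type u} [AddCommGroup X] [Module k X] [AddCommGroup Y]
    [Module k Y] [AddCommGroup Z] [Module k Z] (b : X →ₗ[k] Y →ₗ[k] Z) (x : X)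
    (y : ⨂[k] _ : Fin d, Y) :
    PiTensorProduct.map₂ (fun _ => b) (PiTensorProduct.tprod k fun _ => x) y =
      PiTensorProduct.map (fun _ => b x) y := by
  induction y using PiTensorProduct.induction_on with
  | add y y' hy hy' => simp only [map_add, hy, hy']
  | smul_tprod r g =>
    simp only [map_smul, PiTensorProduct.map₂_tprod_tprod, PiTensorProduct.map_tprod]

theorem map₂_diag_right {X Y Z : Type u} [AddCommGroup X] [Module k X] [AddCommGroup Y]
    [Module k Y] [AddCommGroup Z] [Module k Z] (b : X →ₗ[k] Y →ₗ[k] Z) (y : Y)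
    (x : ⨂[k] _ : Fin d, X) :
    PiTensorProduct.map₂ (fun _ => b) x (PiTensorProduct.tprod k fun _ => y) =
      PiTensorProduct.map (fun _ => b.flip y) x := by
  induction x using PiTensorProduct.induction_on with
  | add x x' hx hx' => simp only [map_add, LinearMap.add_apply, hx, hx']
  | smul_tprod r g =>
    simp only [map_smul, LinearMap.smul_apply, PiTensorProduct.map₂_tprod_tprod,
      PiTensorProduct.map_tprod, LinearMap.flip_apply]

theorem map_eq_self {X : Type u} [AddCommGroup X] [Module k X] (f : X →ₗ[k] X)
    (hf : ∀ x, f x = x) (x : ⨂[k] _ : Fin d, X) :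
    PiTensorProduct.map (fun _ => f) x = x := by
  obtain rfl : f = LinearMap.id := LinearMap.ext hf
  rw [PiTensorProduct.map_id]; rfl

instance : Category (DivCat.{u} k d) where
  id_comp {V W} f := Subtype.ext (by
    rw [DivCat.comp_def, divPowMap₂_coe, DivCat.id_coe, divPowDiag_coe, map₂_diag_right]
    exact map_eq_self _ (fun _ => rfl) _)
  comp_id {V W} f := Subtype.ext (by
    rw [DivCat.comp_def, divPowMap₂_coe, DivCat.id_coe, divPowDiag_coe, map₂_diag_left]
    exact map_eq_self _ (fun _ => rfl) _)
  assoc {V W X Y} f g h := Subtype.ext (by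
    simp only [DivCat.comp_def, divPowMap₂_coe]
    exact (map₂_assoc _ _ _ _ (fun _ _ _ => rfl) _ _ _).symm)

instance : Preadditive (DivCat.{u} k d) where
  homGroup V W := inferInstanceAs (AddCommGroup (divPow k d (V.space →ₗ[k] W.space)))
  add_comp {V W X} f f' g :=
    LinearMap.map_add (divPowMap₂ d (LinearMap.llcomp k V.space W.space X.space) g) f f'
  comp_add {V W X} f g g' :=
    LinearMap.map_add₂ (divPowMap₂ d (LinearMap.llcomp k V.space W.space X.space)) g g' f

instance : Linear k (DivCat.{u} k d) where
  homModule V W := inferInstanceAs (Module k (divPow k d (V.space →ₗ[k] W.space)))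
  smul_comp {V W X} r f g :=
    LinearMap.map_smul (divPowMap₂ d (LinearMap.llcomp k V.space W.space X.space) g) r f
  comp_smul {V W X} f r g :=
    LinearMap.map_smul₂ (divPowMap₂ d (LinearMap.llcomp k V.space W.space X.space)) r g f

instance (V W : DivCat.{u} k d) : Module.Finite k (V ⟶ W) :=
  inferInstanceAs (Module.Finite k (divPow k d (V.space →ₗ[k] W.space)))

end DivCat

section PolyFunctors

open Limits

/-- The `k`-linear functors from `Γ^d 𝒱` to finite dimensional vector spaces. -/
def isPoly (k : Type u) [Field k] (d : ℕ) : ObjectProperty (DivCat.{u} k d ⥤ FGModuleCat.{u} k) :=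
  fun F => F.Additive ∧ F.Linear k

/-- The category `𝒫_d` of homogeneous strict polynomial functors of degree `d` over `k`:
a functor `F` consists of a finite dimensional vector space `F(V)` for each finite dimensional
vector space `V`, and of linear maps `D^d(Hom(V, W)) → Hom(F(V), F(W))` compatible with
identities and composition. -/
abbrev PolyFunctor (k : Type u) [Field k] (d : ℕ) : Type (u + 1) :=
  (isPoly.{u} k d).FullSubcategory

variable {k : Type u} [Field k] {d : ℕ}

instance (F : PolyFunctor.{u} k d) : F.obj.Additive := F.property.1

instance (F : PolyFunctor.{u} k d) : F.obj.Linear k := F.property.2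

instance : (isPoly.{u} k d).IsClosedUnderSubobjects where
  prop_of_mono {F G} f _ hG := by
    obtain ⟨_, _⟩ := hG
    exact ⟨⟨fun {V W a b} => by
      rw [← cancel_mono (f.app W)]
      simp [Functor.map_add]⟩, ⟨fun {V W} a r => by
      rw [← cancel_mono (f.app W)]
      simp [Functor.map_smul]⟩⟩

instance : (isPoly.{u} k d).IsClosedUnderQuotients where
  prop_of_epi {F G} f _ hF := by
    obtain ⟨_, _⟩ := hF
    exact ⟨⟨fun {V W a b} => by
      rw [← cancel_epi (f.app V), Preadditive.comp_add, ← f.naturality, ← f.naturality,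
        ← f.naturality, Functor.map_add, Preadditive.add_comp]⟩, ⟨fun {V W} a r => by
      rw [← cancel_epi (f.app V), Linear.comp_smul, ← f.naturality, ← f.naturality,
        Functor.map_smul, Linear.smul_comp]⟩⟩

instance : (isPoly.{u} k d).ContainsZero where
  exists_zero := by
    obtain ⟨Z, hZ⟩ := HasZeroObject.zero (C := DivCat.{u} k d ⥤ FGModuleCat.{u} k)
    exact ⟨Z, hZ, ⟨fun {V W a b} => ((Functor.isZero_iff _).1 hZ V).eq_of_src _ _⟩,
      ⟨fun {V W} a r => ((Functor.isZero_iff _).1 hZ V).eq_of_src _ _⟩⟩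

instance : (isPoly.{u} k d).IsClosedUnderFiniteProducts where
  isClosedUnderLimitsOfShape J _ := ⟨by
    rintro F ⟨h⟩
    have hj := fun j => h.prop_diag_obj j
    have hl := fun V : DivCat.{u} k d =>
      isLimitOfPreserves ((evaluation (DivCat.{u} k d) (FGModuleCat.{u} k)).obj V) h.isLimit
    refine ⟨⟨fun {V W a b} => ?_⟩, ⟨fun {V W} a r => ?_⟩⟩
    · refine (hl W).hom_ext fun j => ?_
      have := (hj j).1
      have e := fun x : V ⟶ W => (h.π.app j).naturality x
      simp only [Functor.const_obj_obj] at e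
      simp only [Functor.mapCone_π_app, evaluation_obj_map]
      erw [Preadditive.add_comp]
      erw [e, e, e, Functor.map_add, Preadditive.comp_add]
    · refine (hl W).hom_ext fun j => ?_
      have := (hj j).1
      have := (hj j).2
      have e := fun x : V ⟶ W => (h.π.app j).naturality x
      simp only [Functor.const_obj_obj] at e
      simp only [Functor.mapCone_π_app, evaluation_obj_map]
      erw [Linear.smul_comp]
      erw [e, e, Functor.map_smul, Linear.comp_smul]⟩

noncomputable instance : Abelian (PolyFunctor.{u} k d) := inferInstance

instance : HasDerivedCategory (PolyFunctor.{u} k d) := HasDerivedCategory.standard _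

instance : PreservesFiniteLimits (isPoly.{u} k d).ι :=
  have := (isPoly.{u} k d).preservesKernels_ι
  Functor.preservesFiniteLimits_of_preservesKernels _

instance : PreservesFiniteColimits (isPoly.{u} k d).ι :=
  have := (isPoly.{u} k d).preservesCokernels_ι
  Functor.preservesFiniteColimits_of_preservesCokernels _

/-- Exactness in `𝒫_d` is pointwise exactness. -/
theorem exact_iff (S : ShortComplex (PolyFunctor.{u} k d)) :
    S.Exact ↔ ∀ V, Function.Exact (S.f.hom.app V).hom.hom (S.g.hom.app V).hom.hom := by
  rw [← ShortComplex.exact_map_iff_of_faithful S (isPoly.{u} k d).ι,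
    ShortComplex.exact_iff_isZero_homology, Functor.isZero_iff]
  refine forall_congr' fun V => ?_
  let T := (S.map (isPoly.{u} k d).ι)
  have e := T.mapHomologyIso ((evaluation (DivCat.{u} k d) (FGModuleCat.{u} k)).obj V)
  have h1 := e.isZero_iff
  refine h1.symm.trans ?_
  rw [← ShortComplex.exact_iff_isZero_homology,
    ← ShortComplex.exact_map_iff_of_faithful _ (forget₂ (FGModuleCat.{u} k) (ModuleCat.{u} k)),
    ShortComplex.moduleCat_exact_iff]
  exact ⟨fun h y => ⟨fun hy => h y hy, by
    rintro ⟨x, rfl⟩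
    exact congr($(((T.map ((evaluation _ _).obj V)).map
      (forget₂ (FGModuleCat.{u} k) (ModuleCat.{u} k))).zero) x)⟩, fun h y hy => (h y).1 hy⟩

theorem mono_iff {F G : PolyFunctor.{u} k d} (f : F ⟶ G) :
    Mono f ↔ ∀ V, Function.Injective (f.hom.app V).hom.hom := by
  rw [← (isPoly.{u} k d).ι.mono_map_iff_mono, NatTrans.mono_iff_mono_app]
  refine forall_congr' fun V => ?_
  rw [← (forget₂ (FGModuleCat.{u} k) (ModuleCat.{u} k)).mono_map_iff_mono,
    ModuleCat.mono_iff_injective]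
  rfl

end PolyFunctors

section Precomposition

variable {k : Type u} [Field k] {d e s : ℕ}

/-- Precomposition of strict polynomial functors with a linear functor `Γ^e 𝒱 ⥤ Γ^d 𝒱`. -/
def precomp (Φ : DivCat.{u} k e ⥤ DivCat.{u} k d) [Φ.Additive] [Φ.Linear k] :
    PolyFunctor.{u} k d ⥤ PolyFunctor.{u} k e where
  obj F := ⟨Φ ⋙ F.obj, inferInstance, inferInstance⟩
  map f := ObjectProperty.homMk (Functor.whiskerLeft Φ f.hom)

theorem map₂_interchange {X₁ X₂ X₃ X₄ Y₁ Y₂ Z₁ Z₂ T : Type u}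
    [AddCommGroup X₁] [Module k X₁] [AddCommGroup X₂] [Module k X₂]
    [AddCommGroup X₃] [Module k X₃] [AddCommGroup X₄] [Module k X₄]
    [AddCommGroup Y₁] [Module k Y₁] [AddCommGroup Y₂] [Module k Y₂]
    [AddCommGroup Z₁] [Module k Z₁] [AddCommGroup Z₂] [Module k Z₂]
    [AddCommGroup T] [Module k T]
    (b₁ : X₁ →ₗ[k] X₂ →ₗ[k] Y₁) (b₂ : X₃ →ₗ[k] X₄ →ₗ[k] Y₂) (b : Y₁ →ₗ[k] Y₂ →ₗ[k] T)
    (c₁ : X₁ →ₗ[k] X₃ →ₗ[k] Z₁) (c₂ : X₂ →ₗ[k] X₄ →ₗ[k] Z₂) (c : Z₁ →ₗ[k] Z₂ →ₗ[k] T)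
    (h : ∀ x₁ x₂ x₃ x₄, b (b₁ x₁ x₂) (b₂ x₃ x₄) = c (c₁ x₁ x₃) (c₂ x₂ x₄))
    (x₁ : ⨂[k] _ : Fin d, X₁) (x₂ : ⨂[k] _ : Fin d, X₂) (x₃ : ⨂[k] _ : Fin d, X₃)
    (x₄ : ⨂[k] _ : Fin d, X₄) :
    PiTensorProduct.map₂ (fun _ => b) (PiTensorProduct.map₂ (fun _ => b₁) x₁ x₂)
        (PiTensorProduct.map₂ (fun _ => b₂) x₃ x₄) =
      PiTensorProduct.map₂ (fun _ => c) (PiTensorProduct.map₂ (fun _ => c₁) x₁ x₃)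
        (PiTensorProduct.map₂ (fun _ => c₂) x₂ x₄) := by
  induction x₁ using PiTensorProduct.induction_on with
  | add x x' hx hx' => simp only [map_add, LinearMap.add_apply, hx, hx']
  | smul_tprod r f =>
    induction x₂ using PiTensorProduct.induction_on with
    | add x x' hx hx' => simp only [map_add, LinearMap.add_apply, hx, hx']
    | smul_tprod r f =>
      induction x₃ using PiTensorProduct.induction_on with
      | add x x' hx hx' => simp only [map_add, LinearMap.add_apply, hx, hx']
      | smul_tprod r f =>
        induction x₄ using PiTensorProduct.induction_on with
        | add x x' hx hx' => simp only [map_add, hx, hx']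
        | smul_tprod r f =>
          simp only [map_smul, LinearMap.smul_apply, PiTensorProduct.map₂_tprod_tprod, h]
          simp only [smul_smul]
          congr 1
          ring

/-- The tensor product of two objects of `Γ^d 𝒱`. -/
def tensorObj (V W : DivCat.{u} k d) : DivCat.{u} k d :=
  ⟨FGModuleCat.of k (V.space ⊗[k] W.space)⟩

/-- The external product `D^d(Hom(V, V')) × D^d(Hom(W, W')) → D^d(Hom(V ⊗ W, V' ⊗ W'))`. -/
def tensorHom {V V' W W' : DivCat.{u} k d} (f : V ⟶ V') (g : W ⟶ W') :
    tensorObj V W ⟶ tensorObj V' W' :=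
  divPowMap₂ d (TensorProduct.mapBilinear (RingHom.id k) V.space W.space V'.space W'.space) f g

theorem tensorHom_id (V W : DivCat.{u} k d) : tensorHom (𝟙 V) (𝟙 W) = 𝟙 (tensorObj V W) :=
  Subtype.ext (by
    erw [divPowMap₂_coe, DivCat.id_coe, DivCat.id_coe, divPowDiag_coe, divPowDiag_coe,
      PiTensorProduct.map₂_tprod_tprod]
    congr 1
    funext i
    exact TensorProduct.map_id)

theorem tensorHom_comp {V V' V'' W W' W'' : DivCat.{u} k d} (f : V ⟶ V') (f' : V' ⟶ V'')
    (g : W ⟶ W') (g' : W' ⟶ W'') :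
    tensorHom (f ≫ f') (g ≫ g') = tensorHom f g ≫ tensorHom f' g' :=
  Subtype.ext (map₂_interchange _ _ _ _ _ _
    (fun _ _ _ _ => TensorProduct.map_comp _ _ _ _) _ _ _ _)

/-- The functor `V ↦ U ⊗ V` on `Γ^d 𝒱`. -/
def tensorLeft (d : ℕ) (U : FGModuleCat.{u} k) : DivCat.{u} k d ⥤ DivCat.{u} k d where
  obj V := tensorObj ⟨U⟩ V
  map f := tensorHom (𝟙 _) f
  map_id V := tensorHom_id _ _
  map_comp f g := by rw [← tensorHom_comp, Category.id_comp]

instance (U : FGModuleCat.{u} k) : (tensorLeft d U).Additive where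
  map_add {V W f g} := LinearMap.map_add (divPowMap₂ d (TensorProduct.mapBilinear (RingHom.id k)
    U V.space U W.space) (divPowDiag d LinearMap.id)) f g

instance (U : FGModuleCat.{u} k) : (tensorLeft d U).Linear k where
  map_smul {V W} f r := LinearMap.map_smul (divPowMap₂ d (TensorProduct.mapBilinear (RingHom.id k)
    U V.space U W.space) (divPowDiag d LinearMap.id)) r f

/-- The transpose `D^d(Hom(V, W)) → D^d(Hom(W^*, V^*))`. -/
def transposeDiv {V W : DivCat.{u} k d} :
    (V ⟶ W) →ₗ[k] ((⟨FGModuleCat.of k (Module.Dual k W.space)⟩ : DivCat.{u} k d) ⟶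
      ⟨FGModuleCat.of k (Module.Dual k V.space)⟩) :=
  divPowMap d (Module.Dual.transpose (R := k) (M := V.space) (M' := W.space))

theorem transposeDiv_id (V : DivCat.{u} k d) : transposeDiv (𝟙 V) = 𝟙 _ := Subtype.ext (by
  change PiTensorProduct.map _ (PiTensorProduct.tprod k _) = PiTensorProduct.tprod k _
  rw [PiTensorProduct.map_tprod]
  rfl)

theorem transposeDiv_comp {V W X : DivCat.{u} k d} (f : V ⟶ W) (g : W ⟶ X) :
    transposeDiv (f ≫ g) = transposeDiv g ≫ transposeDiv f := Subtype.ext (by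
  change PiTensorProduct.map _ (PiTensorProduct.map₂ _ g.1 f.1) =
    PiTensorProduct.map₂ _ (PiTensorProduct.map _ f.1) (PiTensorProduct.map _ g.1)
  generalize g.1 = x
  generalize f.1 = y
  induction x using PiTensorProduct.induction_on with
  | add x x' hx hx' => simp only [map_add, LinearMap.add_apply, hx, hx']
  | smul_tprod r f =>
    induction y using PiTensorProduct.induction_on with
    | add x x' hx hx' => simp only [map_add, LinearMap.add_apply, hx, hx']
    | smul_tprod r f =>
      simp only [map_smul, LinearMap.smul_apply, PiTensorProduct.map₂_tprod_tprod,
        PiTensorProduct.map_tprod]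
      rw [smul_comm]
      rfl)

end Precomposition

section Inflation

variable {k : Type u} [Field k] {d s : ℕ}

theorem flatten_update {X : Type u} [AddCommGroup X] [Module k X] (f : Fin (d * s) → X)
    (m : Fin (d * s)) (x : X) :
    (fun i : Fin d => PiTensorProduct.tprod k fun j : Fin s =>
        Function.update f m x (finProdFinEquiv (i, j))) =
      Function.update
        (fun i : Fin d => PiTensorProduct.tprod k fun j : Fin s => f (finProdFinEquiv (i, j)))
        (finProdFinEquiv.symm m).1
        (PiTensorProduct.tprod k (Function.update
          (fun j : Fin s => f (finProdFinEquiv ((finProdFinEquiv.symm m).1, j)))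
          (finProdFinEquiv.symm m).2 x)) := by
  obtain ⟨⟨i₀, j₀⟩, rfl⟩ := finProdFinEquiv.surjective m
  simp only [Equiv.symm_apply_apply]
  funext i
  by_cases hi : i = i₀
  · subst hi
    simp only [Function.update_self]
    congr 1
    funext j
    by_cases hj : j = j₀
    · subst hj; simp
    · rw [Function.update_of_ne hj, Function.update_of_ne]
      simpa using hj
  · rw [Function.update_of_ne hi]
    congr 1
    funext j
    rw [Function.update_of_ne]
    simp [hi]

/-- The identification `X^{⊗ ds} → (X^{⊗ s})^{⊗ d}`. -/
def flatten (X : Type u) [AddCommGroup X] [Module k X] :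
    (⨂[k] _ : Fin (d * s), X) →ₗ[k] ⨂[k] _ : Fin d, ⨂[k] _ : Fin s, X :=
  PiTensorProduct.lift
    { toFun := fun f => PiTensorProduct.tprod k fun i => PiTensorProduct.tprod k fun j =>
        f (finProdFinEquiv (i, j))
      map_update_add' := fun {inst} f m x y => by
        obtain rfl : inst = instDecidableEqFin _ := Subsingleton.elim _ _
        simp only [flatten_update, MultilinearMap.map_update_add]
      map_update_smul' := fun {inst} f m c x => by
        obtain rfl : inst = instDecidableEqFin _ := Subsingleton.elim _ _
        simp only [flatten_update, MultilinearMap.map_update_smul] }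

variable {X Y Z : Type u} [AddCommGroup X] [Module k X] [AddCommGroup Y] [Module k Y]
  [AddCommGroup Z] [Module k Z]

theorem flatten_tprod (f : Fin (d * s) → X) :
    flatten X (PiTensorProduct.tprod k f) =
      PiTensorProduct.tprod k fun i => PiTensorProduct.tprod k fun j =>
        f (finProdFinEquiv (i, j)) :=
  PiTensorProduct.lift.tprod _

theorem flatten_map₂ (b : X →ₗ[k] Y →ₗ[k] Z) (x : ⨂[k] _ : Fin (d * s), X)
    (y : ⨂[k] _ : Fin (d * s), Y) :
    flatten Z (PiTensorProduct.map₂ (fun _ => b) x y) =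
      PiTensorProduct.map₂ (fun _ => PiTensorProduct.map₂ fun _ => b) (flatten X x)
        (flatten Y y) := by
  induction x using PiTensorProduct.induction_on with
  | add x x' hx hx' => simp only [map_add, LinearMap.add_apply, hx, hx']
  | smul_tprod r f =>
    induction y using PiTensorProduct.induction_on with
    | add x x' hx hx' => simp only [map_add, hx, hx']
    | smul_tprod r f =>
      simp only [map_smul, LinearMap.smul_apply, PiTensorProduct.map₂_tprod_tprod, flatten_tprod]

/-- A chosen linear retraction of `X^{⊗ s}` onto the subspace of symmetric tensors. -/
def retr (s : ℕ) (X : Type u) [AddCommGroup X] [Module k X] :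
    (⨂[k] _ : Fin s, X) →ₗ[k] divPow k s X :=
  (LinearMap.exists_leftInverse_of_injective (divPow k s X).subtype (by simp)).choose

theorem retr_coe (x : divPow k s X) : retr s X x.1 = x :=
  LinearMap.congr_fun
    (LinearMap.exists_leftInverse_of_injective (divPow k s X).subtype (by simp)).choose_spec x

/-- The linear projection of `X^{⊗ s}` onto the symmetric tensors factors through the maps
`σ - 1`, for `σ` in the symmetric group. -/
theorem exists_factor (s : ℕ) (X : Type u) [AddCommGroup X] [Module k X] :
    ∃ L : Equiv.Perm (Fin s) → ((⨂[k] _ : Fin s, X) →ₗ[k] ⨂[k] _ : Fin s, X),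
      (divPow k s X).subtype ∘ₗ retr s X = LinearMap.id +
        ∑ σ, L σ ∘ₗ (permT k σ - LinearMap.id) := by
  let D : (⨂[k] _ : Fin s, X) →ₗ[k] (Equiv.Perm (Fin s) → ⨂[k] _ : Fin s, X) :=
    LinearMap.pi fun σ => permT k σ - LinearMap.id
  have hker : LinearMap.ker D ≤
      LinearMap.ker ((divPow k s X).subtype ∘ₗ retr s X - LinearMap.id) := by
    intro x hx
    have hx' : x ∈ divPow k s X := fun σ => sub_eq_zero.1 (congrFun hx σ)
    have := retr_coe (⟨x, hx'⟩ : divPow k s X)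
    simp only [LinearMap.mem_ker, LinearMap.sub_apply, LinearMap.comp_apply, LinearMap.id_apply,
      this, Submodule.subtype_apply, sub_self]
  obtain ⟨g, hg⟩ := LinearMap.exists_extend
    ((LinearMap.ker D).liftQ _ hker ∘ₗ D.quotKerEquivRange.symm.toLinearMap)
  have hg' : g ∘ₗ D = (divPow k s X).subtype ∘ₗ retr s X - LinearMap.id := by
    ext1
    refine MultilinearMap.ext fun f => ?_
    have := LinearMap.congr_fun hg (D.rangeRestrict (PiTensorProduct.tprod k f))
    have e : D.quotKerEquivRange.symm (D.rangeRestrict (PiTensorProduct.tprod k f)) =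
        (LinearMap.ker D).mkQ (PiTensorProduct.tprod k f) := by
      rw [LinearEquiv.symm_apply_eq]
      exact Subtype.ext rfl
    simp only [LinearMap.comp_apply, LinearEquiv.coe_coe, e] at this
    exact this
  refine ⟨fun σ => g ∘ₗ LinearMap.single k (fun _ => ⨂[k] _ : Fin s, X) σ, ?_⟩
  rw [← sub_eq_iff_eq_add', ← hg']
  refine LinearMap.ext fun x => ?_
  simp only [LinearMap.comp_apply, LinearMap.sum_apply]
  rw [← map_sum]
  congr 1
  exact (Finset.univ_sum_single (D x)).symm

/-- Tensors invariant under all permutations inside the blocks come from tensors of symmetric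
tensors. -/
theorem map_proj_eq (x : ⨂[k] _ : Fin d, ⨂[k] _ : Fin s, X)
    (hx : ∀ (i : Fin d) (σ : Equiv.Perm (Fin s)),
      PiTensorProduct.map (Function.update (fun _ => LinearMap.id) i (permT k σ)) x = x) :
    PiTensorProduct.map (fun _ => (divPow k s X).subtype ∘ₗ retr s X) x = x := by
  classical
  obtain ⟨L, hL⟩ := exists_factor (k := k) s X
  set p := (divPow k s X).subtype ∘ₗ retr s X with hp
  have h1 : ∀ i : Fin d,
      PiTensorProduct.map (Function.update (fun _ => LinearMap.id) i p) x = x := by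
    intro i
    have : ∀ σ, PiTensorProduct.map (Function.update (fun _ => LinearMap.id) i
        (L σ ∘ₗ (permT k σ - LinearMap.id))) x = 0 := by
      intro σ
      have e1 : Function.update (fun _ : Fin d => (LinearMap.id : (⨂[k] _ : Fin s, X) →ₗ[k] _)) i
          (L σ ∘ₗ (permT k σ - LinearMap.id)) =
          fun j => Function.update (fun _ => LinearMap.id) i (L σ) j ∘ₗ
            Function.update (fun _ => LinearMap.id) i (permT k σ - LinearMap.id) j := by
        funext j
        by_cases hj : j = i
        · subst hj; simp
        · simp [Function.update_of_ne hj]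
      have e2 : PiTensorProduct.map (Function.update (fun _ : Fin d =>
          (LinearMap.id : (⨂[k] _ : Fin s, X) →ₗ[k] _)) i (permT k σ - LinearMap.id)) x = 0 := by
        have h3 := PiTensorProduct.map_update_add (fun _ : Fin d =>
          (LinearMap.id : (⨂[k] _ : Fin s, X) →ₗ[k] _)) i (permT k σ - LinearMap.id) LinearMap.id
        rw [sub_add_cancel, Function.update_eq_self, PiTensorProduct.map_id] at h3
        have h4 := LinearMap.congr_fun h3 x
        rw [hx i σ, LinearMap.add_apply, LinearMap.id_apply] at h4
        exact add_eq_right.1 h4.symm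
      rw [e1, PiTensorProduct.map_comp, LinearMap.comp_apply, e2, map_zero]
    rw [hL, PiTensorProduct.map_update_add, LinearMap.add_apply, Function.update_eq_self,
      PiTensorProduct.map_id, LinearMap.id_apply]
    have h2 := (PiTensorProduct.mapMultilinear k (fun _ : Fin d => ⨂[k] _ : Fin s, X)
          (fun _ : Fin d => ⨂[k] _ : Fin s, X)).map_update_sum Finset.univ i
          (fun σ => L σ ∘ₗ (permT k σ - LinearMap.id)) (fun _ => LinearMap.id)
    simp only [PiTensorProduct.mapMultilinear_apply] at h2
    rw [h2, LinearMap.sum_apply, Finset.sum_eq_zero fun σ _ => this σ, add_zero]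
  have h2 : ∀ S : Finset (Fin d),
      PiTensorProduct.map (fun j => if j ∈ S then p else LinearMap.id) x = x := by
    intro S
    induction S using Finset.induction_on with
    | empty => simp
    | insert i S hi ih =>
      have e : (fun j => if j ∈ insert i S then p else LinearMap.id) =
          fun j => (if j ∈ S then p else LinearMap.id) ∘ₗ
            Function.update (fun _ => LinearMap.id) i p j := by
        funext j
        by_cases hj : j = i
        · subst hj; simp [hi]
        · simp [hj]
      rw [e, PiTensorProduct.map_comp, LinearMap.comp_apply, h1, ih]
  simpa using h2 Finset.univ

theorem map_map₂ {X' Y' Z' : Type u} [AddCommGroup X'] [Module k X'] [AddCommGroup Y']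
    [Module k Y'] [AddCommGroup Z'] [Module k Z'] (b : X →ₗ[k] Y →ₗ[k] Z)
    (b' : X' →ₗ[k] Y' →ₗ[k] Z') (f : X →ₗ[k] X') (g : Y →ₗ[k] Y') (h : Z →ₗ[k] Z')
    (hb : ∀ x y, h (b x y) = b' (f x) (g y)) (x : ⨂[k] _ : Fin d, X) (y : ⨂[k] _ : Fin d, Y) :
    PiTensorProduct.map (fun _ => h) (PiTensorProduct.map₂ (fun _ => b) x y) =
      PiTensorProduct.map₂ (fun _ => b') (PiTensorProduct.map (fun _ => f) x)
        (PiTensorProduct.map (fun _ => g) y) := by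
  induction x using PiTensorProduct.induction_on with
  | add x x' hx hx' => simp only [map_add, LinearMap.add_apply, hx, hx']
  | smul_tprod r f =>
    induction y using PiTensorProduct.induction_on with
    | add x x' hx hx' => simp only [map_add, hx, hx']
    | smul_tprod r f =>
      simp only [map_smul, LinearMap.smul_apply, PiTensorProduct.map₂_tprod_tprod,
        PiTensorProduct.map_tprod, hb]

theorem permT_flatten (ρ : Equiv.Perm (Fin d)) (x : ⨂[k] _ : Fin (d * s), X) :
    permT k ρ (flatten X x) =
      flatten X (permT k (finProdFinEquiv.permCongr (Equiv.prodCongr ρ (Equiv.refl _))) x) := by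
  induction x using PiTensorProduct.induction_on with
  | add x x' hx hx' => simp only [map_add, hx, hx']
  | smul_tprod r f =>
    simp only [map_smul, flatten_tprod, permT_tprod]
    congr 4
    funext i
    congr 1
    funext j
    congr 1
    simp [Equiv.eq_symm_apply, Equiv.permCongr_apply]

theorem map_update_flatten (i₀ : Fin d) (σ : Equiv.Perm (Fin s)) (x : ⨂[k] _ : Fin (d * s), X) :
    PiTensorProduct.map (Function.update (fun _ => LinearMap.id) i₀ (permT k σ)) (flatten X x) =
      flatten X (permT k (finProdFinEquiv.permCongr (Equiv.prodShear (Equiv.refl _)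
        fun i => if i = i₀ then σ else Equiv.refl _)) x) := by
  induction x using PiTensorProduct.induction_on with
  | add x x' hx hx' => simp only [map_add, hx, hx']
  | smul_tprod r f =>
    simp only [map_smul, flatten_tprod, permT_tprod, PiTensorProduct.map_tprod]
    congr 4
    funext i
    by_cases hi : i = i₀
    · subst hi
      rw [Function.update_self, permT_tprod]
      congr 1
      funext j
      congr 1
      simp [Equiv.eq_symm_apply, Equiv.permCongr_apply]
    · rw [Function.update_of_ne hi, LinearMap.id_apply]
      congr 1
      funext j
      congr 1
      simp [Equiv.eq_symm_apply, Equiv.permCongr_apply, hi]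

theorem mapIncl_injective : Function.Injective
    (PiTensorProduct.map (R := k) fun _ : Fin d => (divPow k s X).subtype) := by
  refine Function.LeftInverse.injective
    (g := PiTensorProduct.map fun _ : Fin d => retr s X) fun x => ?_
  rw [← LinearMap.comp_apply, ← PiTensorProduct.map_comp]
  exact map_eq_self _ (fun y => retr_coe y) x

/-- The comultiplication-type map `D^{ds}(X) → D^d(D^s(X))`, characterised by `coe_block`: it is
the inclusion of the `Σ_{ds}`-invariants of `X^{⊗ ds}` into the invariants of `Σ_d` on the
`d`-th tensor power of `D^s(X)`. -/
def block (d s : ℕ) (X : Type u) [AddCommGroup X] [Module k X] :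
    divPow k (d * s) X →ₗ[k] divPow k d (divPow k s X) :=
  LinearMap.codRestrict _
    ((PiTensorProduct.map fun _ => retr s X) ∘ₗ flatten X ∘ₗ (divPow k (d * s) X).subtype)
    fun x ρ => by
      have h := PiTensorProduct.map_reindex (fun _ : Fin d => retr (k := k) s X) ρ (flatten X x.1)
      refine h.symm.trans (congrArg _ ?_)
      exact (permT_flatten ρ x.1).trans (congrArg _ (x.2 _))

theorem coe_block (x : divPow k (d * s) X) :
    PiTensorProduct.map (fun _ => (divPow k s X).subtype) (block d s X x).1 = flatten X x.1 := by
  change PiTensorProduct.map _ (PiTensorProduct.map _ (flatten X x.1)) = _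
  rw [← LinearMap.comp_apply, ← PiTensorProduct.map_comp]
  refine map_proj_eq _ fun i σ => ?_
  rw [map_update_flatten, x.2]

theorem block_diag (x : X) :
    block (k := k) d s X (divPowDiag (d * s) x) = divPowDiag d (divPowDiag s x) := by
  refine Subtype.ext (mapIncl_injective ?_)
  rw [coe_block, divPowDiag_coe, divPowDiag_coe, flatten_tprod, PiTensorProduct.map_tprod]
  rfl

theorem block_map₂ (b : X →ₗ[k] Y →ₗ[k] Z) (x : divPow k (d * s) X) (y : divPow k (d * s) Y) :
    block d s Z (divPowMap₂ (d * s) b x y) =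
      divPowMap₂ d (divPowMap₂ s b) (block d s X x) (block d s Y y) := by
  refine Subtype.ext (mapIncl_injective ?_)
  rw [coe_block, divPowMap₂_coe, flatten_map₂, divPowMap₂_coe,
    map_map₂ _ (PiTensorProduct.map₂ fun _ => b) (divPow k s X).subtype (divPow k s Y).subtype _
      (fun _ _ => rfl), coe_block, coe_block]

/-- The structure map `D^s(Hom(V, W)) → Hom(A(V), A(W))` of a strict polynomial functor. -/
def structureMap (A : PolyFunctor.{u} k s) (V W : FGModuleCat.{u} k) :
    divPow k s (V →ₗ[k] W) →ₗ[k] (A.obj.obj ⟨V⟩ →ₗ[k] A.obj.obj ⟨W⟩) where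
  toFun x := (A.obj.map (X := ⟨V⟩) (Y := ⟨W⟩) x).hom.hom
  map_add' x y := by
    have := A.obj.map_add (X := ⟨V⟩) (Y := ⟨W⟩) (f := x) (g := y)
    exact congrArg (fun f => f.hom.hom) this
  map_smul' r x := by
    have := A.obj.map_smul (X := ⟨V⟩) (Y := ⟨W⟩) r x
    exact congrArg (fun f => f.hom.hom) this

theorem structureMap_comp (A : PolyFunctor.{u} k s) (V W X : FGModuleCat.{u} k)
    (g : divPow k s (W →ₗ[k] X)) (f : divPow k s (V →ₗ[k] W)) :
    structureMap A V X (divPowMap₂ s (LinearMap.llcomp k V W X) g f) =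
      LinearMap.llcomp k _ _ _ (structureMap A W X g) (structureMap A V W f) :=
  congrArg (fun f => f.hom.hom) (A.obj.map_comp (X := ⟨V⟩) (Y := ⟨W⟩) (Z := ⟨X⟩) f g)

theorem structureMap_id (A : PolyFunctor.{u} k s) (V : FGModuleCat.{u} k) :
    structureMap A V V (divPowDiag s LinearMap.id) = LinearMap.id :=
  congrArg (fun f => f.hom.hom) (A.obj.map_id ⟨V⟩)

/-- The map `D^{ds}(Hom(V, W)) → D^d(D^s(Hom(V, W))) → D^d(Hom(A(V), A(W)))`. -/
def inflateMap (d : ℕ) (A : PolyFunctor.{u} k s) (V W : FGModuleCat.{u} k) :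
    divPow k (d * s) (V →ₗ[k] W) →ₗ[k] divPow k d (A.obj.obj ⟨V⟩ →ₗ[k] A.obj.obj ⟨W⟩) :=
  divPowMap d (structureMap A V W) ∘ₗ block d s (V →ₗ[k] W)

theorem inflateMap_comp (A : PolyFunctor.{u} k s) (V W X : FGModuleCat.{u} k)
    (g : divPow k (d * s) (W →ₗ[k] X)) (f : divPow k (d * s) (V →ₗ[k] W)) :
    inflateMap d A V X (divPowMap₂ (d * s) (LinearMap.llcomp k V W X) g f) =
      divPowMap₂ d (LinearMap.llcomp k _ _ _) (inflateMap d A W X g) (inflateMap d A V W f) :=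
  Subtype.ext (by
    rw [inflateMap, LinearMap.comp_apply, block_map₂, divPowMap_coe, divPowMap₂_coe]
    exact map_map₂ _ _ _ _ _ (fun x y => structureMap_comp A V W X x y) _ _)

theorem inflateMap_id (A : PolyFunctor.{u} k s) (V : FGModuleCat.{u} k) :
    inflateMap d A V V (divPowDiag (d * s) LinearMap.id) = divPowDiag d LinearMap.id :=
  Subtype.ext (by
    rw [inflateMap, LinearMap.comp_apply, block_diag, divPowMap_coe, divPowDiag_coe,
      PiTensorProduct.map_tprod, divPowDiag_coe]
    congr 1
    funext _
    exact structureMap_id A V)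

/-- The linear functor `Γ^{ds} 𝒱 ⥤ Γ^d 𝒱` given by `V ↦ A(V)`, induced by `A ∈ 𝒫_s`. -/
def inflate (d : ℕ) (A : PolyFunctor.{u} k s) : DivCat.{u} k (d * s) ⥤ DivCat.{u} k d where
  obj V := ⟨A.obj.obj ⟨V.space⟩⟩
  map {V W} f := inflateMap d A V.space W.space f
  map_id V := inflateMap_id A V.space
  map_comp {V W X} f g := inflateMap_comp A V.space W.space X.space g f

instance (A : PolyFunctor.{u} k s) : (inflate d A).Additive where
  map_add {V W f g} := LinearMap.map_add (inflateMap d A V.space W.space) f g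

instance (A : PolyFunctor.{u} k s) : (inflate d A).Linear k where
  map_smul {V W} f r := LinearMap.map_smul (inflateMap d A V.space W.space) r f

/-- The precomposition functor `𝐂_A : 𝒫_d ⥤ 𝒫_{ds}`, `𝐂_A(F)(V) = F(A(V))`. -/
def precompA (d : ℕ) (A : PolyFunctor.{u} k s) : PolyFunctor.{u} k d ⥤ PolyFunctor.{u} k (d * s) :=
  precomp (inflate d A)

end Inflation

section Generators

variable {k : Type u} [Field k] {d e : ℕ}

/-- The object `k^d` of `Γ^d 𝒱`. -/
def stdObj (k : Type u) [Field k] (d : ℕ) : DivCat.{u} k d := ⟨FGModuleCat.of k (Fin d → k)⟩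

theorem exists_retract_through_std {V : Type u} [AddCommGroup V] [Module k V] [Module.Finite k V]
    (W : Submodule k V) (hW : Module.finrank k W ≤ d) :
    ∃ (ρ : V →ₗ[k] (Fin d → k)) (ι : (Fin d → k) →ₗ[k] V), ∀ w ∈ W, ι (ρ w) = w := by
  obtain ⟨j, hj⟩ : ∃ j : W →ₗ[k] (Fin d → k), Function.Injective j := by
    let b := Module.finBasis k W
    refine ⟨(LinearMap.funLeft k k fun m : Fin d =>
      (m : ℕ)) ∘ₗ LinearMap.pi (fun n : ℕ => if h : n < Module.finrank k W then b.coord ⟨n, h⟩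
        else 0), ?_⟩
    rw [← LinearMap.ker_eq_bot, LinearMap.ker_eq_bot']
    intro w hw
    rw [← b.forall_coord_eq_zero_iff]
    intro i
    have := congrFun hw ⟨i, lt_of_lt_of_le i.2 hW⟩
    simpa [LinearMap.funLeft_apply] using this
  obtain ⟨ρ, hρ⟩ := LinearMap.exists_extend j
  obtain ⟨l, hl⟩ := LinearMap.exists_leftInverse_of_injective j (LinearMap.ker_eq_bot.2 hj)
  refine ⟨ρ, W.subtype ∘ₗ l, fun w hw => ?_⟩
  have h1 : ρ w = j ⟨w, hw⟩ := LinearMap.congr_fun hρ ⟨w, hw⟩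
  have h2 : l (j ⟨w, hw⟩) = ⟨w, hw⟩ := LinearMap.congr_fun hl _
  rw [LinearMap.comp_apply, h1, h2]
  rfl

/-- For a family of endomorphisms `P i` and a symmetric set of indices, the sum of the tensors
`P (f 1) ⊗ ⋯ ⊗ P (f d)` is a symmetric tensor. -/
def symSum {X : Type u} [AddCommGroup X] [Module k X] {ι : Type} (P : ι → X)
    (S : Finset (Fin d → ι)) (hS : ∀ f ∈ S, ∀ σ : Equiv.Perm (Fin d), f ∘ σ ∈ S) :
    divPow k d X :=
  ⟨∑ f ∈ S, PiTensorProduct.tprod k fun r => P (f r), fun σ => by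
    rw [map_sum]
    simp only [permT_tprod]
    refine Finset.sum_bij' (fun f _ => f ∘ σ.symm) (fun f _ => f ∘ σ) (fun f hf => hS f hf _)
      (fun f hf => hS f hf _) ?_ ?_ ?_
    · intro f _; funext r; simp
    · intro f _; funext r; simp
    · intro f _; rfl⟩

/-- Every object of `Γ^d 𝒱` is a retract of a finite sum of copies of `k^d`. -/
theorem exists_factor_std (V : DivCat.{u} k d) :
    ∃ (J : Type) (_ : Fintype J) (a : J → (V ⟶ stdObj k d)) (b : J → (stdObj k d ⟶ V)),
      ∑ j, a j ≫ b j = 𝟙 V := by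
  classical
  let n := Module.finrank k V.space
  let B : Module.Basis (Fin n) k V.space := Module.finBasis k V.space
  let P : Fin n → (V.space →ₗ[k] V.space) := fun i => (B.coord i).smulRight (B i)
  let im : (Fin d → Fin n) → Finset (Fin n) := fun f => Finset.univ.image f
  have hT : ∀ T : Finset (Fin n), ∃ (ρ : V.space →ₗ[k] (Fin d → k))
      (ι : (Fin d → k) →ₗ[k] V.space), T.card ≤ d → ∀ i ∈ T, ∀ v, ι (ρ (P i v)) = P i v := by
    intro T
    by_cases h : T.card ≤ d
    · obtain ⟨ρ, ι, hι⟩ := exists_retract_through_std (d := d)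
        (Submodule.span k (T.image B : Set V.space))
        ((finrank_span_finset_le_card _).trans (Finset.card_image_le.trans h))
      refine ⟨ρ, ι, fun _ i hi v => hι _ ?_⟩
      exact Submodule.smul_mem _ _ (Submodule.subset_span (by
        simpa using ⟨i, hi, rfl⟩))
    · exact ⟨0, 0, fun h' => absurd h' h⟩
  choose ρ ι hι using hT
  let q : Finset (Fin n) → (V ⟶ V) := fun T =>
    symSum P (Finset.univ.filter fun f => im f = T) (fun f hf σ => by
      simp only [Finset.mem_filter, Finset.mem_univ, true_and] at hf ⊢
      rw [← hf]
      ext i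
      simp only [im, Finset.mem_image, Finset.mem_univ, true_and, Function.comp]
      exact ⟨fun ⟨a, h⟩ => ⟨σ a, h⟩, fun ⟨a, h⟩ => ⟨σ.symm a, by simpa using h⟩⟩)
  refine ⟨Finset (Fin n), inferInstance,
    fun T => q T ≫ (divPowDiag d (ρ T) : divPow k d (V.space →ₗ[k] (stdObj k d).space)),
    fun T => (divPowDiag d (ι T) : divPow k d ((stdObj k d).space →ₗ[k] V.space)), ?_⟩
  have key : ∀ T, (q T ≫ (divPowDiag d (ρ T) : divPow k d (V.space →ₗ[k] (stdObj k d).space))) ≫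
      (show stdObj k d ⟶ V from
        (divPowDiag d (ι T) : divPow k d ((stdObj k d).space →ₗ[k] V.space))) = q T := by
    intro T
    refine Subtype.ext ?_
    change PiTensorProduct.map₂ _ (PiTensorProduct.tprod k _)
      (PiTensorProduct.map₂ _ (PiTensorProduct.tprod k _) (∑ f ∈ _, _)) = ∑ f ∈ _, _
    rw [map_sum, map_sum]
    refine Finset.sum_congr rfl fun f hf => ?_
    refine (congrArg _ (PiTensorProduct.map₂_tprod_tprod _ _ _)).trans
      ((PiTensorProduct.map₂_tprod_tprod _ _ _).trans ?_)
    congr 1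
    funext r
    simp only [Finset.mem_filter, Finset.mem_univ, true_and] at hf
    refine LinearMap.ext fun v => hι T ?_ (f r) ?_ v
    · rw [← hf]
      exact Finset.card_image_le.trans (by simp)
    · rw [← hf]
      simp [im]
  refine (Finset.sum_congr rfl fun T _ => key T).trans (Subtype.ext ?_)
  have h0 : ((∑ T, q T : divPow k d (V.space →ₗ[k] V.space)) :
      ⨂[k] _ : Fin d, V.space →ₗ[k] V.space) = ∑ T, (q T).1 := by
    rw [AddSubmonoidClass.coe_finsetSum]
  refine h0.trans ?_
  change ∑ T, ∑ f ∈ Finset.univ.filter (fun f => im f = T),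
    PiTensorProduct.tprod k (fun r => P (f r)) = PiTensorProduct.tprod k fun _ => LinearMap.id
  rw [Finset.sum_fiberwise]
  have hid : (LinearMap.id : V.space →ₗ[k] V.space) = ∑ i, P i := by
    refine LinearMap.ext fun v => ?_
    rw [LinearMap.sum_apply]
    exact (B.sum_repr v).symm
  rw [hid]
  exact (MultilinearMap.map_sum (PiTensorProduct.tprod k)
    (fun (_ : Fin d) (i : Fin n) => P i)).symm

theorem map_sum_factor (F : PolyFunctor.{u} k d) {V : DivCat.{u} k d} {J : Type} [Fintype J]
    {a : J → (V ⟶ stdObj k d)} {b : J → (stdObj k d ⟶ V)} (h : ∑ j, a j ≫ b j = 𝟙 V) :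
    ∑ j, F.obj.map (a j) ≫ F.obj.map (b j) = 𝟙 (F.obj.obj V) := by
  rw [← F.obj.map_id, ← h, Functor.map_sum]
  simp

/-- A morphism of strict polynomial functors is determined by its component at `k^d`. -/
theorem hom_ext_std {F G : PolyFunctor.{u} k d} (f g : F ⟶ G)
    (h : f.hom.app (stdObj k d) = g.hom.app (stdObj k d)) : f = g := by
  refine ObjectProperty.hom_ext _ (NatTrans.ext (funext fun V => ?_))
  obtain ⟨J, _, a, b, hab⟩ := exists_factor_std V
  rw [← Category.id_comp (f.hom.app V), ← Category.id_comp (g.hom.app V), ← map_sum_factor F hab,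
    Preadditive.sum_comp, Preadditive.sum_comp]
  simp only [Category.assoc, NatTrans.naturality, h]

/-- Evaluation of morphisms at `k^d`. -/
def evalStd (F G : PolyFunctor.{u} k d) :
    (F ⟶ G) →ₗ[k] (F.obj.obj (stdObj k d) ⟶ G.obj.obj (stdObj k d)) where
  toFun f := f.hom.app _
  map_add' _ _ := rfl
  map_smul' _ _ := rfl

theorem evalStd_injective (F G : PolyFunctor.{u} k d) : Function.Injective (evalStd F G) :=
  fun f g h => hom_ext_std f g h

instance (F G : PolyFunctor.{u} k d) : Small.{u} (F ⟶ G) :=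
  small_of_injective (evalStd_injective F G)

instance (F G : PolyFunctor.{u} k d) : Module.Finite k (F ⟶ G) :=
  Module.Finite.of_injective _ (evalStd_injective F G)

instance (F G : PolyFunctor.{u} k d) : Module.Finite k (Shrink.{u} (F ⟶ G)) :=
  Module.Finite.equiv (Shrink.linearEquiv.{u} k (F ⟶ G)).symm

end Generators

section RightAdjoint

variable {k : Type u} [Field k] {d s : ℕ}

theorem fgHom_ext {M N : FGModuleCat.{u} k} {f g : M ⟶ N}
    (h : ∀ x, f.hom.hom x = g.hom.hom x) : f = g :=
  ObjectProperty.hom_ext _ (ModuleCat.hom_ext (LinearMap.ext h))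

/-- The divided power functor `D^d_V`, `W ↦ D^d(Hom(V, W))`. -/
def divFunctor (V : DivCat.{u} k d) : PolyFunctor.{u} k d where
  obj :=
    { obj := fun W => FGModuleCat.of k (V ⟶ W)
      map := fun f => FGModuleCat.ofHom (Linear.rightComp k V f)
      map_id := fun W => by ext x; exact Category.comp_id x
      map_comp := fun f g => by ext x; exact (Category.assoc x f g).symm }
  property := ⟨⟨fun {W X f g} => by ext x; exact Preadditive.comp_add _ _ _ x f g⟩,
    ⟨fun {W X} f r => by ext x; exact Linear.comp_smul _ _ _ x r f⟩⟩

/-- The contravariant functoriality of `D^d_V` in `V`. -/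
def divFunctorMap {V V' : DivCat.{u} k d} (f : V ⟶ V') : divFunctor V' ⟶ divFunctor V :=
  ObjectProperty.homMk
    { app := fun W => FGModuleCat.ofHom (Linear.leftComp k W f)
      naturality := fun W X g => by ext x; exact (Category.assoc f x g).symm }

theorem divFunctorMap_id (V : DivCat.{u} k d) : divFunctorMap (𝟙 V) = 𝟙 (divFunctor V) := by
  refine ObjectProperty.hom_ext _ (NatTrans.ext (funext fun W => ?_))
  ext x
  exact Category.id_comp x

theorem divFunctorMap_comp {V V' V'' : DivCat.{u} k d} (f : V ⟶ V') (g : V' ⟶ V'') :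
    divFunctorMap (f ≫ g) = divFunctorMap g ≫ divFunctorMap f := by
  refine ObjectProperty.hom_ext _ (NatTrans.ext (funext fun W => ?_))
  ext x
  exact Category.assoc f g x

theorem divFunctorMap_add {V V' : DivCat.{u} k d} (f g : V ⟶ V') :
    divFunctorMap (f + g) = divFunctorMap f + divFunctorMap g := by
  refine ObjectProperty.hom_ext _ (NatTrans.ext (funext fun W => ?_))
  ext x
  exact Preadditive.add_comp _ _ _ f g x

theorem divFunctorMap_smul {V V' : DivCat.{u} k d} (r : k) (f : V ⟶ V') :
    divFunctorMap (r • f) = r • divFunctorMap f := by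
  refine ObjectProperty.hom_ext _ (NatTrans.ext (funext fun W => ?_))
  ext x
  exact Linear.smul_comp _ _ _ r f x

instance (Φ : DivCat.{u} k (d * s) ⥤ DivCat.{u} k d) [Φ.Additive] [Φ.Linear k] :
    (precomp Φ).Additive where

instance (Φ : DivCat.{u} k (d * s) ⥤ DivCat.{u} k d) [Φ.Additive] [Φ.Linear k] :
    (precomp Φ).Linear k where

instance (A : PolyFunctor.{u} k s) : (precompA d A).Additive :=
  inferInstanceAs (precomp _).Additive

instance (A : PolyFunctor.{u} k s) : (precompA d A).Linear k :=
  inferInstanceAs ((precomp _).Linear k)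

/-- A linear map between `Hom` spaces, as a morphism of finite dimensional vector spaces. -/
def shrinkMap {F G F' G' : PolyFunctor.{u} k d} (T : (F ⟶ G) →ₗ[k] (F' ⟶ G')) :
    FGModuleCat.of k (Shrink.{u} (F ⟶ G)) ⟶ FGModuleCat.of k (Shrink.{u} (F' ⟶ G')) :=
  FGModuleCat.ofHom ((Shrink.linearEquiv.{u} k _).symm.toLinearMap ∘ₗ T ∘ₗ
    (Shrink.linearEquiv.{u} k _).toLinearMap)

theorem shrinkMap_id (F G : PolyFunctor.{u} k d) :
    shrinkMap (LinearMap.id : (F ⟶ G) →ₗ[k] (F ⟶ G)) = 𝟙 _ := by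
  refine fgHom_ext fun x => ?_
  exact (Shrink.linearEquiv.{u} k (F ⟶ G)).symm_apply_apply x

theorem shrinkMap_comp {F G F' G' F'' G'' : PolyFunctor.{u} k d}
    (T : (F ⟶ G) →ₗ[k] (F' ⟶ G')) (T' : (F' ⟶ G') →ₗ[k] (F'' ⟶ G'')) :
    shrinkMap (T' ∘ₗ T) = shrinkMap T ≫ shrinkMap T' := by
  refine fgHom_ext fun x => ?_
  exact congrArg (fun y => (Shrink.linearEquiv.{u} k (F'' ⟶ G'')).symm (T' y))
    ((Shrink.linearEquiv.{u} k (F' ⟶ G')).apply_symm_apply _).symm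

theorem shrinkMap_add {F G F' G' : PolyFunctor.{u} k d} (T T' : (F ⟶ G) →ₗ[k] (F' ⟶ G')) :
    shrinkMap (T + T') = shrinkMap T + shrinkMap T' := by
  refine fgHom_ext fun x => ?_
  exact map_add (Shrink.linearEquiv.{u} k (F' ⟶ G')).symm _ _

theorem shrinkMap_smul {F G F' G' : PolyFunctor.{u} k d} (r : k)
    (T : (F ⟶ G) →ₗ[k] (F' ⟶ G')) : shrinkMap (r • T) = r • shrinkMap T := by
  refine fgHom_ext fun x => ?_
  exact map_smul (Shrink.linearEquiv.{u} k (F' ⟶ G')).symm r _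

/-- The functoriality of `V ↦ Hom(𝐂_A(D^d_V), F)` before passing to the universe of `k`. -/
def rightAdjMap (A : PolyFunctor.{u} k s) (F : PolyFunctor.{u} k (d * s)) {V W : DivCat.{u} k d}
    (f : V ⟶ W) : ((precompA d A).obj (divFunctor V) ⟶ F) →ₗ[k]
      ((precompA d A).obj (divFunctor W) ⟶ F) :=
  Linear.leftComp k F ((precompA d A).map (divFunctorMap f))

theorem rightAdjMap_apply (A : PolyFunctor.{u} k s) (F : PolyFunctor.{u} k (d * s))
    {V W : DivCat.{u} k d} (f : V ⟶ W) (x : (precompA d A).obj (divFunctor V) ⟶ F) :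
    rightAdjMap A F f x = (precompA d A).map (divFunctorMap f) ≫ x := rfl

theorem rightAdjMap_id (A : PolyFunctor.{u} k s) (F : PolyFunctor.{u} k (d * s))
    (V : DivCat.{u} k d) : rightAdjMap A F (𝟙 V) = LinearMap.id := LinearMap.ext fun x => by
  rw [rightAdjMap_apply, divFunctorMap_id, CategoryTheory.Functor.map_id, Category.id_comp]
  rfl

theorem rightAdjMap_comp (A : PolyFunctor.{u} k s) (F : PolyFunctor.{u} k (d * s))
    {V W X : DivCat.{u} k d} (f : V ⟶ W) (g : W ⟶ X) :
    rightAdjMap A F (f ≫ g) = rightAdjMap A F g ∘ₗ rightAdjMap A F f := LinearMap.ext fun x => by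
  rw [LinearMap.comp_apply, rightAdjMap_apply, rightAdjMap_apply, rightAdjMap_apply,
    divFunctorMap_comp, CategoryTheory.Functor.map_comp, Category.assoc]

theorem rightAdjMap_add (A : PolyFunctor.{u} k s) (F : PolyFunctor.{u} k (d * s))
    {V W : DivCat.{u} k d} (f g : V ⟶ W) :
    rightAdjMap A F (f + g) = rightAdjMap A F f + rightAdjMap A F g := LinearMap.ext fun x => by
  rw [LinearMap.add_apply, rightAdjMap_apply, rightAdjMap_apply, rightAdjMap_apply,
    divFunctorMap_add, CategoryTheory.Functor.map_add, Preadditive.add_comp]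

theorem rightAdjMap_smul (A : PolyFunctor.{u} k s) (F : PolyFunctor.{u} k (d * s))
    {V W : DivCat.{u} k d} (r : k) (f : V ⟶ W) :
    rightAdjMap A F (r • f) = r • rightAdjMap A F f := LinearMap.ext fun x => by
  rw [LinearMap.smul_apply, rightAdjMap_apply, rightAdjMap_apply,
    divFunctorMap_smul, CategoryTheory.Functor.map_smul, Linear.smul_comp]

/-- The strict polynomial functor `V ↦ Hom(𝐂_A(D^d_V), F)` of degree `d`, for `F ∈ 𝒫_{ds}`. The
`Hom` spaces of `𝒫_{ds}` are finite dimensional; they are replaced by isomorphic copies in the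
universe of `k`. -/
def rightAdjObj (d : ℕ) (A : PolyFunctor.{u} k s) (F : PolyFunctor.{u} k (d * s)) :
    PolyFunctor.{u} k d where
  obj :=
    { obj := fun V => FGModuleCat.of k (Shrink.{u} ((precompA d A).obj (divFunctor V) ⟶ F))
      map := fun f => shrinkMap (rightAdjMap A F f)
      map_id := fun V => by rw [rightAdjMap_id, shrinkMap_id]
      map_comp := fun f g => by rw [rightAdjMap_comp, shrinkMap_comp] }
  property := ⟨⟨fun {V W f g} => (congrArg shrinkMap (rightAdjMap_add A F f g)).trans
      (shrinkMap_add _ _)⟩,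
    ⟨fun {V W} f r => (congrArg shrinkMap (rightAdjMap_smul A F r f)).trans
      (shrinkMap_smul _ _)⟩⟩

/-- The functor `F ↦ (V ↦ Hom(𝐂_A(D^d_V), F))`. -/
def rightAdj (d : ℕ) (A : PolyFunctor.{u} k s) :
    PolyFunctor.{u} k (d * s) ⥤ PolyFunctor.{u} k d where
  obj F := rightAdjObj d A F
  map {F G} φ := ObjectProperty.homMk
    { app := fun V => shrinkMap (Linear.rightComp k ((precompA d A).obj (divFunctor V)) φ)
      naturality := fun V W f => by
        refine (shrinkMap_comp _ _).symm.trans (Eq.trans ?_ (shrinkMap_comp _ _))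
        exact congrArg shrinkMap (LinearMap.ext fun x => Category.assoc _ x φ) }
  map_id F := by
    refine ObjectProperty.hom_ext _ (NatTrans.ext (funext fun V => ?_))
    refine Eq.trans (congrArg shrinkMap ?_) (shrinkMap_id _ _)
    exact LinearMap.ext fun x => Category.comp_id x
  map_comp φ ψ := by
    refine ObjectProperty.hom_ext _ (NatTrans.ext (funext fun V => ?_))
    refine Eq.trans (congrArg shrinkMap ?_) (shrinkMap_comp _ _)
    exact LinearMap.ext fun x => (Category.assoc x φ ψ).symm

instance (A : PolyFunctor.{u} k s) : (rightAdj d A).Additive where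
  map_add {F G φ ψ} := by
    refine ObjectProperty.hom_ext _ (NatTrans.ext (funext fun V => ?_))
    refine Eq.trans (b := shrinkMap (Linear.rightComp k ((precompA d A).obj (divFunctor V)) φ +
      Linear.rightComp k _ ψ))
      (congrArg shrinkMap ?_) (shrinkMap_add _ _)
    exact LinearMap.ext fun x => Preadditive.comp_add _ _ _ x φ ψ

/-- Evaluation of the elements of `Hom(Hom_{Γ^d 𝒱}(W, U), M)`. -/
def coDivEval (W U : DivCat.{u} k d) (M : FGModuleCat.{u} k) :
    FGModuleCat.of k ((W ⟶ U) →ₗ[k] M) →ₗ[k] (W ⟶ U) →ₗ[k] M :=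
  LinearMap.id

/-- The strict polynomial functor `W ↦ Hom(Hom_{Γ^d 𝒱}(W, U), M)`. -/
def coDiv (U : DivCat.{u} k d) (M : FGModuleCat.{u} k) : PolyFunctor.{u} k d where
  obj :=
    { obj := fun W => FGModuleCat.of k ((W ⟶ U) →ₗ[k] M)
      map := fun f => FGModuleCat.ofHom (LinearMap.lcomp k M (Linear.leftComp k U f))
      map_id := fun W => by
        refine fgHom_ext fun x => ?_
        exact LinearMap.ext fun (y : _ ⟶ U) => congrArg (coDivEval _ U M x) (Category.id_comp y)
      map_comp := fun f g => by
        refine fgHom_ext fun x => ?_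
        exact LinearMap.ext fun (y : _ ⟶ U) => congrArg (coDivEval _ U M x) (Category.assoc f g y) }
  property := ⟨⟨fun {W X f g} => by
      refine fgHom_ext fun x => ?_
      exact LinearMap.ext fun (y : _ ⟶ U) => (congrArg (coDivEval _ U M x) (Preadditive.add_comp _ _ _ f g y)).trans
        (map_add (coDivEval _ U M x) _ _)⟩,
    ⟨fun {W X} f r => by
      refine fgHom_ext fun x => ?_
      exact LinearMap.ext fun (y : _ ⟶ U) => (congrArg (coDivEval _ U M x) (Linear.smul_comp _ _ _ r f y)).trans
        (map_smul (coDivEval _ U M x) _ _)⟩⟩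

/-- The morphism `F ⟶ coDiv U M` which corresponds to a linear map `F(U) → M`. -/
def toCoDiv (F : PolyFunctor.{u} k d) (U : DivCat.{u} k d) (M : FGModuleCat.{u} k)
    (t : F.obj.obj U →ₗ[k] M) : F ⟶ coDiv U M :=
  ObjectProperty.homMk
    { app := fun W => FGModuleCat.ofHom (LinearMap.mk₂ k
        (fun x (f : W ⟶ U) => t ((F.obj.map f).hom.hom x))
        (fun x y f => by rw [map_add, map_add]) (fun r x f => by rw [map_smul, map_smul])
        (fun x f g => by rw [F.obj.map_add]; exact map_add t _ _)
        (fun r x f => by rw [F.obj.map_smul]; exact map_smul t _ _))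
      naturality := fun W X g => by
        refine fgHom_ext fun x => ?_
        refine LinearMap.ext fun f => ?_
        exact congrArg (fun h => t (h.hom.hom x)) (F.obj.map_comp g f).symm }

theorem coDiv_hom_ext {F : PolyFunctor.{u} k d} {U : DivCat.{u} k d} {M : FGModuleCat.{u} k}
    (φ ψ : F ⟶ coDiv U M)
    (h : ∀ x, coDivEval U U M ((φ.hom.app U).hom.hom x) (𝟙 U) =
      coDivEval U U M ((ψ.hom.app U).hom.hom x) (𝟙 U)) : φ = ψ := by
  refine ObjectProperty.hom_ext _ (NatTrans.ext (funext fun W => ?_))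
  refine fgHom_ext fun x => ?_
  refine LinearMap.ext fun (f : W ⟶ U) => ?_
  have key : ∀ χ : F ⟶ coDiv U M, coDivEval W U M ((χ.hom.app W).hom.hom x) f =
      coDivEval U U M ((χ.hom.app U).hom.hom ((F.obj.map f).hom.hom x)) (𝟙 U) := fun χ => by
    have h1 := congrArg (fun m => coDivEval U U M (m.hom.hom x) (𝟙 U)) (χ.hom.naturality f)
    refine Eq.trans ?_ h1.symm
    exact congrArg (coDivEval W U M ((χ.hom.app W).hom.hom x)) (Category.comp_id f).symm
  exact (key φ).trans ((h _).trans (key ψ).symm)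

instance (U : DivCat.{u} k d) (M : FGModuleCat.{u} k) : Injective (coDiv U M) where
  factors {F G} g f hf := by
    have hinj := (mono_iff f).1 hf U
    let t : F.obj.obj U →ₗ[k] M := (LinearMap.applyₗ (𝟙 U : U ⟶ U)) ∘ₗ (g.hom.app U).hom.hom
    obtain ⟨l, hl⟩ := LinearMap.exists_leftInverse_of_injective (f.hom.app U).hom.hom
      (LinearMap.ker_eq_bot.2 hinj)
    refine ⟨toCoDiv G U M (t ∘ₗ l), coDiv_hom_ext _ _ fun x => ?_⟩
    have h1 : (G.obj.map (𝟙 U)).hom.hom ((f.hom.app U).hom.hom x) = (f.hom.app U).hom.hom x := by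
      rw [G.obj.map_id]; rfl
    have h2 := LinearMap.congr_fun hl x
    change t (l ((G.obj.map (𝟙 U)).hom.hom ((f.hom.app U).hom.hom x))) = t x
    rw [h1]
    exact congrArg t h2

instance : EnoughInjectives (PolyFunctor.{u} k d) where
  presentation F := ⟨{
    J := coDiv (stdObj k d) (F.obj.obj (stdObj k d))
    f := toCoDiv F _ _ LinearMap.id
    mono := (mono_iff _).2 fun V => by
      rw [injective_iff_map_eq_zero]
      intro x hx
      obtain ⟨J, _, a, b, hab⟩ := exists_factor_std V
      have h1 := congrArg (fun m => m.hom.hom x) (map_sum_factor F hab)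
      refine h1.symm.trans ?_
      have h2 : ∀ j, (F.obj.map (a j)).hom.hom x = 0 := fun j => LinearMap.congr_fun hx (a j)
      have h3 : (∑ j, F.obj.map (a j) ≫ F.obj.map (b j)).hom.hom x =
          ∑ j, (F.obj.map (b j)).hom.hom ((F.obj.map (a j)).hom.hom x) :=
        map_sum (⟨⟨fun m => m.hom.hom x, rfl⟩, fun _ _ => rfl⟩ :
          (F.obj.obj V ⟶ F.obj.obj V) →+ F.obj.obj V) _ _
      refine h3.trans (Finset.sum_eq_zero fun j _ => ?_)
      rw [h2, map_zero] }⟩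

end RightAdjoint

section KuhnDual

open Limits Opposite

variable {k : Type u} [Field k] {d : ℕ}

theorem exact_dualMap {M N P : Type u} [AddCommGroup M] [Module k M] [AddCommGroup N] [Module k N]
    [AddCommGroup P] [Module k P] {f : M →ₗ[k] N} {g : N →ₗ[k] P} (h : Function.Exact f g) :
    Function.Exact g.dualMap f.dualMap := by
  rw [LinearMap.exact_iff] at h ⊢
  rw [LinearMap.ker_dualMap_eq_dualAnnihilator_range, LinearMap.range_dualMap_eq_dualAnnihilator_ker,
    h]

/-- The dual vector space. -/
abbrev dualObj (V : FGModuleCat.{u} k) : FGModuleCat.{u} k :=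
  FGModuleCat.of k (Module.Dual k V)

/-- The map `F(W^*)^* ← F(V^*)^*` given by a morphism of `Γ^d 𝒱`. -/
def kuhnMap (F : PolyFunctor.{u} k d) {V W : DivCat.{u} k d} (f : V ⟶ W) :
    dualObj (F.obj.obj ⟨dualObj V.space⟩) ⟶ dualObj (F.obj.obj ⟨dualObj W.space⟩) :=
  FGModuleCat.ofHom (F.obj.map (transposeDiv f)).hom.hom.dualMap

theorem kuhnMap_add (F : PolyFunctor.{u} k d) {V W : DivCat.{u} k d} (f g : V ⟶ W) :
    kuhnMap F (f + g) = kuhnMap F f + kuhnMap F g := by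
  unfold kuhnMap
  rw [map_add, CategoryTheory.Functor.map_add]
  refine fgHom_ext fun (x : Module.Dual k _) => LinearMap.ext fun y => ?_
  exact LinearMap.map_add x _ _

theorem kuhnMap_smul (F : PolyFunctor.{u} k d) {V W : DivCat.{u} k d} (r : k) (f : V ⟶ W) :
    kuhnMap F (r • f) = r • kuhnMap F f := by
  unfold kuhnMap
  rw [map_smul, CategoryTheory.Functor.map_smul]
  refine fgHom_ext fun (x : Module.Dual k _) => LinearMap.ext fun y => ?_
  exact LinearMap.map_smul x _ _

/-- The Kuhn dual `F^#` of a strict polynomial functor, `F^#(V) = F(V^*)^*`. -/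
def kuhnObj (F : PolyFunctor.{u} k d) : PolyFunctor.{u} k d where
  obj :=
    { obj := fun V => dualObj (F.obj.obj ⟨dualObj V.space⟩)
      map := kuhnMap F
      map_id := fun V => by
        unfold kuhnMap
        rw [transposeDiv_id, CategoryTheory.Functor.map_id]
        rfl
      map_comp := fun f g => by
        unfold kuhnMap
        rw [transposeDiv_comp, CategoryTheory.Functor.map_comp]
        rfl }
  property := ⟨⟨fun {V W f g} => kuhnMap_add F f g⟩, ⟨fun {V W} f r => kuhnMap_smul F r f⟩⟩

/-- Kuhn duality as a contravariant functor. -/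
def kuhn (k : Type u) [Field k] (d : ℕ) : (PolyFunctor.{u} k d)ᵒᵖ ⥤ PolyFunctor.{u} k d where
  obj F := kuhnObj F.unop
  map {F G} φ := ObjectProperty.homMk
    { app := fun V => FGModuleCat.ofHom (φ.unop.hom.app ⟨dualObj V.space⟩).hom.hom.dualMap
      naturality := fun V W f => by
        have h := φ.unop.hom.naturality (transposeDiv f)
        exact fgHom_ext fun x => LinearMap.ext fun y =>
          (congrArg (fun m => Module.Dual.eval k _ (m.hom.hom y) x) h).symm }
  map_id F := rfl
  map_comp φ ψ := rfl

instance : (kuhn.{u} k d).Additive where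
  map_add {F G φ ψ} := by
    refine ObjectProperty.hom_ext _ (NatTrans.ext (funext fun V => ?_))
    refine fgHom_ext fun (x : Module.Dual k _) => LinearMap.ext fun y => ?_
    exact LinearMap.map_add x _ _

theorem kuhn_exact (S : ShortComplex (PolyFunctor.{u} k d)ᵒᵖ) (hS : S.Exact) :
    (S.map (kuhn k d)).Exact := by
  rw [← ShortComplex.exact_unop_iff, exact_iff] at hS
  rw [exact_iff]
  exact fun V => exact_dualMap (hS ⟨dualObj V.space⟩)

theorem kuhn_preserves :
    PreservesFiniteLimits (kuhn.{u} k d) ∧ PreservesFiniteColimits (kuhn.{u} k d) :=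
  ((kuhn.{u} k d).exact_tfae.out 1 3 rfl rfl).1 kuhn_exact

instance : PreservesFiniteLimits (kuhn.{u} k d) :=
  kuhn_preserves.1

instance : PreservesFiniteColimits (kuhn.{u} k d) :=
  kuhn_preserves.2

/-- Kuhn duality on cochain complexes: the term of degree `n` of the dual of `K` is the Kuhn dual
of the term of degree `-n` of `K`. -/
def kuhnComplex (k : Type u) [Field k] (d : ℕ) :
    (CochainComplex (PolyFunctor.{u} k d) ℤ)ᵒᵖ ⥤ CochainComplex (PolyFunctor.{u} k d) ℤ :=
  (CochainComplex.opEquivalence (PolyFunctor.{u} k d)).functor ⋙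
    (kuhn k d).mapHomologicalComplex (ComplexShape.up ℤ)

theorem kuhnComplex_quasiIso {K L : CochainComplex (PolyFunctor.{u} k d) ℤ} (f : K ⟶ L)
    [QuasiIso f] : QuasiIso ((kuhnComplex k d).map f.op) := by
  have h : QuasiIso ((CochainComplex.opEquivalence (PolyFunctor.{u} k d)).functor.map f.op) := by
    rw [quasiIso_iff]
    intro n
    have h : QuasiIsoAt f (-n) := inferInstance
    rw [quasiIsoAt_iff' _ (-(n + 1)) (-n) (-(n - 1)) (by simp; lia) (by simp; lia)] at h
    rw [quasiIsoAt_iff' _ (n - 1) n (n + 1) (by simp) (by simp)]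
    exact (ShortComplex.quasiIso_opMap_iff _).2 h
  exact inferInstanceAs (QuasiIso (((kuhn k d).mapHomologicalComplex (ComplexShape.up ℤ)).map
    ((CochainComplex.opEquivalence (PolyFunctor.{u} k d)).functor.map f.op)))

theorem kuhnComplex_inverts :
    (HomologicalComplex.quasiIso (PolyFunctor.{u} k d) (ComplexShape.up ℤ)).op.IsInvertedBy
      (kuhnComplex k d ⋙ DerivedCategory.Q) := fun K L f hf => by
  have : QuasiIso f.unop := hf
  have := kuhnComplex_quasiIso f.unop
  exact inferInstanceAs (IsIso (DerivedCategory.Q.map ((kuhnComplex k d).map f.unop.op)))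

/-- Kuhn duality on the derived category of `𝒫_d`. -/
def kuhnDerived (k : Type u) [Field k] (d : ℕ) :
    (DerivedCategory (PolyFunctor.{u} k d))ᵒᵖ ⥤ DerivedCategory (PolyFunctor.{u} k d) :=
  Localization.lift (kuhnComplex k d ⋙ DerivedCategory.Q) kuhnComplex_inverts
    (DerivedCategory.Q (C := PolyFunctor.{u} k d)).op

/-- On complexes, the derived Kuhn duality is given by the termwise Kuhn dual. -/
def kuhnDerivedFactors (k : Type u) [Field k] (d : ℕ) :
    DerivedCategory.Q.op ⋙ kuhnDerived.{u} k d ≅ kuhnComplex k d ⋙ DerivedCategory.Q :=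
  Localization.fac _ kuhnComplex_inverts _

theorem kuhnDerived_bounded (X : DerivedCategory (PolyFunctor.{u} k d))
    (hX : DerivedCategory.TStructure.t.bounded X) :
    DerivedCategory.TStructure.t.bounded ((kuhnDerived k d).obj (op X)) := by
  obtain ⟨⟨a, ha⟩, ⟨b, hb⟩⟩ := hX
  have : X.IsGE a := ha
  have : X.IsLE b := hb
  obtain ⟨K, _, _, ⟨e⟩⟩ := X.exists_iso_Q_obj_of_isGE_of_isLE a b
  let L := (kuhnComplex k d).obj (op K)
  let i : DerivedCategory.Q.obj L ≅ (kuhnDerived k d).obj (op X) :=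
    ((kuhnDerivedFactors k d).app (op K)).symm ≪≫ (kuhnDerived k d).mapIso e.op
  have hz : ∀ n, IsZero (K.X (-n)) → IsZero (L.X n) := fun n h =>
    (kuhn k d).map_isZero h.op
  have : L.IsStrictlyGE (-b) := by
    rw [CochainComplex.isStrictlyGE_iff]
    exact fun n hn => hz n (K.isZero_of_isStrictlyLE b _ (by lia))
  have : L.IsStrictlyLE (-a) := by
    rw [CochainComplex.isStrictlyLE_iff]
    exact fun n hn => hz n (K.isZero_of_isStrictlyGE a _ (by lia))
  refine ObjectProperty.prop_of_iso _ i ⟨⟨-b, ?_⟩, ⟨-a, ?_⟩⟩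
  · exact (inferInstance : (DerivedCategory.Q.obj L).IsGE (-b))
  · exact (inferInstance : (DerivedCategory.Q.obj L).IsLE (-a))

/-- Kuhn duality on the bounded derived category of `𝒫_d`. -/
def kuhnBounded (k : Type u) [Field k] (d : ℕ) :
    (DerivedCategory.Bounded (PolyFunctor.{u} k d))ᵒᵖ ⥤
      DerivedCategory.Bounded (PolyFunctor.{u} k d) :=
  ObjectProperty.lift _ ((DerivedCategory.Bounded.ι (C := PolyFunctor.{u} k d)).op ⋙
    kuhnDerived k d) fun X => kuhnDerived_bounded _ X.unop.property

end KuhnDual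

section Adjoints

variable {k : Type u} [Field k] {s : ℕ}

/-- The right adjoint `𝐊^r_A : 𝒟𝒫_{ds} ⥤ 𝒟𝒫_d` of `𝐂_A`, given by
`𝐊^r_A(F)(V) = RHom(𝐂_A(D^d_V), F)`: the right derived functor of `F ↦ (V ↦ Hom(𝐂_A(D^d_V), F))`,
on the bounded derived category. The derived category of `𝒫_d`, where it takes its values, has the
bounded one as a full subcategory. -/
def rightK (d : ℕ) (A : PolyFunctor.{u} k s) :
    DerivedCategory.Bounded (PolyFunctor.{u} k (d * s)) ⥤ DerivedCategory (PolyFunctor.{u} k d) :=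
  ObjectProperty.ιOfLE (fun _ h => h.1) ⋙ (rightAdj d A).rightDerivedFunctorPlus ⋙
    DerivedCategory.Plus.ι

/-- The left adjoint `𝐊^l_A` of `𝐂_A`, `𝐊^l_A(F) = 𝐊^r_{A^#}(F^#)^#`. -/
def leftK (d : ℕ) (A : PolyFunctor.{u} k s) :
    DerivedCategory.Bounded (PolyFunctor.{u} k (d * s)) ⥤ DerivedCategory (PolyFunctor.{u} k d) :=
  (kuhnBounded k (d * s)).rightOp ⋙ (rightK d (kuhnObj A)).op ⋙ kuhnDerived k d

end Adjoints

section Graded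

variable {k : Type u} [Field k]

/-- A finite dimensional vector space graded by `ℤ`: the grading is recorded by the projections
`proj i` onto the homogeneous components, and `supp` is a finite set of degrees that contains the
degrees of all nonzero components. -/
structure GradedSpace (k : Type u) [Field k] where
  space : FGModuleCat.{u} k
  proj : ℤ → (space →ₗ[k] space)
  supp : Finset ℤ
  proj_comp_self : ∀ i, proj i ∘ₗ proj i = proj i
  proj_comp_of_ne : ∀ i j, i ≠ j → proj i ∘ₗ proj j = 0
  sum_proj : ∑ i ∈ supp, proj i = LinearMap.id

/-- The graded dual: `(U^*)^j = (U^{-j})^*`. -/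
def GradedSpace.dual (U : GradedSpace.{u} k) : GradedSpace.{u} k where
  space := dualObj U.space
  proj i := (U.proj (-i)).dualMap
  supp := U.supp.image Neg.neg
  proj_comp_self i := (LinearMap.dualMap_comp_dualMap _ _).trans
    (congrArg LinearMap.dualMap (U.proj_comp_self (-i)))
  proj_comp_of_ne i j h := (LinearMap.dualMap_comp_dualMap _ _).trans
    ((congrArg LinearMap.dualMap (U.proj_comp_of_ne (-j) (-i)
      fun h' => h (neg_injective h'.symm))).trans (map_zero (Module.Dual.transpose (R := k))))
  sum_proj := by
    rw [Finset.sum_image fun _ _ _ _ h => neg_injective h]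
    simp only [neg_neg]
    refine LinearMap.ext fun x => LinearMap.ext fun y => ?_
    have h := LinearMap.congr_fun U.sum_proj y
    rw [LinearMap.sum_apply] at h ⊢
    rw [LinearMap.sum_apply]
    exact (map_sum x _ _).symm.trans (congrArg x h)

variable (d : ℕ)

/-- The degrees `i₁ + ⋯ + i_d` of `U^{⊗ d}`. -/
def GradedSpace.degs (U : GradedSpace.{u} k) : Finset ℤ :=
  (Fintype.piFinset fun _ : Fin d => U.supp).image fun f => ∑ r, f r

/-- The endomorphism of `U` in `Γ^d 𝒱` which is the projection of `U^{⊗ d}` onto its component of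
degree `j`: the sum of the `proj i₁ ⊗ ⋯ ⊗ proj i_d` with `i₁ + ⋯ + i_d = j`. -/
def GradedSpace.weight (U : GradedSpace.{u} k) (j : ℤ) :
    (⟨U.space⟩ : DivCat.{u} k d) ⟶ ⟨U.space⟩ :=
  symSum U.proj ((Fintype.piFinset fun _ : Fin d => U.supp).filter fun f => ∑ r, f r = j)
    fun f hf σ => by
      simp only [Finset.mem_filter, Fintype.mem_piFinset] at hf ⊢
      exact ⟨fun r => hf.1 (σ r), (Equiv.sum_comp σ f).trans hf.2⟩

variable {d}

theorem tprod_comp (U : GradedSpace.{u} k) (f g : Fin d → ℤ) :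
    PiTensorProduct.map₂ (fun _ => LinearMap.llcomp k U.space U.space U.space)
        (PiTensorProduct.tprod k fun r => U.proj (f r))
        (PiTensorProduct.tprod k fun r => U.proj (g r)) =
      if f = g then PiTensorProduct.tprod k fun r => U.proj (f r) else 0 := by
  rw [PiTensorProduct.map₂_tprod_tprod]
  split_ifs with h
  · subst h
    congr 1
    funext r
    exact U.proj_comp_self (f r)
  · obtain ⟨r, hr⟩ := Function.ne_iff.1 h
    exact MultilinearMap.map_coord_zero _ r (U.proj_comp_of_ne _ _ hr)

theorem weight_comp (U : GradedSpace.{u} k) (i j : ℤ) :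
    U.weight d i ≫ U.weight d j = if i = j then U.weight d i else 0 := by
  refine Subtype.ext ?_
  change PiTensorProduct.map₂ (fun _ => LinearMap.llcomp k U.space U.space U.space)
    (∑ f ∈ _, _) (∑ f ∈ _, _) = _
  simp only [map_sum, LinearMap.sum_apply, tprod_comp]
  rw [Finset.sum_comm]
  split_ifs with h
  · subst h
    refine Finset.sum_congr rfl fun f hf => ?_
    rw [Finset.sum_ite_eq, if_pos hf]
  · refine Finset.sum_eq_zero fun f hf => Finset.sum_eq_zero fun g hg => if_neg ?_
    rintro rfl
    simp only [Finset.mem_filter] at hf hg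
    exact h (hg.2.symm.trans hf.2)

theorem sum_weight (U : GradedSpace.{u} k) : ∑ j ∈ U.degs d, U.weight d j = 𝟙 _ := by
  refine Subtype.ext ?_
  have h0 : ((∑ j ∈ U.degs d, U.weight d j : divPow k d (U.space →ₗ[k] U.space)) :
      ⨂[k] _ : Fin d, U.space →ₗ[k] U.space) = ∑ j ∈ U.degs d, (U.weight d j).1 := by
    rw [AddSubmonoidClass.coe_finsetSum]
  refine h0.trans ?_
  change ∑ j ∈ U.degs d, ∑ f ∈ (Fintype.piFinset fun _ : Fin d => U.supp).filter
    (fun f => ∑ r, f r = j), PiTensorProduct.tprod k (fun r => U.proj (f r)) =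
      PiTensorProduct.tprod k fun _ => LinearMap.id
  have h1 := Finset.sum_fiberwise_of_maps_to (s := Fintype.piFinset fun _ : Fin d => U.supp)
    (t := U.degs d) (g := fun f => ∑ r, f r)
    (fun f hf => Finset.mem_image_of_mem (fun f : Fin d → ℤ => ∑ r, f r) hf)
    (fun f => PiTensorProduct.tprod k fun r => U.proj (f r))
  rw [← U.sum_proj]
  exact h1.trans (MultilinearMap.map_sum_finset (PiTensorProduct.tprod k)
    (fun (_ : Fin d) (i : ℤ) => U.proj i) fun _ => U.supp).symm

/-- The graded space `A(U)`, for `A ∈ 𝒫_s` and a graded space `U`: its component of degree `j` is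
the image of the projection of `U^{⊗ s}` onto its component of degree `j`. -/
def GradedSpace.eval {s : ℕ} (A : PolyFunctor.{u} k s) (U : GradedSpace.{u} k) :
    GradedSpace.{u} k where
  space := A.obj.obj ⟨U.space⟩
  proj j := (A.obj.map (U.weight s j)).hom.hom
  supp := U.degs s
  proj_comp_self i := by
    have h := A.obj.map_comp (U.weight s i) (U.weight s i)
    rw [weight_comp, if_pos rfl] at h
    exact (congrArg (fun m => m.hom.hom) h).symm
  proj_comp_of_ne i j hij := by
    have h := A.obj.map_comp (U.weight s j) (U.weight s i)
    rw [weight_comp, if_neg (Ne.symm hij), CategoryTheory.Functor.map_zero] at h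
    exact (congrArg (fun m => m.hom.hom) h).symm
  sum_proj := by
    have h := congrArg (A.obj.map) (sum_weight (d := s) U)
    rw [Functor.map_sum, CategoryTheory.Functor.map_id] at h
    refine LinearMap.ext fun x => ?_
    rw [LinearMap.sum_apply]
    refine Eq.trans ?_ (congrArg (fun m => m.hom.hom x) h)
    exact (map_sum (⟨⟨fun m => m.hom.hom x, rfl⟩, fun _ _ => rfl⟩ :
      (A.obj.obj ⟨U.space⟩ ⟶ A.obj.obj ⟨U.space⟩) →+ A.obj.obj ⟨U.space⟩) _ _).symm

end Graded

section Twist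

open Limits

variable {k : Type u} [Field k] {d s : ℕ}

/-- The endomorphism `F(e ⊗ id)` of `F(U ⊗ V)`. -/
def partMap {U : DivCat.{u} k d} (e : U ⟶ U) (F : PolyFunctor.{u} k d) (V : DivCat.{u} k d) :
    F.obj.obj (tensorObj U V) →ₗ[k] F.obj.obj (tensorObj U V) :=
  (F.obj.map (tensorHom e (𝟙 V))).hom.hom

/-- The map `F(id ⊗ f) : F(U ⊗ V) → F(U ⊗ W)`. -/
def tensMap (U : DivCat.{u} k d) (F : PolyFunctor.{u} k d) {V W : DivCat.{u} k d} (f : V ⟶ W) :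
    F.obj.obj (tensorObj U V) →ₗ[k] F.obj.obj (tensorObj U W) :=
  (((precomp (tensorLeft d U.space)).obj F).obj.map f).hom.hom

theorem tensMap_partMap {U : DivCat.{u} k d} (e : U ⟶ U) (F : PolyFunctor.{u} k d)
    {V W : DivCat.{u} k d} (f : V ⟶ W) (x) :
    tensMap U F f (partMap e F V x) = partMap e F W (tensMap U F f x) := by
  have h : tensorHom e (𝟙 V) ≫ tensorHom (𝟙 U) f = tensorHom (𝟙 U) f ≫ tensorHom e (𝟙 W) := by
    rw [← tensorHom_comp, ← tensorHom_comp, Category.id_comp, Category.comp_id, Category.id_comp,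
      Category.comp_id]
  have h' := congrArg F.obj.map h
  rw [CategoryTheory.Functor.map_comp, CategoryTheory.Functor.map_comp] at h'
  exact congrArg (fun m => m.hom.hom x) h'

/-- The strict polynomial functor `V ↦ F(e ⊗ id)(F(U ⊗ V))`. -/
def partObj {U : DivCat.{u} k d} (e : U ⟶ U) (F : PolyFunctor.{u} k d) : PolyFunctor.{u} k d where
  obj :=
    { obj := fun V => FGModuleCat.of k (LinearMap.range (partMap e F V))
      map := fun {V W} f => FGModuleCat.ofHom ((tensMap U F f).restrict (by
        rintro _ ⟨y, rfl⟩
        exact ⟨_, (tensMap_partMap e F f y).symm⟩))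
      map_id := fun V => fgHom_ext fun x => Subtype.ext
        (congrArg (fun m => m.hom.hom x.1)
          (((precomp (tensorLeft d U.space)).obj F).obj.map_id V))
      map_comp := fun f g => fgHom_ext fun x => Subtype.ext
        (congrArg (fun m => m.hom.hom x.1)
          (((precomp (tensorLeft d U.space)).obj F).obj.map_comp f g)) }
  property := ⟨⟨fun {V W f g} => fgHom_ext fun x => Subtype.ext
      (congrArg (fun m => m.hom.hom x.1)
        (((precomp (tensorLeft d U.space)).obj F).obj.map_add (f := f) (g := g)))⟩,
    ⟨fun {V W} f r => fgHom_ext fun x => Subtype.ext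
      (congrArg (fun m => m.hom.hom x.1)
        (((precomp (tensorLeft d U.space)).obj F).obj.map_smul r f))⟩⟩

/-- The functor `F ↦ (V ↦ F(e ⊗ id)(F(U ⊗ V)))`. -/
def part {U : DivCat.{u} k d} (e : U ⟶ U) : PolyFunctor.{u} k d ⥤ PolyFunctor.{u} k d where
  obj F := partObj e F
  map {F G} φ := ObjectProperty.homMk
    { app := fun V => FGModuleCat.ofHom
        (LinearMap.restrict (p := LinearMap.range (partMap e F V))
          (q := LinearMap.range (partMap e G V)) (φ.hom.app (tensorObj U V)).hom.hom (by
            rintro _ ⟨y, rfl⟩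
            exact ⟨(φ.hom.app (tensorObj U V)).hom.hom y,
              (congrArg (fun m => m.hom.hom y) (φ.hom.naturality (tensorHom e (𝟙 V)))).symm⟩))
      naturality := fun V W f => fgHom_ext fun x => Subtype.ext
        (congrArg (fun m => m.hom.hom x.1) (φ.hom.naturality ((tensorLeft d U.space).map f))) }
  map_id F := rfl
  map_comp φ ψ := rfl

instance {U : DivCat.{u} k d} (e : U ⟶ U) : (part e).Additive where
  map_add := rfl

theorem part_exact {U : DivCat.{u} k d} (e : U ⟶ U) (he : e ≫ e = e)
    (S : ShortComplex (PolyFunctor.{u} k d)) (hS : S.Exact) : (S.map (part e)).Exact := by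
  rw [exact_iff] at hS ⊢
  intro V
  have hV := hS (tensorObj U V)
  have hidem : ∀ (F : PolyFunctor.{u} k d) (y), partMap e F V (partMap e F V y) = partMap e F V y :=
    fun F y => by
      have h : tensorHom e (𝟙 V) ≫ tensorHom e (𝟙 V) = tensorHom e (𝟙 V) := by
        rw [← tensorHom_comp, he, Category.id_comp]
      have h' := congrArg F.obj.map h
      rw [CategoryTheory.Functor.map_comp] at h'
      exact congrArg (fun m => m.hom.hom y) h'
  rintro ⟨_, ⟨y, rfl⟩⟩
  constructor
  · intro h0
    have h1 := congrArg Subtype.val h0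
    obtain ⟨x, hx⟩ := (hV (partMap e S.X₂ V y)).1 h1
    refine ⟨⟨partMap e S.X₁ V x, x, rfl⟩, Subtype.ext ?_⟩
    have h2 := congrArg (fun m => m.hom.hom x) (S.f.hom.naturality (tensorHom e (𝟙 V)))
    refine Eq.trans h2 (Eq.trans (congrArg (partMap e S.X₂ V) hx) (hidem _ _))
  · rintro ⟨x, hx⟩
    refine Subtype.ext ?_
    exact (hV (partMap e S.X₂ V y)).2 ⟨x.1, congrArg Subtype.val hx⟩

/-- The component of degree `j` of the graded strict polynomial functor `F_U`,
`F_U(V) = F(U^* ⊗ V)`, for a graded space `U`. -/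
def component (d : ℕ) (U : GradedSpace.{u} k) (j : ℤ) :
    PolyFunctor.{u} k d ⥤ PolyFunctor.{u} k d :=
  part (U.dual.weight d j)

instance (U : GradedSpace.{u} k) (j : ℤ) : (component d U j).Additive :=
  inferInstanceAs (part _).Additive

theorem component_preserves (U : GradedSpace.{u} k) (j : ℤ) :
    PreservesFiniteLimits (component d U j) ∧ PreservesFiniteColimits (component d U j) :=
  ((component d U j).exact_tfae.out 1 3 rfl rfl).1
    (part_exact _ (by rw [weight_comp, if_pos rfl]))

instance (U : GradedSpace.{u} k) (j : ℤ) : PreservesFiniteLimits (component d U j) :=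
  (component_preserves U j).1

instance (U : GradedSpace.{u} k) (j : ℤ) : PreservesFiniteColimits (component d U j) :=
  (component_preserves U j).2

theorem bounded_shift (X : DerivedCategory (PolyFunctor.{u} k d)) (n : ℤ)
    (hX : DerivedCategory.TStructure.t.bounded X) :
    DerivedCategory.TStructure.t.bounded ((shiftFunctor _ n).obj X) :=
  ObjectProperty.le_shift (DerivedCategory.TStructure.t.bounded) n _ hX

theorem bounded_component (X : DerivedCategory (PolyFunctor.{u} k d)) (U : GradedSpace.{u} k)
    (j : ℤ) (hX : DerivedCategory.TStructure.t.bounded X) :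
    DerivedCategory.TStructure.t.bounded ((component d U j).mapDerivedCategory.obj X) := by
  obtain ⟨⟨a, ha⟩, ⟨b, hb⟩⟩ := hX
  have : X.IsGE a := ha
  have : X.IsLE b := hb
  obtain ⟨K, _, _, ⟨e⟩⟩ := X.exists_iso_Q_obj_of_isGE_of_isLE a b
  let L : CochainComplex (PolyFunctor.{u} k d) ℤ := ((component d U j).mapHomologicalComplex (ComplexShape.up ℤ)).obj K
  let i : DerivedCategory.Q.obj L ≅ (component d U j).mapDerivedCategory.obj X :=
    ((component d U j).mapDerivedCategoryFactors.app K).symm ≪≫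
      (component d U j).mapDerivedCategory.mapIso e.symm
  have : L.IsStrictlyGE a := by
    rw [CochainComplex.isStrictlyGE_iff]
    exact fun n hn => (component d U j).map_isZero (K.isZero_of_isStrictlyGE a _ hn)
  have : L.IsStrictlyLE b := by
    rw [CochainComplex.isStrictlyLE_iff]
    exact fun n hn => (component d U j).map_isZero (K.isZero_of_isStrictlyLE b _ hn)
  refine ObjectProperty.prop_of_iso _ i ⟨⟨a, ?_⟩, ⟨b, ?_⟩⟩
  · exact (inferInstance : (DerivedCategory.Q.obj L).IsGE a)
  · exact (inferInstance : (DerivedCategory.Q.obj L).IsLE b)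

/-- The endofunctor `X ↦ X_U` of the derived category of `𝒫_d`, for a graded space `U`: the direct
sum over `j` of the components of degree `j`, placed in cohomological degree `j`. -/
def twist (d : ℕ) (U : GradedSpace.{u} k) :
    DerivedCategory (PolyFunctor.{u} k d) ⥤ DerivedCategory (PolyFunctor.{u} k d) where
  obj X := ⨁ fun j : U.dual.degs d =>
    (shiftFunctor _ (-j.1)).obj ((component d U j.1).mapDerivedCategory.obj X)
  map f := biproduct.map fun j =>
    (shiftFunctor _ (-j.1)).map ((component d U j.1).mapDerivedCategory.map f)
  map_id X := by
    simp only [CategoryTheory.Functor.map_id]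
    exact biproduct.hom_ext _ _ fun j => by simp
  map_comp f g := by
    simp only [CategoryTheory.Functor.map_comp]
    exact biproduct.hom_ext _ _ fun j => by simp

theorem bounded_twist (X : DerivedCategory (PolyFunctor.{u} k d)) (U : GradedSpace.{u} k)
    (hX : DerivedCategory.TStructure.t.bounded X) :
    DerivedCategory.TStructure.t.bounded ((twist d U).obj X) :=
  ObjectProperty.prop_of_iso _ (biproduct.isoProduct _).symm
    (ObjectProperty.prop_pi _ _ fun j => bounded_shift _ _ (bounded_component X U j.1 hX))

/-- The endofunctor `X ↦ X_U` of the bounded derived category of `𝒫_d`, for a graded space `U`. -/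
def twistBounded (d : ℕ) (U : GradedSpace.{u} k) :
    DerivedCategory.Bounded (PolyFunctor.{u} k d) ⥤
      DerivedCategory.Bounded (PolyFunctor.{u} k d) :=
  ObjectProperty.lift _ (DerivedCategory.Bounded.ι ⋙ twist d U)
    fun X => bounded_twist _ U X.property

/-- An isomorphism `A(V ⊗ W) ≃ A(V) ⊗ A(W)` of strict polynomial bifunctors in `V` and `W`:
a family of isomorphisms which is natural with respect to `D^s(Hom(V, V'))` and
`D^s(Hom(W, W'))`. -/
structure TensorIso (A : PolyFunctor.{u} k s) where
  iso : ∀ V W : DivCat.{u} k s,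
    A.obj.obj (tensorObj V W) ≃ₗ[k] (A.obj.obj V ⊗[k] A.obj.obj W)
  naturality : ∀ {V V' W W' : DivCat.{u} k s} (f : V ⟶ V') (g : W ⟶ W') (x),
    iso V' W' ((A.obj.map (tensorHom f g)).hom.hom x) =
      TensorProduct.map (A.obj.map f).hom.hom (A.obj.map g).hom.hom (iso V W x)

end Twist

end StrictPoly

end

/-! The functor `F ↦ F_U` is a finite direct sum of shifted exact functors `component d U j`, each
cut out of `F ↦ F(U^* ⊗ -)` by an idempotent of `Γ^d 𝒱`. It therefore suffices to move one component
and one shift through the derived functor, and to match the index sets and idempotents on both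
sides.

Before deriving, the statement is obtained by taking right adjoints. Multiplicativity gives `F(A(U ⊗
V)) ≃ F(A(U) ⊗ A(V))`, so `𝐂_A` intertwines tensoring the argument with `U` and with `A(U)`,
compatibly with the idempotents (`precompAPartIso`). By the Yoneda lemma `rightAdj d A` is right
adjoint to `𝐂_A` (`rightAdjAdj`). Since `U^* ⊗ -` is left adjoint to `U ⊗ -`, precomposition with `U
⊗ -` is left adjoint to precomposition with `U^* ⊗ -`. This adjunction restricts to the pieces cut
out by an idempotent and its transpose (`partAdj`), because `tensorAdj_unit_transpose` says that the
unit exchanges the two. Uniqueness of right adjoints yields `partRightAdjIso`. The gradings agree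
because the projection of `A(U)^{⊗ d}` onto degree `j` is induced by that of `U^{⊗ ds}`
(`GradedSpace.eval_weight`).

The components are exact, and preserve injectives as right adjoints of exact functors. On bounded
below complexes of injectives, which model the bounded below derived category, right derived
functors are computed termwise. Hence the underived isomorphism passes to the derived functors
(`nonempty_rightDerived_iso`), and shifts pass through as well. Summing over degrees proves the
claim for `𝐊^r_A`.

For `𝐊^l_A`, Kuhn duality sends `F_U` to `(F^#)_{U^*}`, because it exchanges the components of
degrees `j` and `-j` and the shifts by `n` and `-n` (`kuhnTwistIso`). Moreover `A^#` is again
multiplicative (`TensorIso.kuhn`), and `A^#(U^*)` is graded dual to `A(U)` (`gradedDualityEval`).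
The second claim for `A` and `U` is thus the Kuhn dual of the first claim for `A^#` and `U^*`. -/

noncomputable section

/-! ### Retracts and finite direct sum decompositions of functors. -/

namespace CategoryTheory

open Limits

/-- Retracts of isomorphic objects are isomorphic if the isomorphism is compatible with the
idempotents. -/
def Retract.isoOfIso {C : Type*} [Category* C] {X X' Y Y' : C} (h : Retract Y X)
    (h' : Retract Y' X') (e : X ≅ X') (w : (h.r ≫ h.i) ≫ e.hom = e.hom ≫ h'.r ≫ h'.i) :
    Y ≅ Y' where
  hom := h.i ≫ e.hom ≫ h'.r
  inv := h'.i ≫ e.inv ≫ h.r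
  hom_inv_id := by
    -- Composed with `h.i`, the condition `w` says that `h'.r ≫ h'.i` may be dropped after `h.i ≫
    -- e.hom`.
    have w₁ := h.i ≫= w
    simp only [Category.assoc, h.retract_assoc] at w₁
    simp only [Category.assoc]
    rw [← reassoc_of% w₁]
    simp
  inv_hom_id := by
    have w₁ : (h'.r ≫ h'.i) ≫ e.inv = e.inv ≫ h.r ≫ h.i := by
      rw [Iso.comp_inv_eq, Category.assoc, w, e.inv_hom_id_assoc]
    have w₂ := h'.i ≫= w₁
    simp only [Category.assoc, h'.retract_assoc] at w₂
    simp only [Category.assoc]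
    rw [← reassoc_of% w₂]
    simp

/-- The data which presents a functor `G` as the biproduct of a finite family of functors. -/
structure FunctorDecomp {C D J : Type*} [Category* C] [Category* D] [Preadditive D] [Fintype J]
    (G : C ⥤ D) (H : J → C ⥤ D) where
  ι : ∀ j, H j ⟶ G
  π : ∀ j, G ⟶ H j
  ι_π : ∀ j X, (ι j).app X ≫ (π j).app X = 𝟙 _
  ι_π_ne : ∀ i j, i ≠ j → ∀ X, (ι i).app X ≫ (π j).app X = 0
  sum : ∀ X, ∑ j, (π j).app X ≫ (ι j).app X = 𝟙 _

namespace FunctorDecomp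

variable {B C D E J J' : Type*} [Category* B] [Category* C] [Category* D] [Category* E]
  [Preadditive D] [Preadditive E] [Fintype J] [Fintype J']
  {G G' : C ⥤ D} {H : J → C ⥤ D} {H' : J' → C ⥤ D}

def precomp (δ : FunctorDecomp G H) (K : B ⥤ C) : FunctorDecomp (K ⋙ G) fun j => K ⋙ H j where
  ι j := Functor.whiskerLeft K (δ.ι j)
  π j := Functor.whiskerLeft K (δ.π j)
  ι_π j _ := δ.ι_π j _
  ι_π_ne i j h _ := δ.ι_π_ne i j h _
  sum _ := δ.sum _

def postcomp (δ : FunctorDecomp G H) (K : D ⥤ E) [K.Additive] :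
    FunctorDecomp (G ⋙ K) fun j => H j ⋙ K where
  ι j := Functor.whiskerRight (δ.ι j) K
  π j := Functor.whiskerRight (δ.π j) K
  ι_π j X := by
    dsimp
    rw [← K.map_comp, δ.ι_π, K.map_id]
  ι_π_ne i j h X := by
    dsimp
    rw [← K.map_comp, δ.ι_π_ne i j h, K.map_zero]
  sum X := by
    dsimp
    simp only [← K.map_comp]
    rw [← K.map_sum, δ.sum, K.map_id]

/-- Needed because Kuhn duality is contravariant; inclusions and projections change places. -/
def op (δ : FunctorDecomp G H) : FunctorDecomp G.op fun j => (H j).op where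
  ι j := NatTrans.op (δ.π j)
  π j := NatTrans.op (δ.ι j)
  ι_π j _ := Quiver.Hom.unop_inj (δ.ι_π j _)
  ι_π_ne i j h _ := Quiver.Hom.unop_inj (δ.ι_π_ne j i h.symm _)
  sum X := Quiver.Hom.unop_inj ((unop_sum _ _ _ _).trans (δ.sum X.unop))

/-- Fullness lifts the inclusions and projections, and faithfulness reflects the identities between
them. This brings a decomposition formed in the whole derived category back to a full subcategory on
which the derived functor is defined. -/
def ofFullyFaithful (K : D ⥤ E) [K.Additive] [K.Full] [K.Faithful]
    (δ : FunctorDecomp (G ⋙ K) fun j => H j ⋙ K) : FunctorDecomp G H where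
  ι j := ((Functor.FullyFaithful.ofFullyFaithful K).whiskeringRight C).preimage (δ.ι j)
  π j := ((Functor.FullyFaithful.ofFullyFaithful K).whiskeringRight C).preimage (δ.π j)
  ι_π j X := K.map_injective (by simpa using δ.ι_π j X)
  ι_π_ne i j h X := K.map_injective (by simpa using δ.ι_π_ne i j h X)
  sum X := K.map_injective (by simpa using δ.sum X)

def congrIso (δ : FunctorDecomp G H) {K : J → C ⥤ D} (e : ∀ j, H j ≅ K j) : FunctorDecomp G K where
  ι j := (e j).inv ≫ δ.ι j
  π j := δ.π j ≫ (e j).hom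
  ι_π j X := by
    have := δ.ι_π j X
    simp [reassoc_of% this]
  ι_π_ne i j h X := by
    have := δ.ι_π_ne i j h X
    simp [reassoc_of% this]
  sum X := by simpa using δ.sum X

/-- Functors with isomorphic summands are isomorphic. -/
def iso (δ : FunctorDecomp G H) (δ' : FunctorDecomp G' H') (σ : J ≃ J')
    (e : ∀ j, H j ≅ H' (σ j)) : G ≅ G' :=
  NatIso.ofComponents (fun X =>
    -- Both maps are diagonal for the decompositions, so in a composite only equal indices survive,
    -- and they add up to the identity.
    { hom := ∑ j, (δ.π j).app X ≫ (e j).hom.app X ≫ (δ'.ι (σ j)).app X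
      inv := ∑ j, (δ'.π (σ j)).app X ≫ (e j).inv.app X ≫ (δ.ι j).app X
      hom_inv_id := by
        classical
        rw [Preadditive.sum_comp, ← δ.sum]
        refine Finset.sum_congr rfl fun i _ => ?_
        rw [Preadditive.comp_sum, Finset.sum_eq_single i]
        · have := δ'.ι_π (σ i) X
          simp [reassoc_of% this]
        · intro j _ h
          have := δ'.ι_π_ne (σ i) (σ j) (fun h' => h (σ.injective h').symm) X
          simp [reassoc_of% this]
        · simp
      inv_hom_id := by
        classical
        rw [Preadditive.sum_comp, ← δ'.sum, ← σ.sum_comp]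
        refine Finset.sum_congr rfl fun i _ => ?_
        rw [Preadditive.comp_sum, Finset.sum_eq_single i]
        · have := δ.ι_π i X
          simp [reassoc_of% this]
        · intro j _ h
          have := δ.ι_π_ne i j h.symm X
          simp [reassoc_of% this]
        · simp })
    (fun f => by simp [Preadditive.sum_comp, Preadditive.comp_sum])

end FunctorDecomp

/-- Restriction along an equivalence is fully faithful on functor categories, hence reflects
isomorphisms of functors. It is used with `E` the equivalence from complexes of injectives to the
derived category. -/
theorem isoOfPrecompEquivalence {A B C : Type*} [Category* A] [Category* B] [Category* C]
    (E : A ⥤ B) [E.IsEquivalence] {G G' : B ⥤ C} (e : E ⋙ G ≅ E ⋙ G') : Nonempty (G ≅ G') :=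
  ⟨((Functor.whiskeringLeft _ _ _).obj E).preimageIso e⟩

/-! ### Right derived functors computed on bounded below complexes of injectives. -/

section RightDerived

variable {C D : Type*} [Category* C] [Category* D] [Abelian C] [Abelian D]
  [HasDerivedCategory C] [HasDerivedCategory D] 

variable (C) in
/-- The functor from bounded below complexes of injectives up to homotopy to the bounded below
derived category. -/
def injectiveToDerived : HomotopyCategory.Plus (InjectiveObject C) ⥤ DerivedCategory.Plus C :=
  (InjectiveObject.ι C).mapHomotopyCategoryPlus ⋙ DerivedCategory.Plus.Qh

/-- Bounded below complexes of injectives are K-injective, so morphisms into them are the same in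
the homotopy category and in the derived category. Fullness holds for the same reason. -/
instance : (injectiveToDerived C).Faithful where
  map_injective {X Y} f g h := by
    refine (InjectiveObject.ι C).mapHomotopyCategoryPlus.map_injective ?_
    obtain ⟨Y', rfl⟩ := HomotopyCategory.Plus.quotient_obj_surjective Y
    exact (DerivedCategory.Plus.Qh_map_bijective_of_isKInjective _ _
      (inferInstanceAs (CochainComplex.IsKInjective
        (((InjectiveObject.ι C).mapHomologicalComplex (.up ℤ)).obj Y'.obj)))).injective h

instance : (injectiveToDerived C).Full where
  map_surjective {X Y} f := by
    obtain ⟨Y', rfl⟩ := HomotopyCategory.Plus.quotient_obj_surjective Y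
    obtain ⟨g, hg⟩ := (DerivedCategory.Plus.Qh_map_bijective_of_isKInjective _ _
      (inferInstanceAs (CochainComplex.IsKInjective
        (((InjectiveObject.ι C).mapHomologicalComplex (.up ℤ)).obj Y'.obj)))).surjective f
    exact ⟨(InjectiveObject.ι C).mapHomotopyCategoryPlus.preimage g, by
      simpa [injectiveToDerived] using hg⟩

/-- Every bounded below object has an injective resolution. -/
instance [EnoughInjectives C] : (injectiveToDerived C).EssSurj where
  mem_essImage K := by
    obtain ⟨n, hn⟩ := K.property
    have : K.IsGE n := (K.isGE_ι_obj_iff n).1 hn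
    obtain ⟨L, _, ⟨e⟩⟩ := DerivedCategory.Plus.exists_injective_nonempty_iso K n
    exact ⟨(HomotopyCategory.Plus.quotient _).obj L, ⟨e⟩⟩

instance [EnoughInjectives C] : (injectiveToDerived C).IsEquivalence where

instance : (injectiveToDerived C).CommShift ℤ :=
  inferInstanceAs (((InjectiveObject.ι C).mapHomotopyCategoryPlus ⋙
    DerivedCategory.Plus.Qh).CommShift ℤ)

instance : (DerivedCategory.Plus.Qh (C := C)).Additive := inferInstance

instance {C D : Type*} [Category* C] [Category* D] [Preadditive C] [Preadditive D] (F : C ⥤ D)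
    [F.Additive] : F.mapHomotopyCategoryPlus.Additive where
  map_add := by
    intros
    refine (HomotopyCategory.Plus.ι D).map_injective ?_
    exact (F.mapHomotopyCategory (.up ℤ)).map_add

instance : (injectiveToDerived C).Additive :=
  inferInstanceAs (_ ⋙ DerivedCategory.Plus.Qh).Additive

variable (F : C ⥤ D) [F.Additive] [EnoughInjectives C]

/-- The right derived functor is computed by complexes of injectives. -/
def injectiveToDerivedCompRightDerived :
    injectiveToDerived C ⋙ F.rightDerivedFunctorPlus ≅
      (InjectiveObject.ι C ⋙ F).mapHomotopyCategoryPlus ⋙ DerivedCategory.Plus.Qh :=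
  -- The unit of the right derived functor is invertible on complexes of injectives.
  (@asIso _ _ _ _ (Functor.whiskerLeft (InjectiveObject.ι C).mapHomotopyCategoryPlus
    F.rightDerivedFunctorPlusUnit) (by
      rw [NatTrans.isIso_iff_isIso_app]
      intro X
      dsimp only [Functor.whiskerLeft_app]
      infer_instance)).symm ≪≫ (Functor.associator _ _ _).symm ≪≫
    Functor.isoWhiskerRight (Functor.mapHomotopyCategoryPlusCompIso (Iso.refl _)) _

/-- Additivity can be tested after the full and essentially surjective additive functor
`injectiveToDerived C`, where the derived functor is termwise application of `F`. It lets finite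
direct sums pass through the derived functor. -/
instance : F.rightDerivedFunctorPlus.Additive := by
  have : (injectiveToDerived C ⋙ F.rightDerivedFunctorPlus).Additive :=
    Functor.additive_of_iso (injectiveToDerivedCompRightDerived F).symm
  exact Functor.additive_of_full_essSurj_comp (injectiveToDerived C) _

/-- The functor induced by an exact functor on bounded below derived categories. -/
def mapDerivedPlus (T : C ⥤ D) [T.Additive] [PreservesFiniteLimits T] [PreservesFiniteColimits T] :
    DerivedCategory.Plus C ⥤ DerivedCategory.Plus D :=
  ObjectProperty.lift _ (DerivedCategory.Plus.ι ⋙ T.mapDerivedCategory) (by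
    rintro ⟨X, n, K, e, h⟩
    have : CochainComplex.IsStrictlyGE ((T.mapHomologicalComplex (ComplexShape.up ℤ)).obj K) n :=
      inferInstance
    exact ⟨n, _, T.mapDerivedCategory.mapIso e ≪≫ T.mapDerivedCategoryFactors.app K, this⟩)

/-- On complexes, `mapDerivedPlus` is given by termwise application of the functor. -/
def mapDerivedPlusFactors (T : C ⥤ D) [T.Additive] [PreservesFiniteLimits T]
    [PreservesFiniteColimits T] : DerivedCategory.Plus.Qh ⋙ mapDerivedPlus T ≅
      T.mapHomotopyCategoryPlus ⋙ DerivedCategory.Plus.Qh :=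
  (DerivedCategory.TStructure.t.plus.fullyFaithfulι.whiskeringRight _).preimageIso
    (Functor.isoWhiskerLeft (HomotopyCategory.Plus.ι C) T.mapDerivedCategoryFactorsh)

/-- The functor induced on injective objects. -/
def injectiveRestrict (T : C ⥤ D) [T.PreservesInjectiveObjects] :
    InjectiveObject C ⥤ InjectiveObject D :=
  ObjectProperty.lift _ (InjectiveObject.ι C ⋙ T) fun X => T.injective_obj X.obj


instance (T : C ⥤ D) [T.Additive] [T.PreservesInjectiveObjects] :
    (injectiveRestrict T).Additive where
  map_add := by
    intros
    exact (InjectiveObject.ι D).map_injective T.map_add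

def injectiveRestrictCompι (T : C ⥤ D) [T.PreservesInjectiveObjects] :
    injectiveRestrict T ⋙ InjectiveObject.ι D ≅ InjectiveObject.ι C ⋙ T :=
  ObjectProperty.liftCompιIso _ _ _

/-- An exact functor which preserves injective objects acts on bounded below complexes of
injectives. -/
def injectiveToDerivedCompMap (T : C ⥤ D) [T.Additive] [PreservesFiniteLimits T]
    [PreservesFiniteColimits T] [T.PreservesInjectiveObjects] :
    injectiveToDerived C ⋙ mapDerivedPlus T ≅
      (injectiveRestrict T).mapHomotopyCategoryPlus ⋙ injectiveToDerived D :=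
  Functor.associator _ _ _ ≪≫ Functor.isoWhiskerLeft _ (mapDerivedPlusFactors T) ≪≫
    (Functor.associator _ _ _).symm ≪≫
    Functor.isoWhiskerRight (Functor.mapHomotopyCategoryPlusCompIso
        (Iso.refl (InjectiveObject.ι C ⋙ T)) ≪≫
      (Functor.mapHomotopyCategoryPlusCompIso (injectiveRestrictCompι T)).symm) _ ≪≫
    Functor.associator _ _ _

/-- Right derived functors are compatible with exact functors that preserve injective objects. -/
theorem nonempty_rightDerived_iso {C' D' : Type*} [Category* C'] [Category* D'] [Abelian C']
    [Abelian D'] [HasDerivedCategory C'] [HasDerivedCategory D'] [EnoughInjectives C']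
    (F : C ⥤ D) [F.Additive] (F' : C' ⥤ D') [F'.Additive] (T : C ⥤ C') [T.Additive]
    [PreservesFiniteLimits T] [PreservesFiniteColimits T] [T.PreservesInjectiveObjects]
    (T' : D ⥤ D') [T'.Additive] [PreservesFiniteLimits T'] [PreservesFiniteColimits T']
    (e : T ⋙ F' ≅ F ⋙ T') :
    Nonempty (mapDerivedPlus T ⋙ F'.rightDerivedFunctorPlus ≅
      F.rightDerivedFunctorPlus ⋙ mapDerivedPlus T') := by
  -- On complexes of injectives everything is termwise: `T` keeps the terms injective, so no second
  -- resolution is needed before deriving `F'`, and the exact functor `T'` needs none. Both sides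
  -- thus reduce to the two functors compared by `e`.
  refine isoOfPrecompEquivalence (injectiveToDerived C) ?_
  have e₁ : injectiveRestrict T ⋙ (InjectiveObject.ι C' ⋙ F') ≅
      (InjectiveObject.ι C ⋙ F) ⋙ T' := Functor.isoWhiskerLeft (InjectiveObject.ι C) e
  exact (Functor.associator _ _ _).symm ≪≫
    Functor.isoWhiskerRight (injectiveToDerivedCompMap T) _ ≪≫ Functor.associator _ _ _ ≪≫
    Functor.isoWhiskerLeft _ (injectiveToDerivedCompRightDerived F') ≪≫
    (Functor.associator _ _ _).symm ≪≫
    Functor.isoWhiskerRight (Functor.mapHomotopyCategoryPlusCompIso e₁ ≪≫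
      (Functor.mapHomotopyCategoryPlusCompIso (Iso.refl _)).symm) _ ≪≫
    Functor.associator _ _ _ ≪≫
    Functor.isoWhiskerLeft _ (mapDerivedPlusFactors T').symm ≪≫
    (Functor.associator _ _ _).symm ≪≫
    Functor.isoWhiskerRight (injectiveToDerivedCompRightDerived F).symm _ ≪≫
    Functor.associator _ _ _

/-- Right derived functors commute with the shifts. -/
theorem nonempty_rightDerived_shift (n : ℤ) :
    Nonempty (shiftFunctor _ n ⋙ F.rightDerivedFunctorPlus ≅
      F.rightDerivedFunctorPlus ⋙ shiftFunctor _ n) := by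
  -- Termwise application of `F` to complexes of injectives commutes with the shift.
  refine isoOfPrecompEquivalence (injectiveToDerived C) ?_
  exact (Functor.associator _ _ _).symm ≪≫
    Functor.isoWhiskerRight ((injectiveToDerived C).commShiftIso n).symm _ ≪≫
    Functor.associator _ _ _ ≪≫
    Functor.isoWhiskerLeft _ (injectiveToDerivedCompRightDerived F) ≪≫
    ((InjectiveObject.ι C ⋙ F).mapHomotopyCategoryPlus ⋙
      DerivedCategory.Plus.Qh).commShiftIso n ≪≫
    Functor.isoWhiskerRight (injectiveToDerivedCompRightDerived F).symm _ ≪≫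
    Functor.associator _ _ _

end RightDerived

end CategoryTheory

/-! ### Restriction of an adjunction to retracts of its two functors. -/

namespace CategoryTheory

/-- Compatible retracts of adjoint functors are adjoint. -/
def Adjunction.ofRetract {C D : Type*} [Category* C] [Category* D] {L L₀ : C ⥤ D} {R R₀ : D ⥤ C}
    (adj : L ⊣ R) (hL : Retract L₀ L) (hR : Retract R₀ R)
    (w : ∀ X, adj.unit.app X ≫ R.map (hL.r.app X ≫ hL.i.app X) =
      adj.unit.app X ≫ hR.r.app (L.obj X) ≫ hR.i.app (L.obj X)) : L₀ ⊣ R₀ :=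
  have hLX : ∀ X, hL.i.app X ≫ hL.r.app X = 𝟙 _ := fun X => congr($(hL.retract).app X)
  have hRX : ∀ X, hR.i.app X ≫ hR.r.app X = 𝟙 _ := fun X => congr($(hR.retract).app X)
  Adjunction.mkOfUnitCounit
    { unit :=
        { app := fun X => adj.unit.app X ≫ R.map (hL.r.app X) ≫ hR.r.app _
          naturality := fun X Y f => by
            have h₁ := adj.unit_naturality f
            have h₂ := hL.r.naturality f
            have h₃ := hR.r.naturality (L₀.map f)
            dsimp at h₃ ⊢
            rw [Category.assoc, Category.assoc, ← h₃, ← R.map_comp_assoc, ← h₂, R.map_comp_assoc,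
              ← adj.unit_naturality_assoc] }
      counit :=
        { app := fun Y => hL.i.app _ ≫ L.map (hR.i.app Y) ≫ adj.counit.app Y
          naturality := fun X Y f => by
            have h₂ := hL.i.naturality (R₀.map f)
            have h₃ := hR.i.naturality f
            dsimp at h₂ ⊢
            rw [reassoc_of% h₂, ← L.map_comp_assoc, h₃, L.map_comp_assoc, Category.assoc,
              Category.assoc, adj.counit_naturality] }
      left_triangle := by
        ext X
        have h₁ := hL.i.naturality (adj.unit.app X ≫ R.map (hL.r.app X) ≫ hR.r.app _)
        -- By `w`, the idempotent of `R` acts on the unit as the idempotent of `L`, and the latter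
        -- is absorbed by `R.map (hL.r.app X)`.
        have h₂ : (adj.unit.app X ≫ R.map (hL.r.app X) ≫ hR.r.app _) ≫ hR.i.app _ =
            adj.unit.app X ≫ R.map (hL.r.app X) := by
          have h₃ := hR.r.naturality (hL.r.app X)
          have h₄ := hR.i.naturality (hL.r.app X)
          have h₅ := w X =≫ R.map (hL.r.app X)
          simp only [R.map_comp, Category.assoc] at h₅
          rw [← R.map_comp, hLX, R.map_id, Category.comp_id] at h₅
          simp only [Category.assoc]
          rw [reassoc_of% h₃, h₄, h₅]
        dsimp
        simp only [Category.id_comp]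
        dsimp at h₁
        rw [reassoc_of% h₁, ← L.map_comp_assoc, h₂, L.map_comp_assoc, adj.counit_naturality,
          adj.left_triangle_components_assoc, hLX]
      right_triangle := by
        ext Y
        have h₁ := hR.r.naturality (hL.i.app (R₀.obj Y) ≫ L.map (hR.i.app Y) ≫ adj.counit.app Y)
        dsimp at h₁ ⊢
        simp only [Category.assoc, Category.id_comp]
        rw [← h₁, R.map_comp_assoc]
        -- Here `w` turns the idempotent of `L` into that of `R`, which naturality moves next to the
        -- final `hR.r`, where it disappears. What remains is the triangle identity of `adj` between
        -- `hR.i` and `hR.r`.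
        have h₅ := w (R₀.obj Y) =≫ R.map (L.map (hR.i.app Y) ≫ adj.counit.app Y) ≫ hR.r.app _
        dsimp at h₅
        simp only [Category.assoc, R.map_comp] at h₅
        simp only [Category.assoc, R.map_comp]
        rw [h₅]
        have h₆ := hR.i.naturality (L.map (hR.i.app Y) ≫ adj.counit.app Y)
        have h₇ := hR.r.naturality (L.map (hR.i.app Y) ≫ adj.counit.app Y)
        rw [← R.map_comp_assoc, ← reassoc_of% h₆, ← reassoc_of% h₇, hRX, Category.comp_id,
          R.map_comp, Category.assoc, adj.unit_naturality_assoc,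
          adj.right_triangle_components_assoc, hRX] }

end CategoryTheory

namespace StrictPoly

/-! ### Morphisms of the divided power category given by linear maps. -/

section DivPowerMorphisms

variable {k : Type u} [Field k] {d : ℕ}

/-- The morphism `f^{⊗ d}` of `Γ^d 𝒱` given by a linear map `f`. -/
def diagHom {V W : DivCat.{u} k d} (f : V.space →ₗ[k] W.space) : V ⟶ W :=
  (divPowDiag d f : divPow k d (V.space →ₗ[k] W.space))

theorem diagHom_id (V : DivCat.{u} k d) : diagHom (LinearMap.id : V.space →ₗ[k] V.space) = 𝟙 V :=
  rfl

/-- Composing with a pure power is `D^d` of a linear map of `Hom` spaces. Identities in `Γ^d 𝒱` that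
involve pure powers thereby reduce to identities of linear maps. -/
theorem comp_diagHom {V W X : DivCat.{u} k d} (f : V ⟶ W) (g : W.space →ₗ[k] X.space) :
    f ≫ diagHom g = divPowMap d (LinearMap.llcomp k V.space W.space X.space g) f :=
  Subtype.ext (map₂_diag_left _ _ _)

theorem diagHom_comp {V W X : DivCat.{u} k d} (f : V.space →ₗ[k] W.space) (g : W ⟶ X) :
    diagHom f ≫ g = divPowMap d (LinearMap.lcomp k X.space f) g :=
  Subtype.ext (map₂_diag_right _ _ _)

theorem divPowMap_diag {X Y : Type u} [AddCommGroup X] [Module k X] [AddCommGroup Y] [Module k Y]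
    (f : X →ₗ[k] Y) (x : X) : divPowMap d f (divPowDiag d x) = divPowDiag d (f x) :=
  Subtype.ext (PiTensorProduct.map_tprod _ _)

theorem diagHom_comp_diagHom {V W X : DivCat.{u} k d} (f : V.space →ₗ[k] W.space)
    (g : W.space →ₗ[k] X.space) : diagHom f ≫ diagHom g = (diagHom (g ∘ₗ f) : V ⟶ X) :=
  (comp_diagHom _ _).trans (divPowMap_diag _ _)

theorem divPowMap_divPowMap {X Y Z : Type u} [AddCommGroup X] [Module k X] [AddCommGroup Y]
    [Module k Y] [AddCommGroup Z] [Module k Z] (f : X →ₗ[k] Y) (g : Y →ₗ[k] Z) (x : divPow k d X) :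
    divPowMap d g (divPowMap d f x) = divPowMap d (g ∘ₗ f) x :=
  Subtype.ext (by
    rw [divPowMap_coe, divPowMap_coe, divPowMap_coe, PiTensorProduct.map_comp]
    rfl)

theorem tensorHom_id_left (U : DivCat.{u} k d) {V W : DivCat.{u} k d} (f : V ⟶ W) :
    tensorHom (𝟙 U) f = divPowMap d (LinearMap.lTensorHom U.space) f :=
  Subtype.ext (map₂_diag_left _ _ _)

theorem tensorHom_id_right (U : DivCat.{u} k d) {V W : DivCat.{u} k d} (f : V ⟶ W) :
    tensorHom f (𝟙 U) = divPowMap d (LinearMap.rTensorHom U.space) f :=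
  Subtype.ext (map₂_diag_right _ _ _)

theorem divPowMap_id {X : Type u} [AddCommGroup X] [Module k X] (x : divPow k d X) :
    divPowMap d LinearMap.id x = x :=
  Subtype.ext (map_eq_self _ (fun _ => rfl) _)

/-- A commutative square of linear maps which depend linearly on `x ∈ X` induces a commutative
square in `Γ^d 𝒱` for every element of `D^d(X)`. -/
theorem diagHom_naturality {V V' W W' : DivCat.{u} k d} (a : V.space →ₗ[k] V'.space)
    (b : W.space →ₗ[k] W'.space) {X : Type u} [AddCommGroup X] [Module k X]
    (g : X →ₗ[k] V.space →ₗ[k] W.space) (g' : X →ₗ[k] V'.space →ₗ[k] W'.space)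
    (h : ∀ x v, b (g x v) = g' x (a v)) (x : divPow k d X) {y : V ⟶ W} {y' : V' ⟶ W'}
    (hy : y = divPowMap d g x) (hy' : y' = divPowMap d g' x) :
    y ≫ diagHom b = diagHom a ≫ y' := by
  rw [comp_diagHom, diagHom_comp]
  subst hy hy'
  refine (divPowMap_divPowMap _ _ _).trans (Eq.trans ?_ (divPowMap_divPowMap _ _ _).symm)
  exact congrArg (fun f => divPowMap d f x) (LinearMap.ext fun x => LinearMap.ext fun v => h x v)

/-- Both sides are images of `x` under `D^d` of one and the same linear map. The condition is put on
linear families and not only on morphisms `f^{⊗ d}`, because over a small finite field the pure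
powers need not span `D^d(X)`. -/
theorem diagHom_comp_eq {V V' W' : DivCat.{u} k d} (a : V.space →ₗ[k] V'.space)
    {X : Type u} [AddCommGroup X] [Module k X]
    (g g' : X →ₗ[k] V'.space →ₗ[k] W'.space)
    (h : ∀ x v, g x (a v) = g' x (a v)) (x : divPow k d X) {y y' : V' ⟶ W'}
    (hy : y = divPowMap d g x) (hy' : y' = divPowMap d g' x) :
    diagHom a ≫ y = diagHom a ≫ y' := by
  rw [diagHom_comp, diagHom_comp]
  subst hy hy'
  refine (divPowMap_divPowMap _ _ _).trans (Eq.trans ?_ (divPowMap_divPowMap _ _ _).symm)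
  exact congrArg (fun f => divPowMap d f x) (LinearMap.ext fun x => LinearMap.ext fun v => h x v)

/-- The morphism `f` enters through the equation `hf`, so that the lemma can be iterated for nested
tensor products. -/
theorem tensorHom_id_left_eq (U : DivCat.{u} k d) {V W : DivCat.{u} k d} {X : Type u}
    [AddCommGroup X] [Module k X] (g : X →ₗ[k] V.space →ₗ[k] W.space) (x : divPow k d X)
    {f : V ⟶ W} (hf : f = divPowMap d g x) :
    tensorHom (𝟙 U) f = divPowMap d (LinearMap.lTensorHom U.space ∘ₗ g) x := by
  subst hf
  exact (tensorHom_id_left _ _).trans (divPowMap_divPowMap _ _ _)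

theorem tensorHom_id_right_eq (U : DivCat.{u} k d) {V W : DivCat.{u} k d} {X : Type u}
    [AddCommGroup X] [Module k X] (g : X →ₗ[k] V.space →ₗ[k] W.space) (x : divPow k d X)
    {f : V ⟶ W} (hf : f = divPowMap d g x) :
    tensorHom f (𝟙 U) = divPowMap d (LinearMap.rTensorHom U.space ∘ₗ g) x := by
  subst hf
  exact (tensorHom_id_right _ _).trans (divPowMap_divPowMap _ _ _)

theorem tensorHom_id_diagHom (U : DivCat.{u} k d) {V W : DivCat.{u} k d}
    (f : V.space →ₗ[k] W.space) :
    tensorHom (𝟙 U) (diagHom f) = diagHom (V := tensorObj U V) (W := tensorObj U W)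
      (f.lTensor U.space) :=
  (tensorHom_id_left _ _).trans (divPowMap_diag _ _)

/-- An isomorphism of `Γ^d 𝒱` given by a linear isomorphism. -/
def diagIso {V W : DivCat.{u} k d} (e : V.space ≃ₗ[k] W.space) : V ≅ W where
  hom := diagHom e.toLinearMap
  inv := diagHom e.symm.toLinearMap
  hom_inv_id := by rw [diagHom_comp_diagHom, e.symm_comp, diagHom_id]
  inv_hom_id := by rw [diagHom_comp_diagHom, e.comp_symm, diagHom_id]

end DivPowerMorphisms

/-! ### Duality between tensoring with `U` and with `U^*`. -/

section TensorAdjunction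

variable {k : Type u} [Field k] {d : ℕ}

/-- The dual of an object of `Γ^d 𝒱`. -/
abbrev dualDiv (U : DivCat.{u} k d) : DivCat.{u} k d := ⟨dualObj U.space⟩

/-- The map `V → U ⊗ (U^* ⊗ V)`. -/
def coevTensor (U V : Type u) [AddCommGroup U] [Module k U] [Module.Finite k U]
    [AddCommGroup V] [Module k V] : V →ₗ[k] U ⊗[k] (Module.Dual k U ⊗[k] V) :=
  ∑ i, TensorProduct.mk k U (Module.Dual k U ⊗[k] V) (Module.finBasis k U i) ∘ₗ
    TensorProduct.mk k (Module.Dual k U) V ((Module.finBasis k U).coord i)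

/-- The map `U^* ⊗ (U ⊗ V) → V`. -/
def evTensor (U V : Type u) [AddCommGroup U] [Module k U] [AddCommGroup V] [Module k V] :
    Module.Dual k U ⊗[k] (U ⊗[k] V) →ₗ[k] V :=
  (TensorProduct.lid k V).toLinearMap ∘ₗ (contractLeft k U).rTensor V ∘ₗ
    (TensorProduct.assoc k (Module.Dual k U) U V).symm.toLinearMap

theorem coevTensor_apply (U V : Type u) [AddCommGroup U] [Module k U] [Module.Finite k U]
    [AddCommGroup V] [Module k V] (v : V) : coevTensor (k := k) U V v =
      ∑ i, Module.finBasis k U i ⊗ₜ[k] ((Module.finBasis k U).coord i ⊗ₜ[k] v) := by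
  simp [coevTensor]

theorem evTensor_tmul (U V : Type u) [AddCommGroup U] [Module k U]
    [AddCommGroup V] [Module k V] (φ : Module.Dual k U) (x : U) (v : V) :
    evTensor (k := k) U V (φ ⊗ₜ (x ⊗ₜ v)) = φ x • v := by
  simp [evTensor]

theorem coevTensor_naturality (U V W : Type u) [AddCommGroup U] [Module k U] [Module.Finite k U]
    [AddCommGroup V] [Module k V] [AddCommGroup W] [Module k W] (f : V →ₗ[k] W) (v : V) :
    coevTensor (k := k) U W (f v) = (f.lTensor (Module.Dual k U)).lTensor U (coevTensor U V v) := by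
  simp [coevTensor_apply]

theorem evTensor_naturality (U V W : Type u) [AddCommGroup U] [Module k U]
    [AddCommGroup V] [Module k V] [AddCommGroup W] [Module k W] (f : V →ₗ[k] W) :
    evTensor (k := k) U W ∘ₗ (f.lTensor U).lTensor (Module.Dual k U) = f ∘ₗ evTensor U V := by
  ext φ x v
  simp [evTensor_tmul]

/-- In a basis and its dual basis, both sides are the same double sum over the matrix coefficients
of `f`, with the two summations exchanged. This is the reason why an idempotent of `U` corresponds
to its transpose under the adjunction. -/
theorem coevTensor_dualMap (U V : Type u) [AddCommGroup U] [Module k U] [Module.Finite k U]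
    [AddCommGroup V] [Module k V] (f : U →ₗ[k] U) (v : V) :
    (f.dualMap.rTensor V).lTensor U (coevTensor U V v) =
      f.rTensor (Module.Dual k U ⊗[k] V) (coevTensor U V v) := by
  simp only [coevTensor_apply, map_sum, LinearMap.lTensor_tmul, LinearMap.rTensor_tmul]
  let b := Module.finBasis k U
  change ∑ i, b i ⊗ₜ[k] (f.dualMap (b.coord i) ⊗ₜ[k] v) = ∑ i, f (b i) ⊗ₜ[k] (b.coord i ⊗ₜ[k] v)
  have h₁ : ∀ i, f.dualMap (b.coord i) = ∑ j, (b.coord i) (f (b j)) • b.coord j := fun i => by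
    refine b.ext fun l => ?_
    simp [Finsupp.single_apply]
  have h₂ : ∀ i, f (b i) = ∑ j, (b.coord j) (f (b i)) • b j := fun i => (b.sum_repr _).symm
  simp only [h₁]
  conv_rhs => enter [2, i]; rw [h₂ i]
  simp only [TensorProduct.sum_tmul, TensorProduct.tmul_sum, ← TensorProduct.smul_tmul',
    TensorProduct.tmul_smul]
  exact Finset.sum_comm

/-- A triangle identity, which amounts to the expansion of a linear form in the dual basis. -/
theorem evTensor_lTensor_coevTensor (U V : Type u) [AddCommGroup U] [Module k U]
    [Module.Finite k U] [AddCommGroup V] [Module k V] :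
    evTensor (k := k) U (Module.Dual k U ⊗[k] V) ∘ₗ
      (coevTensor U V).lTensor (Module.Dual k U) = LinearMap.id := by
  refine TensorProduct.ext' fun φ v => ?_
  let b := Module.finBasis k U
  have h : ∑ i, φ (b i) • b.coord i = φ := b.ext fun l => by simp
  rw [LinearMap.comp_apply, LinearMap.lTensor_tmul, coevTensor_apply, TensorProduct.tmul_sum,
    map_sum]
  simp only [evTensor_tmul]
  change ∑ i, φ (b i) • (b.coord i ⊗ₜ[k] v) = φ ⊗ₜ[k] v
  conv_rhs => rw [← h, TensorProduct.sum_tmul]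
  rfl

/-- The other triangle identity, which amounts to the expansion of a vector in the basis. -/
theorem lTensor_evTensor_coevTensor (U V : Type u) [AddCommGroup U] [Module k U]
    [Module.Finite k U] [AddCommGroup V] [Module k V] :
    (evTensor (k := k) U V).lTensor U ∘ₗ coevTensor U (U ⊗[k] V) = LinearMap.id := by
  refine TensorProduct.ext' fun x v => ?_
  let b := Module.finBasis k U
  rw [LinearMap.comp_apply, coevTensor_apply, map_sum]
  simp only [LinearMap.lTensor_tmul, evTensor_tmul]
  change ∑ i, b i ⊗ₜ[k] (b.coord i x • v) = x ⊗ₜ[k] v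
  conv_rhs => rw [← b.sum_repr x, TensorProduct.sum_tmul]
  exact Finset.sum_congr rfl fun i _ => (TensorProduct.smul_tmul _ _ _).symm

/-- The functor `U^* ⊗ -` is left adjoint to `U ⊗ -` on `Γ^d 𝒱`. -/
def tensorAdj (d : ℕ) (U : FGModuleCat.{u} k) : tensorLeft d (dualObj U) ⊣ tensorLeft d U :=
  Adjunction.mkOfUnitCounit
    { unit :=
        { app := fun V => diagHom (W := tensorObj ⟨U⟩ (tensorObj ⟨dualObj U⟩ V))
            (coevTensor U V.space)
          naturality := fun V W f => by
            exact diagHom_naturality _ _ LinearMap.id _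
              (fun f v => coevTensor_naturality U V.space W.space f v) f (divPowMap_id f).symm
              (tensorHom_id_left_eq _ _ _ (tensorHom_id_left _ _)) }
      counit :=
        { app := fun V => diagHom (V := tensorObj ⟨dualObj U⟩ (tensorObj ⟨U⟩ V))
            (evTensor U V.space)
          naturality := fun V W f => by
            exact diagHom_naturality _ _ _ LinearMap.id
              (fun f => LinearMap.congr_fun (evTensor_naturality U V.space W.space f)) f
              (tensorHom_id_left_eq _ _ _ (tensorHom_id_left _ _)) (divPowMap_id f).symm }
      left_triangle := by
        ext V
        refine (congrArg (_ ≫ ·) (Category.id_comp _)).trans ?_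
        refine (congrArg (· ≫ _) (tensorHom_id_diagHom _ _)).trans ?_
        refine (diagHom_comp_diagHom _ _).trans (congrArg diagHom ?_)
        exact evTensor_lTensor_coevTensor U V.space
      right_triangle := by
        ext V
        refine (congrArg (_ ≫ ·) (Category.id_comp _)).trans ?_
        refine (congrArg (_ ≫ ·) (tensorHom_id_diagHom _ _)).trans ?_
        refine (diagHom_comp_diagHom _ _).trans (congrArg diagHom ?_)
        exact lTensor_evTensor_coevTensor U V.space }

/-- The unit of the adjunction exchanges an endomorphism of `U` and its transpose. -/
theorem tensorAdj_unit_transpose {U : DivCat.{u} k d} (f : U ⟶ U) (V : DivCat.{u} k d) :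
    (tensorAdj d U.space).unit.app V ≫ tensorHom (𝟙 U) (tensorHom (transposeDiv f) (𝟙 V)) =
      (tensorAdj d U.space).unit.app V ≫ tensorHom f (𝟙 (tensorObj (dualDiv U) V)) := by
  exact diagHom_comp_eq _ _ _ (fun f v => coevTensor_dualMap _ _ f v) f
    (tensorHom_id_left_eq _ _ _ (tensorHom_id_right_eq _ _ _ rfl)) (tensorHom_id_right _ _)

end TensorAdjunction

end StrictPoly

namespace StrictPoly

/-! ### Adjunctions between the pieces cut out by idempotents. -/

section PartAdjunction

variable {k : Type u} [Field k] {d s : ℕ}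

theorem polyHom_ext {F G : PolyFunctor.{u} k d} {f g : F ⟶ G}
    (h : ∀ V x, (f.hom.app V).hom.hom x = (g.hom.app V).hom.hom x) : f = g :=
  ObjectProperty.hom_ext _ (NatTrans.ext (funext fun V => fgHom_ext (h V)))

theorem polyNatTrans_ext {C : Type*} [Category* C] {Φ Ψ : C ⥤ PolyFunctor.{u} k d} {α β : Φ ⟶ Ψ}
    (h : ∀ F V, (α.app F).hom.app V = (β.app F).hom.app V) : α = β :=
  NatTrans.ext (funext fun F => ObjectProperty.hom_ext _ (NatTrans.ext (funext fun V => h F V)))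

/-- A natural transformation between linear functors induces a natural transformation between
the precomposition functors. -/
def precompMap {e : ℕ} {Φ Ψ : DivCat.{u} k e ⥤ DivCat.{u} k d} [Φ.Additive] [Φ.Linear k]
    [Ψ.Additive] [Ψ.Linear k] (α : Φ ⟶ Ψ) : precomp Φ ⟶ precomp Ψ where
  app F := ObjectProperty.homMk (Functor.whiskerRight α F.obj)
  naturality _ _ f := ObjectProperty.hom_ext _ (NatTrans.ext (funext fun V =>
    (f.hom.naturality (α.app V)).symm))

/-- Isomorphic linear functors induce isomorphic precomposition functors. -/
def precompIso {e : ℕ} {Φ Ψ : DivCat.{u} k e ⥤ DivCat.{u} k d} [Φ.Additive] [Φ.Linear k]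
    [Ψ.Additive] [Ψ.Linear k] (α : Φ ≅ Ψ) : precomp Φ ≅ precomp Ψ where
  hom := precompMap α.hom
  inv := precompMap α.inv
  hom_inv_id := by
    refine polyNatTrans_ext fun F V => ?_
    exact (F.obj.map_comp _ _).symm.trans ((congrArg F.obj.map (α.hom_inv_id_app V)).trans
      (F.obj.map_id _))
  inv_hom_id := by
    refine polyNatTrans_ext fun F V => ?_
    exact (F.obj.map_comp _ _).symm.trans ((congrArg F.obj.map (α.inv_hom_id_app V)).trans
      (F.obj.map_id _))

/-- Precomposition with adjoint functors gives adjoint functors, with the roles exchanged. -/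
def precompAdj {L R : DivCat.{u} k d ⥤ DivCat.{u} k d} [L.Additive] [L.Linear k] [R.Additive]
    [R.Linear k] (adj : L ⊣ R) : precomp R ⊣ precomp L :=
  Adjunction.mkOfUnitCounit
    { unit :=
        { app := fun F => ObjectProperty.homMk
            { app := fun V => F.obj.map (adj.unit.app V)
              naturality := fun V W f => by
                refine (F.obj.map_comp _ _).symm.trans (Eq.trans ?_ (F.obj.map_comp _ _))
                exact congrArg F.obj.map (adj.unit.naturality f) }
          naturality := fun F G f => ObjectProperty.hom_ext _ (NatTrans.ext (funext fun V =>
            (f.hom.naturality (adj.unit.app V)).symm)) }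
      counit :=
        { app := fun F => ObjectProperty.homMk
            { app := fun V => F.obj.map (adj.counit.app V)
              naturality := fun V W f => by
                refine (F.obj.map_comp _ _).symm.trans (Eq.trans ?_ (F.obj.map_comp _ _))
                exact congrArg F.obj.map (adj.counit.naturality f) }
          naturality := fun F G f => ObjectProperty.hom_ext _ (NatTrans.ext (funext fun V =>
            (f.hom.naturality (adj.counit.app V)).symm)) }
      left_triangle := by
        refine polyNatTrans_ext fun F V => ?_
        -- Precomposition is contravariant in the order of composition, so the left triangle here is
        -- `F` applied to the right triangle of `adj`.
        refine (congrArg (F.obj.map _ ≫ ·) (Category.id_comp (F.obj.map _))).trans ?_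
        exact (F.obj.map_comp _ _).symm.trans ((congrArg F.obj.map
          (adj.right_triangle_components V)).trans (F.obj.map_id _))
      right_triangle := by
        refine polyNatTrans_ext fun F V => ?_
        refine (congrArg (F.obj.map _ ≫ ·) (Category.id_comp (F.obj.map _))).trans ?_
        exact (F.obj.map_comp _ _).symm.trans ((congrArg F.obj.map
          (adj.left_triangle_components V)).trans (F.obj.map_id _)) }

theorem partMap_partMap {U : DivCat.{u} k d} {e : U ⟶ U} (he : e ≫ e = e)
    (F : PolyFunctor.{u} k d) (V : DivCat.{u} k d) (y) :
    partMap e F V (partMap e F V y) = partMap e F V y := by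
  have h : tensorHom e (𝟙 V) ≫ tensorHom e (𝟙 V) = tensorHom e (𝟙 V) := by
    rw [← tensorHom_comp, he, Category.id_comp]
  have h' := congrArg F.obj.map h
  rw [CategoryTheory.Functor.map_comp] at h'
  exact congrArg (fun m => m.hom.hom y) h'

/-- The functor `part e` is a retract of `F ↦ F(U ⊗ -)`, if `e` is an idempotent. -/
def partRetract {U : DivCat.{u} k d} (e : U ⟶ U) (he : e ≫ e = e) :
    Retract (part e) (precomp (tensorLeft d U.space)) where
  i :=
    { app := fun F => ObjectProperty.homMk
        { app := fun V => FGModuleCat.ofHom (LinearMap.range (partMap e F V)).subtype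
          naturality := fun V W f => rfl }
      naturality := fun F G f => rfl }
  r :=
    { app := fun F => ObjectProperty.homMk
        { app := fun V => FGModuleCat.ofHom (partMap e F V).rangeRestrict
          naturality := fun V W f => fgHom_ext fun x =>
            Subtype.ext (tensMap_partMap e F f x).symm }
      naturality := fun F G f => ObjectProperty.hom_ext _ (NatTrans.ext (funext fun V =>
        fgHom_ext fun x => Subtype.ext
          (congrArg (fun m => m.hom.hom x) (f.hom.naturality (tensorHom e (𝟙 V)))).symm)) }
  retract := by
    refine polyNatTrans_ext fun F V => fgHom_ext fun x => ?_
    obtain ⟨_, y, rfl⟩ := x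
    exact Subtype.ext (partMap_partMap he F V y)

theorem transposeDiv_idem {U : DivCat.{u} k d} {e : U ⟶ U} (he : e ≫ e = e) :
    transposeDiv e ≫ transposeDiv e = transposeDiv e := by
  rw [← transposeDiv_comp, he]

/-- For an idempotent `e`, the functor `part e` is left adjoint to the functor given by the
transpose of `e`. -/
def partAdj {U : DivCat.{u} k d} (e : U ⟶ U) (he : e ≫ e = e) :
    part e ⊣ part (transposeDiv e) :=
  (precompAdj (tensorAdj d U.space)).ofRetract (partRetract e he)
    (partRetract (transposeDiv e) (transposeDiv_idem he)) fun F => by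
      -- The unit at `F` is `F` applied to the unit of `tensorAdj`, so the compatibility of the
      -- idempotents is the image under `F` of `tensorAdj_unit_transpose`.
      refine ObjectProperty.hom_ext _ (NatTrans.ext (funext fun V => ?_))
      refine (F.obj.map_comp _ _).symm.trans (Eq.trans ?_ (F.obj.map_comp _ _))
      exact congrArg F.obj.map (tensorAdj_unit_transpose e V).symm

end PartAdjunction

/-! ### The Yoneda lemma and the right adjoint of precomposition with `A`. -/

section RightAdjunction

variable {k : Type u} [Field k] {d s : ℕ}

/-- Morphisms of `FGModuleCat` as linear maps. -/
def homLinear (M N : FGModuleCat.{u} k) : (M ⟶ N) →ₗ[k] (M →ₗ[k] N) where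
  toFun f := f.hom.hom
  map_add' _ _ := rfl
  map_smul' _ _ := rfl

/-- The morphism `D^d_V ⟶ G` which corresponds to an element of `G(V)`. -/
def divYoneda (G : PolyFunctor.{u} k d) (V : DivCat.{u} k d) :
    G.obj.obj V →ₗ[k] (divFunctor V ⟶ G) where
  toFun x := ObjectProperty.homMk
    { app := fun W => FGModuleCat.ofHom (LinearMap.applyₗ x ∘ₗ
        (homLinear (G.obj.obj V) (G.obj.obj W)) ∘ₗ G.obj.mapLinearMap k)
      naturality := fun W _ g => fgHom_ext fun (f : V ⟶ W) =>
        congrArg (fun m => m.hom.hom x) (G.obj.map_comp f g) }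
  map_add' x y := polyHom_ext fun W (f : V ⟶ W) => map_add (G.obj.map f).hom.hom x y
  map_smul' r x := polyHom_ext fun W (f : V ⟶ W) => map_smul (G.obj.map f).hom.hom r x

/-- Naturality of the Yoneda map in `V`; it makes the unit of the adjunction a morphism of `𝒫_d`. -/
theorem divYoneda_map (G : PolyFunctor.{u} k d) {V W : DivCat.{u} k d} (f : V ⟶ W)
    (x : G.obj.obj V) :
    divYoneda G W ((G.obj.map f).hom.hom x) = divFunctorMap f ≫ divYoneda G V x :=
  polyHom_ext fun X (g : W ⟶ X) => (congrArg (fun m => m.hom.hom x) (G.obj.map_comp f g)).symm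

theorem divYoneda_comp {F G : PolyFunctor.{u} k d} (φ : F ⟶ G) {V : DivCat.{u} k d}
    (x : F.obj.obj V) : divYoneda F V x ≫ φ = divYoneda G V ((φ.hom.app V).hom.hom x) :=
  polyHom_ext fun _ f => congrArg (fun m => m.hom.hom x) (φ.hom.naturality f)

/-- Passage to the copy of a `Hom` space in the universe of `k`. -/
abbrev toShrink {F G : PolyFunctor.{u} k d} : (F ⟶ G) ≃ₗ[k] Shrink.{u} (F ⟶ G) :=
  (Shrink.linearEquiv.{u} k _).symm

theorem shrinkMap_toShrink {F G F' G' : PolyFunctor.{u} k d} (T : (F ⟶ G) →ₗ[k] (F' ⟶ G'))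
    (x : F ⟶ G) : (shrinkMap T).hom.hom (toShrink (k := k) x) = toShrink (k := k) (T x) :=
  congrArg (fun y => toShrink (k := k) (T y)) ((toShrink (k := k)).symm_apply_apply x)

theorem toShrink_symm_shrinkMap {F G F' G' : PolyFunctor.{u} k d}
    (T : (F ⟶ G) →ₗ[k] (F' ⟶ G')) (x : Shrink.{u} (F ⟶ G)) :
    (toShrink (k := k)).symm ((shrinkMap T).hom.hom x) = T ((toShrink (k := k)).symm x) :=
  (toShrink (k := k)).symm_apply_apply _

/-- The unit of the adjunction between `𝐂_A` and `rightAdj d A`. -/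
def rightAdjUnit (A : PolyFunctor.{u} k s) (G : PolyFunctor.{u} k d) :
    G ⟶ (rightAdj d A).obj ((precompA d A).obj G) :=
  ObjectProperty.homMk
    { app := fun V => FGModuleCat.ofHom (toShrink.toLinearMap ∘ₗ
        (precompA d A).mapLinearMap k ∘ₗ divYoneda G V)
      naturality := fun V W f => fgHom_ext fun x => by
        refine Eq.trans ?_ (shrinkMap_toShrink (rightAdjMap A ((precompA d A).obj G) f) _).symm
        refine congrArg (toShrink (k := k)) ?_
        refine (congrArg (precompA d A).map (divYoneda_map G f x)).trans ?_
        exact (precompA d A).map_comp _ _ }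

/-- Evaluation at the identity of `A(W)`, on `Hom(𝐂_A(D^d_{A(W)}), F)`. -/
def rightAdjEval (A : PolyFunctor.{u} k s) (F : PolyFunctor.{u} k (d * s))
    (W : DivCat.{u} k (d * s)) :
    ((precompA d A).obj (divFunctor ((inflate d A).obj W)) ⟶ F) →ₗ[k] F.obj.obj W where
  toFun y := (y.hom.app W).hom.hom (𝟙 ((inflate d A).obj W) : (inflate d A).obj W ⟶ _)
  map_add' _ _ := rfl
  map_smul' _ _ := rfl

/-- The counit of the adjunction between `𝐂_A` and `rightAdj d A`. -/
def rightAdjCounit (A : PolyFunctor.{u} k s) (F : PolyFunctor.{u} k (d * s)) :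
    (precompA d A).obj ((rightAdj d A).obj F) ⟶ F :=
  ObjectProperty.homMk
    { app := fun W => FGModuleCat.ofHom (rightAdjEval A F W ∘ₗ toShrink.symm.toLinearMap)
      naturality := fun V W f => fgHom_ext fun y => by
        refine (congrArg (rightAdjEval A F W) (toShrink_symm_shrinkMap _ y)).trans ?_
        let x : (precompA d A).obj (divFunctor ((inflate d A).obj V)) ⟶ F := toShrink.symm y
        have h := congrArg (fun m => m.hom.hom (𝟙 ((inflate d A).obj V) :
          (inflate d A).obj V ⟶ _)) (x.hom.naturality f)
        refine Eq.trans ?_ h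
        -- By naturality of `x`, only its arguments remain to be compared; both are `A(f)`, composed
        -- with an identity on one side or the other.
        refine congrArg (x.hom.app W).hom.hom ?_
        exact (Category.comp_id ((inflate d A).map f)).trans
          (Category.id_comp ((inflate d A).map f)).symm }

/-- The functor `rightAdj d A` is right adjoint to `𝐂_A`. -/
def rightAdjAdj (d : ℕ) (A : PolyFunctor.{u} k s) : precompA d A ⊣ rightAdj d A :=
  Adjunction.mkOfUnitCounit
    { unit :=
        { app := rightAdjUnit A
          naturality := fun F G φ => polyHom_ext fun V x => by
            refine Eq.trans ?_ (shrinkMap_toShrink _ _).symm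
            refine congrArg (toShrink (k := k)) ?_
            refine (congrArg (precompA d A).map (divYoneda_comp φ x).symm).trans ?_
            exact (precompA d A).map_comp _ _ }
      counit :=
        { app := rightAdjCounit A
          naturality := fun F G φ => polyHom_ext fun W y =>
            congrArg (rightAdjEval A G W) (toShrink_symm_shrinkMap _ y) }
      left_triangle := by
        refine polyNatTrans_ext fun G V => fgHom_ext fun x => ?_
        refine (congrArg (rightAdjEval A ((precompA d A).obj G) V)
          ((toShrink (k := k)).symm_apply_apply _)).trans ?_
        exact congrArg (fun m => m.hom.hom x) (G.obj.map_id ((inflate d A).obj V))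
      right_triangle := by
        refine polyNatTrans_ext fun F V => fgHom_ext fun y => ?_
        -- Once `y` is an actual morphism `x`, the composite sends `f` to the value of `x` at `f ≫
        -- 𝟙`.
        obtain ⟨x, rfl⟩ := (toShrink (k := k)).surjective y
        refine (shrinkMap_toShrink _ _).trans (congrArg (toShrink (k := k)) ?_)
        refine polyHom_ext fun W (f : V ⟶ (inflate d A).obj W) => ?_
        refine (congrArg (rightAdjEval A F W) ((toShrink_symm_shrinkMap _ _).trans
          (congrArg _ ((toShrink (k := k)).symm_apply_apply x)))).trans ?_
        exact congrArg (x.hom.app W).hom.hom (Category.comp_id f) }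

end RightAdjunction

end StrictPoly

namespace StrictPoly

/-! ### Multiplicativity of `A` and its consequence for the right adjoint. -/

section Exponential

variable {k : Type u} [Field k] {d s : ℕ}

theorem divPowMap_map₂ {X Y Z X' Y' Z' T : Type u} [AddCommGroup X] [Module k X] [AddCommGroup Y]
    [Module k Y] [AddCommGroup Z] [Module k Z] [AddCommGroup X'] [Module k X'] [AddCommGroup Y']
    [Module k Y'] [AddCommGroup Z'] [Module k Z'] [AddCommGroup T] [Module k T]
    (B : X →ₗ[k] Y →ₗ[k] Z) (B' : X' →ₗ[k] Y' →ₗ[k] Z') (p : X →ₗ[k] X') (q : Y →ₗ[k] Y')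
    (a : Z →ₗ[k] T) (b : Z' →ₗ[k] T) (h : ∀ x y, a (B x y) = b (B' (p x) (q y)))
    (x : divPow k d X) (y : divPow k d Y) :
    divPowMap d a (divPowMap₂ d B x y) =
      divPowMap d b (divPowMap₂ d B' (divPowMap d p x) (divPowMap d q y)) := by
  refine Subtype.ext ?_
  simp only [divPowMap_coe, divPowMap₂_coe]
  rw [map_map₂ B (B'.compr₂ b) p q a h, map_map₂ B' (B'.compr₂ b) LinearMap.id LinearMap.id b
    (fun _ _ => rfl), map_eq_self _ (fun _ => rfl), map_eq_self _ (fun _ => rfl)]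

/-- The map `block` embeds `D^{ds}` in `D^d(D^s)` compatibly with bilinear maps, so an identity
known for elements of `D^s` extends to `D^{ds}`. -/
theorem divPowMap_block_map₂ {X Y Z X' Y' Z' Z'' T : Type u} [AddCommGroup X] [Module k X]
    [AddCommGroup Y] [Module k Y] [AddCommGroup Z] [Module k Z] [AddCommGroup X'] [Module k X']
    [AddCommGroup Y'] [Module k Y'] [AddCommGroup Z'] [Module k Z'] [AddCommGroup Z'']
    [Module k Z''] [AddCommGroup T] [Module k T]
    (B : X →ₗ[k] Y →ₗ[k] Z) (B' : X' →ₗ[k] Y' →ₗ[k] Z') (p : divPow k s X →ₗ[k] X')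
    (q : divPow k s Y →ₗ[k] Y') (r : divPow k s Z →ₗ[k] Z'') (a : Z'' →ₗ[k] T) (b : Z' →ₗ[k] T)
    (h : ∀ x y, a (r (divPowMap₂ s B x y)) = b (B' (p x) (q y)))
    (x : divPow k (d * s) X) (y : divPow k (d * s) Y) :
    divPowMap d a (divPowMap d r (block d s Z (divPowMap₂ (d * s) B x y))) =
      divPowMap d b (divPowMap₂ d B' (divPowMap d p (block d s X x))
        (divPowMap d q (block d s Y y))) := by
  rw [block_map₂, divPowMap_divPowMap]
  exact divPowMap_map₂ _ _ _ _ _ _ h _ _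

/-- The isomorphism `φ` is natural for `D^s` by definition; its naturality for `D^{ds}` follows
through `divPowMap_block_map₂`. -/
theorem inflate_tensorHom {A : PolyFunctor.{u} k s} (φ : TensorIso A)
    {V V' W W' : DivCat.{u} k (d * s)} (f : V ⟶ V') (g : W ⟶ W') :
    (inflate d A).map (tensorHom f g) ≫ diagHom (W := tensorObj ((inflate d A).obj V')
        ((inflate d A).obj W')) (φ.iso ⟨V'.space⟩ ⟨W'.space⟩).toLinearMap =
      diagHom (V := (inflate d A).obj (tensorObj V W)) (φ.iso ⟨V.space⟩ ⟨W.space⟩).toLinearMap ≫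
        tensorHom ((inflate d A).map f) ((inflate d A).map g) := by
  refine (comp_diagHom _ _).trans (Eq.trans ?_ (diagHom_comp _ _).symm)
  refine divPowMap_block_map₂ (Z := (tensorObj V W).space →ₗ[k] (tensorObj V' W').space)
    (TensorProduct.mapBilinear (RingHom.id k) V.space W.space V'.space W'.space)
    (TensorProduct.mapBilinear (RingHom.id k) (A.obj.obj ⟨V.space⟩) (A.obj.obj ⟨W.space⟩)
      (A.obj.obj ⟨V'.space⟩) (A.obj.obj ⟨W'.space⟩))
    (structureMap A V.space V'.space) (structureMap A W.space W'.space)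
    (structureMap A (tensorObj V W).space (tensorObj V' W').space)
    _ _ (fun x y => ?_) f g
  exact LinearMap.ext fun v => φ.naturality (V := ⟨V.space⟩) (V' := ⟨V'.space⟩)
      (W := ⟨W.space⟩) (W' := ⟨W'.space⟩) x y v

/-- The multiplicativity of `A` gives an isomorphism of functors on `Γ^{ds} 𝒱`. -/
def tensorInflateIso (d : ℕ) {A : PolyFunctor.{u} k s} (φ : TensorIso A) (U : FGModuleCat.{u} k) :
    tensorLeft (d * s) U ⋙ inflate d A ≅ inflate d A ⋙ tensorLeft d (A.obj.obj ⟨U⟩) :=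
  NatIso.ofComponents (fun V => diagIso (V := (inflate d A).obj (tensorObj ⟨U⟩ V))
      (W := tensorObj ((inflate d A).obj ⟨U⟩) ((inflate d A).obj V))
      (φ.iso ⟨U⟩ ⟨V.space⟩)) fun f =>
    (inflate_tensorHom φ (𝟙 (⟨U⟩ : DivCat.{u} k (d * s))) f).trans
      (congrArg (fun x => diagHom _ ≫ tensorHom x ((inflate d A).map f))
        ((inflate d A).map_id _))

/-- Precomposition with `A` is compatible with the decompositions given by idempotents. -/
def precompAPartIso (d : ℕ) {A : PolyFunctor.{u} k s} (φ : TensorIso A)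
    {U : DivCat.{u} k (d * s)} (e : U ⟶ U) (he : e ≫ e = e)
    (he' : (inflate d A).map e ≫ (inflate d A).map e = (inflate d A).map e) :
    precompA d A ⋙ part e ≅ part ((inflate d A).map e) ⋙ precompA d A :=
  -- The two sides are retracts of `F(A(U ⊗ -))` and of `F(A(U) ⊗ A(-))`. The isomorphism between
  -- these respects the idempotents by naturality of `φ` in the first tensor factor.
  ((partRetract e he).map ((Functor.whiskeringLeft _ _ _).obj (precompA d A))).isoOfIso
    ((partRetract _ he').map ((Functor.whiskeringRight _ _ _).obj (precompA d A)))
    (precompIso (tensorInflateIso d φ U.space)) (by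
      refine polyNatTrans_ext fun F V => ?_
      refine (F.obj.map_comp _ _).symm.trans (Eq.trans ?_ (F.obj.map_comp _ _))
      refine congrArg F.obj.map ((inflate_tensorHom φ e (𝟙 V)).trans ?_)
      exact congrArg (fun x => diagHom _ ≫ tensorHom ((inflate d A).map e) x)
        ((inflate d A).map_id V))

/-- The functor `rightAdj d A` is compatible with the decompositions given by idempotents. -/
def partRightAdjIso (d : ℕ) {A : PolyFunctor.{u} k s} (φ : TensorIso A)
    {U : DivCat.{u} k (d * s)} (e : U ⟶ U) (he : e ≫ e = e) :
    part (transposeDiv e) ⋙ rightAdj d A ≅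
      rightAdj d A ⋙ part (transposeDiv ((inflate d A).map e)) :=
  have he' : (inflate d A).map e ≫ (inflate d A).map e = (inflate d A).map e := by
    rw [← (inflate d A).map_comp, he]
  -- Passing to right adjoints reverses the composites and transposes the idempotents.
  conjugateIsoEquiv ((rightAdjAdj d A).comp (partAdj e he))
    ((partAdj _ he').comp (rightAdjAdj d A)) (precompAPartIso d φ e he he').symm

end Exponential

/-! ### Homogeneous projections for dual graded spaces and for `A(U)`. -/

section Weights

variable {k : Type u} [Field k] {d s : ℕ}

theorem GradedSpace.weight_coe (U : GradedSpace.{u} k) (j : ℤ) :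
    (U.weight d j : divPow k d (U.space →ₗ[k] U.space)).1 =
      ∑ f ∈ (Fintype.piFinset fun _ : Fin d => U.supp).filter fun f => ∑ r, f r = j,
        PiTensorProduct.tprod k fun r => U.proj (f r) := rfl

/-- Transposing the tensor of the projections of `U` in degrees `f r` gives that of the projections
of `U^*` in degrees `- f r`. Consequently `component d U j` is cut out by a transpose, as a right
adjoint in `partAdj` has to be. -/
theorem GradedSpace.dual_weight (U : GradedSpace.{u} k) (j : ℤ) :
    U.dual.weight d j = transposeDiv (U.weight d (-j)) := by
  refine Subtype.ext ?_
  refine (U.dual.weight_coe j).trans (Eq.trans ?_ (congrArg (PiTensorProduct.map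
    fun _ => Module.Dual.transpose (R := k) (M := U.space) (M' := U.space))
    (U.weight_coe (-j)).symm))
  rw [map_sum]
  refine Finset.sum_bij' (fun f _ r => - f r) (fun f _ r => - f r) ?_ ?_ ?_ ?_ ?_
  · intro f hf
    simp only [Finset.mem_filter, Fintype.mem_piFinset, GradedSpace.dual, Finset.mem_image] at hf ⊢
    refine ⟨fun r => ?_, by rw [Finset.sum_neg_distrib, hf.2]⟩
    obtain ⟨i, hi, h⟩ := hf.1 r
    rwa [← h, neg_neg]
  · intro f hf
    simp only [Finset.mem_filter, Fintype.mem_piFinset, GradedSpace.dual, Finset.mem_image] at hf ⊢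
    exact ⟨fun r => ⟨_, hf.1 r, rfl⟩, by rw [Finset.sum_neg_distrib, hf.2, neg_neg]⟩
  · intro f _
    simp
  · intro f _
    simp
  · intro f _
    rw [PiTensorProduct.map_tprod]
    rfl

/-- A sum of `ds` degrees is a sum of `d` block sums of length `s`. The equality is exact because
the support of `A(U)` is taken to be all degrees of `U^{⊗ s}`, including those in which `A(U)`
vanishes. -/
theorem GradedSpace.degs_eval (A : PolyFunctor.{u} k s) (U : GradedSpace.{u} k) :
    (U.eval A).degs d = U.degs (d * s) := by
  ext j
  simp only [GradedSpace.degs, GradedSpace.eval, Finset.mem_image, Fintype.mem_piFinset]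
  constructor
  · rintro ⟨f, hf, rfl⟩
    choose g hg hg' using hf
    refine ⟨fun r => g (finProdFinEquiv.symm r).1 (finProdFinEquiv.symm r).2, fun r => hg _ _, ?_⟩
    rw [← finProdFinEquiv.sum_comp, Fintype.sum_prod_type]
    simp [hg']
  · rintro ⟨g, hg, rfl⟩
    refine ⟨fun i => ∑ r, g (finProdFinEquiv (i, r)), fun i => ⟨_, fun r => hg _, rfl⟩, ?_⟩
    rw [← finProdFinEquiv.sum_comp, Fintype.sum_prod_type]

theorem GradedSpace.degs_dual (U : GradedSpace.{u} k) :
    U.dual.degs d = (U.degs d).image Neg.neg := by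
  ext j
  simp only [GradedSpace.degs, GradedSpace.dual, Finset.mem_image, Fintype.mem_piFinset]
  constructor
  · rintro ⟨f, hf, rfl⟩
    refine ⟨- ∑ r, f r, ⟨fun r => - f r, fun r => ?_, by simp⟩, by simp⟩
    obtain ⟨i, hi, h⟩ := hf r
    simpa [← h] using hi
  · rintro ⟨_, ⟨f, hf, rfl⟩, rfl⟩
    exact ⟨fun r => - f r, fun r => ⟨_, hf r, rfl⟩, by simp⟩

/-- The decomposition of a tensor power of `A(U)` is induced by the decomposition of a tensor power
of `U`. -/
theorem GradedSpace.eval_weight (A : PolyFunctor.{u} k s) (U : GradedSpace.{u} k) (j : ℤ) :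
    (U.eval A).weight d j = (inflate d A).map (U.weight (d * s) j) := by
  refine Subtype.ext ?_
  refine ((U.eval A).weight_coe j).trans ?_
  change _ = PiTensorProduct.map (fun _ => structureMap A U.space U.space)
    (block d s (U.space →ₗ[k] U.space) (U.weight (d * s) j)).1
  -- A projection onto total degree `j` splits according to the degrees `g i` of the `d` blocks.
  -- Since `mapIncl_injective` holds, this may be checked after `D^s` is included in the full tensor
  -- power.
  have h : (block d s (U.space →ₗ[k] U.space) (U.weight (d * s) j)).1 =
      ∑ g ∈ (Fintype.piFinset fun _ : Fin d => U.degs s).filter fun g => ∑ i, g i = j,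
        PiTensorProduct.tprod k fun i =>
          (U.weight s (g i) : divPow k s (U.space →ₗ[k] U.space)) := by
    refine mapIncl_injective ((coe_block _).trans ?_)
    rw [U.weight_coe, map_sum, map_sum]
    simp only [flatten_tprod, PiTensorProduct.map_tprod, Submodule.subtype_apply, U.weight_coe,
      MultilinearMap.map_sum_finset]
    -- A choice of `ds` degrees is the same as `d` block sums with a choice of `s` degrees in each
    -- block having that sum.
    rw [Finset.sum_sigma']
    refine Finset.sum_bij' (fun f _ => ⟨fun i => ∑ r, f (finProdFinEquiv (i, r)),
      fun i r => f (finProdFinEquiv (i, r))⟩)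
      (fun g _ r => g.2 (finProdFinEquiv.symm r).1 (finProdFinEquiv.symm r).2) ?_ ?_ ?_ ?_ ?_
    · intro f hf
      simp only [Finset.mem_filter, Fintype.mem_piFinset, Finset.mem_sigma, GradedSpace.degs,
        Finset.mem_image] at hf ⊢
      refine ⟨⟨fun i => ⟨_, fun r => hf.1 _, rfl⟩, ?_⟩, fun i => ⟨fun r => hf.1 _, trivial⟩⟩
      rw [← hf.2, ← finProdFinEquiv.sum_comp, Fintype.sum_prod_type]
    · rintro ⟨g, h⟩ hg
      simp only [Finset.mem_filter, Fintype.mem_piFinset, Finset.mem_sigma] at hg ⊢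
      refine ⟨fun r => (hg.2 _).1 _, ?_⟩
      rw [← finProdFinEquiv.sum_comp, Fintype.sum_prod_type, ← hg.1.2]
      simp [(hg.2 _).2]
    · intro f hf
      exact funext fun r => congrArg f (finProdFinEquiv.apply_symm_apply r)
    · rintro ⟨g, h⟩ hg
      simp only [Finset.mem_filter, Fintype.mem_piFinset, Finset.mem_sigma] at hg
      obtain rfl : g = fun i => ∑ r, h i r := funext fun i => ((hg.2 i).2).symm
      simp
    · intro f hf
      rfl
  rw [h, map_sum]
  simp only [PiTensorProduct.map_tprod]
  rfl

end Weights

end StrictPoly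

namespace StrictPoly

open Limits

/-! ### The isomorphism for the right adjoint. -/

section RightAdjoint

variable {k : Type u} [Field k] {d s : ℕ}

theorem weight_idem (U : GradedSpace.{u} k) (j : ℤ) :
    U.weight d j ≫ U.weight d j = U.weight d j := by
  rw [weight_comp, if_pos rfl]

/-- The component functors are right adjoints of exact functors. -/
def componentAdj (U : GradedSpace.{u} k) (j : ℤ) :
    part (U.weight d (-j)) ⊣ component d U j :=
  (partAdj _ (weight_idem U (-j))).ofNatIsoRight
    (eqToIso (congrArg part (U.dual_weight j).symm))

/-- The left adjoint of the component is cut out by an idempotent, hence exact, so it preserves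
monomorphisms. This is what allows the component to be applied to an injective resolution. -/
instance (U : GradedSpace.{u} k) (j : ℤ) : (component d U j).PreservesInjectiveObjects := by
  have h : PreservesFiniteLimits (part (U.weight d (-j))) :=
    (((part (U.weight d (-j))).exact_tfae.out 1 3 rfl rfl).1 (part_exact _ (weight_idem U _))).1
  exact Functor.preservesInjectiveObjects_of_adjunction_of_preservesMonomorphisms (componentAdj U j)

/-- The functor `rightAdj d A` is compatible with the gradings. -/
def componentRightAdjIso (d : ℕ) {A : PolyFunctor.{u} k s} (φ : TensorIso A)
    (U : GradedSpace.{u} k) (j : ℤ) :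
    component (d * s) U j ⋙ rightAdj d A ≅ rightAdj d A ⋙ component d (U.eval A) j :=
  Functor.isoWhiskerRight (eqToIso (congrArg part (U.dual_weight j))) _ ≪≫
    partRightAdjIso d φ (U.weight (d * s) (-j)) (weight_idem U _) ≪≫
    Functor.isoWhiskerLeft _ (eqToIso (congrArg part
      (((U.eval A).dual_weight j).trans (congrArg transposeDiv (U.eval_weight A (-j)))).symm))

theorem degs_dual_eval (A : PolyFunctor.{u} k s) (U : GradedSpace.{u} k) :
    (U.eval A).dual.degs d = U.dual.degs (d * s) := by
  rw [GradedSpace.degs_dual, GradedSpace.degs_dual, GradedSpace.degs_eval]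

/-- The decomposition of `X_U` into shifted components. -/
def twistDecomp (d : ℕ) (U : GradedSpace.{u} k) :
    FunctorDecomp (twist d U) fun j : U.dual.degs d =>
      (component d U j.1).mapDerivedCategory ⋙ shiftFunctor _ (-j.1) where
  ι j :=
    { app := fun X => biproduct.ι (fun j : U.dual.degs d => (shiftFunctor _ (-j.1)).obj
        ((component d U j.1).mapDerivedCategory.obj X)) j
      naturality := fun _ _ f => (biproduct.ι_map (fun j : U.dual.degs d =>
        (shiftFunctor _ (-j.1)).map ((component d U j.1).mapDerivedCategory.map f)) j).symm }
  π j :=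
    { app := fun X => biproduct.π (fun j : U.dual.degs d => (shiftFunctor _ (-j.1)).obj
        ((component d U j.1).mapDerivedCategory.obj X)) j
      naturality := fun _ _ f => biproduct.map_π (fun j : U.dual.degs d =>
        (shiftFunctor _ (-j.1)).map ((component d U j.1).mapDerivedCategory.map f)) j }
  ι_π j _ := biproduct.ι_π_self _ j
  ι_π_ne _ _ h _ := biproduct.ι_π_ne _ h
  sum _ := biproduct.total

/-- The inclusion of the bounded derived category in the bounded below one. -/
def boundedToPlus (k : Type u) [Field k] (d : ℕ) :
    DerivedCategory.Bounded (PolyFunctor.{u} k d) ⥤ DerivedCategory.Plus (PolyFunctor.{u} k d) :=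
  ObjectProperty.ιOfLE (fun _ h => h.1)

/-- The decomposition of `X_U` into shifted components, in the bounded below derived category. -/
def twistBoundedDecomp (d : ℕ) (U : GradedSpace.{u} k) :
    FunctorDecomp (twistBounded d U ⋙ boundedToPlus k d) fun j : U.dual.degs d =>
      boundedToPlus k d ⋙ mapDerivedPlus (component d U j.1) ⋙ shiftFunctor _ (-j.1) :=
  FunctorDecomp.ofFullyFaithful DerivedCategory.Plus.ι
    (((twistDecomp d U).precomp DerivedCategory.Bounded.ι).congrIso fun j =>
      Functor.isoWhiskerLeft (boundedToPlus k d ⋙ mapDerivedPlus (component d U j.1))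
        (DerivedCategory.Plus.ι.commShiftIso (-j.1)).symm)

/-- This is the isomorphism on a single summand: `e₂` carries the shift through the derived functor,
`e₁` carries the component through it, and the inclusion of the bounded below derived category
commutes with the shift. -/
theorem nonempty_component_rightDerived_iso (d : ℕ) {A : PolyFunctor.{u} k s} (φ : TensorIso A)
    (U : GradedSpace.{u} k) (j : ℤ) :
    Nonempty ((boundedToPlus k (d * s) ⋙ mapDerivedPlus (component (d * s) U j) ⋙
        shiftFunctor _ (-j)) ⋙ (rightAdj d A).rightDerivedFunctorPlus ⋙ DerivedCategory.Plus.ι ≅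
      rightK d A ⋙ (component d (U.eval A) j).mapDerivedCategory ⋙ shiftFunctor _ (-j)) := by
  obtain ⟨e₁⟩ := nonempty_rightDerived_iso (rightAdj d A) (rightAdj d A) _ _
    (componentRightAdjIso d φ U j)
  obtain ⟨e₂⟩ := nonempty_rightDerived_shift (rightAdj d A) (-j)
  let B := boundedToPlus k (d * s)
  let T := mapDerivedPlus (component (d * s) U j)
  let T' := mapDerivedPlus (component d (U.eval A) j)
  exact ⟨Functor.isoWhiskerLeft (B ⋙ T) (Functor.isoWhiskerRight e₂ DerivedCategory.Plus.ι) ≪≫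
    Functor.isoWhiskerLeft B (Functor.isoWhiskerRight e₁
      (shiftFunctor _ (-j) ⋙ DerivedCategory.Plus.ι)) ≪≫
    Functor.isoWhiskerLeft (B ⋙ (rightAdj d A).rightDerivedFunctorPlus ⋙ T')
      (DerivedCategory.Plus.ι.commShiftIso (-j))⟩

/-- `𝐊^r_A(F_U) ≃ 𝐊^r_A(F)_{A(U)}`. -/
theorem nonempty_rightK_twist_iso (d : ℕ) {A : PolyFunctor.{u} k s} (φ : TensorIso A)
    (U : GradedSpace.{u} k) :
    Nonempty (twistBounded (d * s) U ⋙ rightK d A ≅ rightK d A ⋙ twist d (U.eval A)) :=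
  ⟨((twistBoundedDecomp (d * s) U).postcomp ((rightAdj d A).rightDerivedFunctorPlus ⋙
      DerivedCategory.Plus.ι)).iso ((twistDecomp d (U.eval A)).precomp (rightK d A))
    -- The summands on the two sides are indexed by the same integers.
    (Equiv.subtypeEquivRight fun j => by rw [degs_dual_eval])
    fun j => (nonempty_component_rightDerived_iso d φ U j.1).some⟩

end RightAdjoint

end StrictPoly

namespace StrictPoly

open Limits Opposite

/-! ### Kuhn duality on the derived category: exact functors and shifts. -/

section KuhnDerived

variable {k : Type u} [Field k] {d s : ℕ}

/-- Functors on the opposite derived category are isomorphic if they are isomorphic on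
complexes. -/
def isoOfQ {E : Type*} [Category* E] {G G' : (DerivedCategory (PolyFunctor.{u} k d))ᵒᵖ ⥤ E}
    (e : DerivedCategory.Q.op ⋙ G ≅ DerivedCategory.Q.op ⋙ G') : G ≅ G' :=
  letI : Localization.Lifting (DerivedCategory.Q (C := PolyFunctor.{u} k d)).op
    (HomologicalComplex.quasiIso (PolyFunctor.{u} k d) (ComplexShape.up ℤ)).op
    (DerivedCategory.Q.op ⋙ G) G := ⟨Iso.refl _⟩
  letI : Localization.Lifting (DerivedCategory.Q (C := PolyFunctor.{u} k d)).op
    (HomologicalComplex.quasiIso (PolyFunctor.{u} k d) (ComplexShape.up ℤ)).op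
    (DerivedCategory.Q.op ⋙ G') G' := ⟨Iso.refl _⟩
  Localization.liftNatIso (DerivedCategory.Q (C := PolyFunctor.{u} k d)).op
    (HomologicalComplex.quasiIso (PolyFunctor.{u} k d) (ComplexShape.up ℤ)).op
    (DerivedCategory.Q.op ⋙ G) (DerivedCategory.Q.op ⋙ G') G G' e

instance : (kuhnComplex.{u} k d).Additive where
  map_add {K L f g} := by
    ext n : 1
    exact (kuhn k d).map_add (f := (f.unop.f (-n)).op) (g := (g.unop.f (-n)).op)

/-- Additivity is tested first on the homotopy category, of which the derived category is a
localization, and then on complexes, where the duality is termwise. -/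
instance : (kuhnDerived.{u} k d).Additive := by
  rw [Localization.functor_additive_iff (DerivedCategory.Qh (C := PolyFunctor.{u} k d)).op
    (HomotopyCategory.quasiIso (PolyFunctor.{u} k d) (ComplexShape.up ℤ)).op]
  have : ((HomotopyCategory.quotient (PolyFunctor.{u} k d) (ComplexShape.up ℤ)).op ⋙
      DerivedCategory.Qh.op ⋙ kuhnDerived.{u} k d).Additive :=
    Functor.additive_of_iso (F := kuhnComplex.{u} k d ⋙ DerivedCategory.Q)
      ((kuhnDerivedFactors k d).symm ≪≫ Functor.isoWhiskerRight
        (NatIso.op (DerivedCategory.quotientCompQhIso (PolyFunctor.{u} k d)))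
          (kuhnDerived.{u} k d))
  exact Functor.additive_of_full_essSurj_comp
    (HomotopyCategory.quotient (PolyFunctor.{u} k d) (ComplexShape.up ℤ)).op _

/-- Kuhn duality on complexes is compatible with termwise applied functors. -/
def kuhnComplexMapIso {T T' : PolyFunctor.{u} k d ⥤ PolyFunctor.{u} k d} [T.Additive]
    [T'.Additive] (e : T.op ⋙ kuhn k d ≅ kuhn k d ⋙ T') :
    (T.mapHomologicalComplex (ComplexShape.up ℤ)).op ⋙ kuhnComplex k d ≅
      kuhnComplex k d ⋙ T'.mapHomologicalComplex (ComplexShape.up ℤ) :=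
  NatIso.ofComponents (fun K => HomologicalComplex.Hom.isoOfComponents
      (fun n => e.app (op (K.unop.X (-n))))
      (fun i j _ => (e.hom.naturality (K.unop.d (-j) (-i)).op).symm))
    (fun f => by
      ext n : 1
      exact e.hom.naturality (f.unop.f (-n)).op)

/-- Kuhn duality on the derived category is compatible with exact functors. -/
def kuhnDerivedMapIso {T T' : PolyFunctor.{u} k d ⥤ PolyFunctor.{u} k d} [T.Additive]
    [PreservesFiniteLimits T] [PreservesFiniteColimits T] [T'.Additive]
    [PreservesFiniteLimits T'] [PreservesFiniteColimits T']
    (e : T.op ⋙ kuhn k d ≅ kuhn k d ⋙ T') :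
    T.mapDerivedCategory.op ⋙ kuhnDerived k d ≅ kuhnDerived k d ⋙ T'.mapDerivedCategory :=
  isoOfQ (Functor.isoWhiskerRight (NatIso.op T.mapDerivedCategoryFactors).symm
      (kuhnDerived k d) ≪≫
    Functor.isoWhiskerLeft (T.mapHomologicalComplex (ComplexShape.up ℤ)).op
      (kuhnDerivedFactors k d) ≪≫
    Functor.isoWhiskerRight (kuhnComplexMapIso e) DerivedCategory.Q ≪≫
    Functor.isoWhiskerLeft (kuhnComplex k d) T'.mapDerivedCategoryFactors.symm ≪≫
    Functor.isoWhiskerRight (kuhnDerivedFactors k d).symm T'.mapDerivedCategory)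

/-- Kuhn duality on complexes exchanges the shifts by `n` and `-n`. -/
def kuhnComplexShiftIso (n : ℤ) :
    (shiftFunctor (CochainComplex (PolyFunctor.{u} k d) ℤ) n).op ⋙ kuhnComplex k d ≅
      kuhnComplex k d ⋙ shiftFunctor _ (-n) :=
  NatIso.ofComponents (fun K => HomologicalComplex.Hom.isoOfComponents
      -- In degree `i` both complexes have the dual of the term of degree `n - i`, written in two
      -- ways.
      (fun i => (kuhn k d).mapIso (K.unop.XIsoOfEq (show -(i + -n) = -i + n by ring)).op)
      (fun i j _ => by
        change (kuhn k d).map (K.unop.XIsoOfEq _).hom.op ≫ ((-n).negOnePow •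
            (kuhn k d).map (K.unop.d (-(j + -n)) (-(i + -n))).op) =
          (kuhn k d).map (n.negOnePow • K.unop.d (-j + n) (-i + n)).op ≫
            (kuhn k d).map (K.unop.XIsoOfEq _).hom.op
        -- The differentials carry the signs of the shifts by `n` and `-n`, which are equal, so no
        -- sign is needed in the isomorphism.
        rw [Int.negOnePow_neg]
        have h : (kuhn k d).map (K.unop.XIsoOfEq (show -(i + -n) = -i + n by ring)).hom.op ≫
            (kuhn k d).map (K.unop.d (-(j + -n)) (-(i + -n))).op =
          (kuhn k d).map (K.unop.d (-j + n) (-i + n)).op ≫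
            (kuhn k d).map (K.unop.XIsoOfEq (show -(j + -n) = -j + n by ring)).hom.op := by
          rw [← (kuhn k d).map_comp, ← (kuhn k d).map_comp, ← op_comp, ← op_comp]
          simp
        obtain hn | hn := Int.units_eq_one_or n.negOnePow
        · rw [hn, one_smul, one_smul]
          exact h
        · rw [hn, Units.neg_smul, one_smul, Units.neg_smul, one_smul, op_neg,
            CategoryTheory.Functor.map_neg, Preadditive.comp_neg, Preadditive.neg_comp]
          exact congrArg Neg.neg h))
    (fun {K L} f => by
      ext i : 1
      change (kuhn k d).map (f.unop.f (-i + n)).op ≫ (kuhn k d).map (L.unop.XIsoOfEq _).hom.op =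
        (kuhn k d).map (K.unop.XIsoOfEq _).hom.op ≫ (kuhn k d).map (f.unop.f (-(i + -n))).op
      rw [← (kuhn k d).map_comp, ← (kuhn k d).map_comp, ← op_comp, ← op_comp,
        HomologicalComplex.XIsoOfEq_hom_naturality])

/-- Kuhn duality on the derived category exchanges the shifts by `n` and `-n`. -/
def kuhnDerivedShiftIso (n : ℤ) :
    (shiftFunctor (DerivedCategory (PolyFunctor.{u} k d)) n).op ⋙ kuhnDerived k d ≅
      kuhnDerived k d ⋙ shiftFunctor _ (-n) :=
  isoOfQ (Functor.isoWhiskerRight (NatIso.op (DerivedCategory.Q.commShiftIso n))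
      (kuhnDerived k d) ≪≫
    Functor.isoWhiskerLeft (shiftFunctor (CochainComplex (PolyFunctor.{u} k d) ℤ) n).op
      (kuhnDerivedFactors k d) ≪≫
    Functor.isoWhiskerRight (kuhnComplexShiftIso n) DerivedCategory.Q ≪≫
    Functor.isoWhiskerLeft (kuhnComplex k d) (DerivedCategory.Q.commShiftIso (-n)) ≪≫
    Functor.isoWhiskerRight (kuhnDerivedFactors k d).symm (shiftFunctor _ (-n)))

end KuhnDerived

end StrictPoly

namespace StrictPoly

open Limits Opposite

/-! ### Kuhn duality and the pieces cut out by idempotents. -/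

section KuhnPart

variable {k : Type u} [Field k] {d s : ℕ}

/-- The isomorphism `U ⊗ V^* ≃ (U' ⊗ V)^*` given by an isomorphism `U' ≃ U^*`. -/
def dualTensorEquiv {U U' : Type u} (V : Type u) [AddCommGroup U] [Module k U] [Module.Finite k U]
    [AddCommGroup U'] [Module k U'] [Module.Finite k U'] [AddCommGroup V] [Module k V]
    [Module.Finite k V] (θ : U' ≃ₗ[k] Module.Dual k U) :
    U ⊗[k] Module.Dual k V ≃ₗ[k] Module.Dual k (U' ⊗[k] V) :=
  TensorProduct.congr (Module.evalEquiv k U ≪≫ₗ θ.dualMap) (LinearEquiv.refl k _) ≪≫ₗ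
    TensorProduct.dualDistribEquiv k U' V

theorem dualTensorEquiv_apply {U U' : Type u} (V : Type u) [AddCommGroup U] [Module k U]
    [Module.Finite k U] [AddCommGroup U'] [Module k U'] [Module.Finite k U'] [AddCommGroup V]
    [Module k V] [Module.Finite k V] (θ : U' ≃ₗ[k] Module.Dual k U) (x : U) (φ : Module.Dual k V)
    (y : U') (v : V) : dualTensorEquiv V θ (x ⊗ₜ φ) (y ⊗ₜ v) = θ y x * φ v := by
  simp [dualTensorEquiv, TensorProduct.dualDistribEquiv]

/-- The transpose of an endomorphism of `U`, as an endomorphism of `U' ≃ U^*`. -/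
def conjTranspose {U U' : Type u} [AddCommGroup U] [Module k U] [AddCommGroup U'] [Module k U']
    (θ : U' ≃ₗ[k] Module.Dual k U) : (U →ₗ[k] U) →ₗ[k] (U' →ₗ[k] U') :=
  (θ.symm.arrowCongr θ.symm).toLinearMap ∘ₗ Module.Dual.transpose (R := k)

theorem conjTranspose_apply {U U' : Type u} [AddCommGroup U] [Module k U] [AddCommGroup U']
    [Module k U'] (θ : U' ≃ₗ[k] Module.Dual k U) (f : U →ₗ[k] U) (y : U') (x : U) :
    θ (conjTranspose θ f y) x = θ y (f x) := by
  simp [conjTranspose, Module.Dual.transpose_apply]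

/-- The isomorphism `U ⊗ V^* ≃ (U' ⊗ V)^*` of `Γ^d 𝒱` given by an isomorphism `U' ≃ U^*`. -/
def dualTensorIso {U U' : DivCat.{u} k d} (θ : U'.space ≃ₗ[k] Module.Dual k U.space)
    (V : DivCat.{u} k d) : tensorObj U (dualDiv V) ≅ dualDiv (tensorObj U' V) :=
  diagIso (V := tensorObj U (dualDiv V)) (W := dualDiv (tensorObj U' V))
    (dualTensorEquiv V.space θ)

theorem dualTensorEquiv_lTensor {U U' V W : Type u} [AddCommGroup U] [Module k U]
    [Module.Finite k U] [AddCommGroup U'] [Module k U'] [Module.Finite k U'] [AddCommGroup V]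
    [Module k V] [Module.Finite k V] [AddCommGroup W] [Module k W] [Module.Finite k W]
    (θ : U' ≃ₗ[k] Module.Dual k U) (f : V →ₗ[k] W) (z : U ⊗[k] Module.Dual k W) :
    dualTensorEquiv V θ (f.dualMap.lTensor U z) =
      (f.lTensor U').dualMap (dualTensorEquiv W θ z) := by
  induction z with
  | zero => simp
  | add x y hx hy => simp only [map_add, hx, hy]
  | tmul x φ =>
    refine TensorProduct.ext' fun y v => ?_
    simp [dualTensorEquiv_apply]

/-- For the pairing of `U'` with `U` defined by `θ`, the adjoint of `f` is `conjTranspose θ f`; it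
suffices to evaluate on pure tensors. -/
theorem dualTensorEquiv_rTensor {U U' V : Type u} [AddCommGroup U] [Module k U]
    [Module.Finite k U] [AddCommGroup U'] [Module k U'] [Module.Finite k U'] [AddCommGroup V]
    [Module k V] [Module.Finite k V] (θ : U' ≃ₗ[k] Module.Dual k U) (f : U →ₗ[k] U)
    (z : U ⊗[k] Module.Dual k V) :
    dualTensorEquiv V θ (f.rTensor _ z) =
      ((conjTranspose θ f).rTensor V).dualMap (dualTensorEquiv V θ z) := by
  induction z with
  | zero => simp
  | add x y hx hy => simp only [map_add, hx, hy]
  | tmul x φ =>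
    refine TensorProduct.ext' fun y v => ?_
    simp [dualTensorEquiv_apply, conjTranspose_apply]

theorem dualTensorIso_naturality {U U' : DivCat.{u} k d}
    (θ : U'.space ≃ₗ[k] Module.Dual k U.space) {V W : DivCat.{u} k d} (f : V ⟶ W) :
    tensorHom (𝟙 U) (transposeDiv f) ≫ (dualTensorIso θ V).hom =
      (dualTensorIso θ W).hom ≫ transposeDiv (tensorHom (𝟙 U') f) := by
  have h₁ : tensorHom (𝟙 U) (transposeDiv f) = divPowMap d (LinearMap.lTensorHom U.space ∘ₗ
      Module.Dual.transpose (R := k) (M := V.space) (M' := W.space)) f :=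
    tensorHom_id_left_eq U (V := dualDiv W) (W := dualDiv V)
      (Module.Dual.transpose (R := k) (M := V.space) (M' := W.space)) f rfl
  have h₂ : transposeDiv (tensorHom (𝟙 U') f) = divPowMap d (Module.Dual.transpose (R := k)
      (M := U'.space ⊗[k] V.space) (M' := U'.space ⊗[k] W.space) ∘ₗ
        LinearMap.lTensorHom U'.space) f :=
    (congrArg transposeDiv (tensorHom_id_left U' f)).trans (divPowMap_divPowMap _ _ _)
  exact diagHom_naturality (V := tensorObj U (dualDiv W)) (W := tensorObj U (dualDiv V))
    (V' := dualDiv (tensorObj U' W)) (W' := dualDiv (tensorObj U' V))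
    (dualTensorEquiv W.space θ).toLinearMap (dualTensorEquiv V.space θ).toLinearMap
    (LinearMap.lTensorHom U.space ∘ₗ
      Module.Dual.transpose (R := k) (M := V.space) (M' := W.space))
    (Module.Dual.transpose (R := k)
      (M := U'.space ⊗[k] V.space) (M' := U'.space ⊗[k] W.space) ∘ₗ
        LinearMap.lTensorHom U'.space)
    (fun f z => dualTensorEquiv_lTensor θ f z) f h₁ h₂

/-- This identifies the idempotents on the two sides of `kuhnPrecompIso`. A general `θ` is allowed
since the spaces to be compared later are dual only up to isomorphism. -/
theorem dualTensorIso_conjTranspose {U U' : DivCat.{u} k d}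
    (θ : U'.space ≃ₗ[k] Module.Dual k U.space) (e : U ⟶ U) {e' : U' ⟶ U'}
    (he : e' = divPowMap d (conjTranspose θ) e) (V : DivCat.{u} k d) :
    tensorHom e (𝟙 (dualDiv V)) ≫ (dualTensorIso θ V).hom =
      (dualTensorIso θ V).hom ≫ transposeDiv (tensorHom e' (𝟙 V)) :=
  diagHom_naturality (V := tensorObj U (dualDiv V)) (W := tensorObj U (dualDiv V))
    (V' := dualDiv (tensorObj U' V)) (W' := dualDiv (tensorObj U' V))
    (dualTensorEquiv V.space θ).toLinearMap (dualTensorEquiv V.space θ).toLinearMap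
    (LinearMap.rTensorHom (Module.Dual k V.space))
    (Module.Dual.transpose (R := k) ∘ₗ LinearMap.rTensorHom V.space ∘ₗ conjTranspose θ)
    (fun f z => dualTensorEquiv_rTensor θ f z) e (tensorHom_id_right _ _)
    ((congrArg transposeDiv (tensorHom_id_right_eq V _ e he)).trans (divPowMap_divPowMap _ _ _))

/-- Kuhn duality exchanges `F(U ⊗ -)` and `F^#(U' ⊗ -)`, for `U' ≃ U^*`. -/
def kuhnPrecompIso {U U' : DivCat.{u} k d} (θ : U'.space ≃ₗ[k] Module.Dual k U.space) :
    kuhn k d ⋙ precomp (tensorLeft d U'.space) ≅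
      (precomp (tensorLeft d U.space)).op ⋙ kuhn k d :=
  NatIso.ofComponents (fun F => (isPoly.{u} k d).isoMk (NatIso.ofComponents
      (fun V => LinearEquiv.toFGModuleCatIso
        ((FGModuleCat.isoToLinearEquiv (F.unop.obj.mapIso (dualTensorIso θ V))).dualMap))
      (fun {V W} f => by
        have h := congrArg F.unop.obj.map (dualTensorIso_naturality θ f)
        rw [CategoryTheory.Functor.map_comp, CategoryTheory.Functor.map_comp] at h
        exact fgHom_ext fun x => LinearMap.ext fun y =>
          (congrArg (fun m => Module.Dual.eval k _ (m.hom.hom y) x) h).symm)))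
    (fun {F G} f => by
      refine ObjectProperty.hom_ext _ (NatTrans.ext (funext fun V => ?_))
      have h := f.unop.hom.naturality (dualTensorIso θ V).hom
      exact fgHom_ext fun x => LinearMap.ext fun y =>
          (congrArg (fun m => Module.Dual.eval k _ (m.hom.hom y) x) h))

/-- Kuhn duality exchanges the components given by an idempotent and by its transpose. -/
def kuhnPartIso {U U' : DivCat.{u} k d} (θ : U'.space ≃ₗ[k] Module.Dual k U.space) {e : U ⟶ U}
    (he : e ≫ e = e) {e' : U' ⟶ U'} (he' : e' ≫ e' = e')
    (h : e' = divPowMap d (conjTranspose θ) e) :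
    (part e).op ⋙ kuhn k d ≅ kuhn k d ⋙ part e' :=
  (((partRetract e' he').map ((Functor.whiskeringLeft _ _ _).obj (kuhn k d))).isoOfIso
    -- A contravariant functor exchanges the inclusion and the projection of a retract.
    ((⟨NatTrans.op (partRetract e he).r, NatTrans.op (partRetract e he).i,
      congrArg NatTrans.op (partRetract e he).retract⟩ :
        Retract (part e).op (precomp (tensorLeft d U.space)).op).map
      ((Functor.whiskeringRight _ _ _).obj (kuhn k d)))
    (kuhnPrecompIso θ) (by
      refine polyNatTrans_ext fun F V => ?_
      have h' := congrArg F.unop.obj.map (dualTensorIso_conjTranspose θ e h V)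
      rw [CategoryTheory.Functor.map_comp, CategoryTheory.Functor.map_comp] at h'
      exact fgHom_ext fun x => LinearMap.ext fun y =>
          (congrArg (fun m => Module.Dual.eval k _ (m.hom.hom y) x) h').symm)).symm

end KuhnPart

end StrictPoly

namespace StrictPoly

open Limits Opposite

/-! ### Kuhn duality and graded spaces. -/

section KuhnTwist

variable {k : Type u} [Field k] {d s : ℕ}

theorem divPowMap_eq {X Y Z : Type u} [AddCommGroup X] [Module k X] [AddCommGroup Y] [Module k Y]
    [AddCommGroup Z] [Module k Z] (f : X →ₗ[k] Y) (g : Y →ₗ[k] Z) (h : X →ₗ[k] Z)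
    (hh : ∀ x, h x = g (f x)) (x : divPow k d X) :
    divPowMap d h x = divPowMap d g (divPowMap d f x) := by
  obtain rfl : h = g ∘ₗ f := LinearMap.ext hh
  exact (divPowMap_divPowMap f g x).symm

theorem divPowMap_conjTranspose {U U' : Type u} [AddCommGroup U] [Module k U] [AddCommGroup U']
    [Module k U'] (θ : U' ≃ₗ[k] Module.Dual k U) (x : divPow k d (U →ₗ[k] U)) :
    divPowMap d (conjTranspose θ) x = divPowMap d (X := Module.Dual k U →ₗ[k] Module.Dual k U)
      (Y := U' →ₗ[k] U') (θ.symm.arrowCongr θ.symm).toLinearMap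
      (divPowMap d (Module.Dual.transpose (R := k) (M := U) (M' := U)) x) := by
  exact divPowMap_eq _ _ _ (fun f => rfl) x

/-- The weight is a sum over functions with values in `supp`; with equal supports the sums match
term by term, and each tensor factor is conjugated by `θ`. -/
theorem GradedSpace.weight_conj {U U' : GradedSpace.{u} k} (θ : U'.space ≃ₗ[k] U.space)
    (hsupp : U'.supp = U.supp) (hθ : ∀ j y, θ (U'.proj j y) = U.proj j (θ y)) (j : ℤ) :
    U'.weight d j = divPowMap d (θ.symm.arrowCongr θ.symm).toLinearMap (U.weight d j) := by
  refine Subtype.ext ((U'.weight_coe j).trans (Eq.trans ?_ (congrArg (PiTensorProduct.map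
    fun _ => (θ.symm.arrowCongr θ.symm).toLinearMap) (U.weight_coe j).symm)))
  rw [map_sum, hsupp]
  refine Finset.sum_congr rfl fun f _ => ?_
  rw [PiTensorProduct.map_tprod]
  refine congrArg _ (funext fun r => LinearMap.ext fun y => ?_)
  exact (θ.symm_apply_apply _).symm.trans (congrArg θ.symm (hθ (f r) y))

/-- A graded duality between `U` and `U'`: an isomorphism of `U'` with the graded dual of `U`. -/
structure GradedDuality (U U' : GradedSpace.{u} k) where
  equiv : U'.space ≃ₗ[k] Module.Dual k U.space
  supp_eq : U'.supp = U.dual.supp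
  equiv_proj : ∀ j y, equiv (U'.proj j y) = U.dual.proj j (equiv y)

namespace GradedDuality

variable {U U' : GradedSpace.{u} k}

theorem degs_eq (δ : GradedDuality U U') : U'.degs d = (U.degs d).image Neg.neg := by
  rw [← U.degs_dual, GradedSpace.degs, GradedSpace.degs, δ.supp_eq]

theorem weight_eq (δ : GradedDuality U U') (j : ℤ) :
    U'.weight d j = divPowMap d (conjTranspose δ.equiv) (U.weight d (-j)) := by
  have h := GradedSpace.weight_conj (d := d) (U := U.dual) δ.equiv δ.supp_eq δ.equiv_proj j
  rw [U.dual_weight] at h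
  exact h.trans (divPowMap_conjTranspose (U := U.space) (U' := U'.space) δ.equiv _).symm

end GradedDuality

/-- The graded duality between `U^*` and `U^{**}`. -/
def gradedDualityDual (U : GradedSpace.{u} k) : GradedDuality U U.dual where
  equiv := LinearEquiv.refl k _
  supp_eq := rfl
  equiv_proj _ _ := rfl

/-- Kuhn duality exchanges the components of degree `j` and `-j`, for graded spaces which are
dual to each other. -/
def kuhnComponentIso {U U' : GradedSpace.{u} k} (δ : GradedDuality U.dual U'.dual) (j : ℤ) :
    (component d U j).op ⋙ kuhn k d ≅ kuhn k d ⋙ component d U' (-j) :=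
  kuhnPartIso (U := ⟨U.dual.space⟩) (U' := ⟨U'.dual.space⟩) δ.equiv (e := U.dual.weight d j)
    (weight_idem U.dual j) (e' := U'.dual.weight d (-j)) (weight_idem U'.dual (-j))
    ((δ.weight_eq (-j)).trans (by rw [neg_neg]))

/-- Kuhn duality is compatible with `X ↦ X_U`. -/
def kuhnTwistIso (d : ℕ) {U U' : GradedSpace.{u} k} (δ : GradedDuality U.dual U'.dual) :
    (twist d U).op ⋙ kuhnDerived k d ≅ kuhnDerived k d ⋙ twist d U' :=
  ((twistDecomp d U).op.postcomp (kuhnDerived k d)).iso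
    ((twistDecomp d U').precomp (kuhnDerived k d))
    -- Duality sends the summand of degree `j` to that of degree `-j`, and its shift by `-j` to the
    -- shift by `- -j` required there.
    ((Equiv.neg ℤ).subtypeEquiv fun j => by simp [δ.degs_eq])
    fun j => Functor.isoWhiskerLeft (component d U j.1).mapDerivedCategory.op
        (kuhnDerivedShiftIso (-j.1)) ≪≫
      Functor.isoWhiskerRight (kuhnDerivedMapIso (kuhnComponentIso δ j.1))
        (shiftFunctor _ (- -j.1))

/-- Kuhn duality on the bounded derived category is compatible with `X ↦ X_U`. -/
def kuhnTwistBoundedIso (d : ℕ) (U : GradedSpace.{u} k) :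
    twistBounded d U ⋙ (kuhnBounded k d).rightOp ≅
      (kuhnBounded k d).rightOp ⋙ (twistBounded d U.dual).op :=
  let e : (twistBounded d U).op ⋙ kuhnBounded k d ≅ kuhnBounded k d ⋙ twistBounded d U.dual :=
    ((Functor.FullyFaithful.ofFullyFaithful
      (DerivedCategory.Bounded.ι (C := PolyFunctor.{u} k d))).whiskeringRight _).preimageIso
      (Functor.isoWhiskerLeft DerivedCategory.Bounded.ι.op
        (kuhnTwistIso d (gradedDualityDual U.dual)))
  NatIso.ofComponents (fun X => (e.app (op X)).op.symm) fun f =>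
    Quiver.Hom.unop_inj (e.inv.naturality f.op).symm

/-- The isomorphism `A(U) ≃ A(U^{**})` induced by the evaluation `U ≃ U^{**}`. -/
def evalSpaceIso (A : PolyFunctor.{u} k s) (U : FGModuleCat.{u} k) :
    A.obj.obj ⟨U⟩ ≃ₗ[k] A.obj.obj ⟨dualObj (dualObj U)⟩ :=
  FGModuleCat.isoToLinearEquiv (A.obj.mapIso (diagIso (V := ⟨U⟩) (W := ⟨dualObj (dualObj U)⟩)
    (Module.evalEquiv k U)))

/-- The biduality map intertwines a linear map with its double transpose; this extends to
`D^s(Hom(U, V))` by linearity in the map, and `A` is applied to the resulting square. -/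
theorem evalSpaceIso_naturality (A : PolyFunctor.{u} k s) {U V : DivCat.{u} k s} (f : U ⟶ V) (x) :
    evalSpaceIso A V.space ((A.obj.map f).hom.hom x) =
      (A.obj.map (transposeDiv (transposeDiv f))).hom.hom (evalSpaceIso A U.space x) := by
  let g := Module.Dual.transpose (R := k) (M := Module.Dual k V.space)
    (M' := Module.Dual k U.space) ∘ₗ Module.Dual.transpose (R := k) (M := U.space) (M' := V.space)
  have h₁ : transposeDiv (transposeDiv f) = divPowMap s g f := divPowMap_divPowMap _ _ _
  have h : f ≫ diagHom (W := dualDiv (dualDiv V)) (Module.evalEquiv k V.space).toLinearMap =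
      diagHom (W := dualDiv (dualDiv U)) (Module.evalEquiv k U.space).toLinearMap ≫
        transposeDiv (transposeDiv f) :=
    diagHom_naturality (V := U) (W := V) (V' := dualDiv (dualDiv U)) (W' := dualDiv (dualDiv V))
      (Module.evalEquiv k U.space).toLinearMap (Module.evalEquiv k V.space).toLinearMap
      LinearMap.id g (fun _ _ => rfl) f (divPowMap_id f).symm h₁
  have h' := congrArg A.obj.map h
  rw [CategoryTheory.Functor.map_comp, CategoryTheory.Functor.map_comp] at h'
  exact congrArg (fun m => m.hom.hom x) h'

/-- The graded duality between `A^#(U^*)^*` and `A(U)^*`. -/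
def gradedDualityEval (A : PolyFunctor.{u} k s) (U : GradedSpace.{u} k) :
    GradedDuality (U.dual.eval (kuhnObj A)).dual (U.eval A).dual where
  equiv := (evalSpaceIso A U.space).symm.dualMap ≪≫ₗ
    Module.evalEquiv k (Module.Dual k (A.obj.obj ⟨dualObj (dualObj U.space)⟩))
  supp_eq := by
    change (U.degs s).image Neg.neg = ((U.dual.degs s).image Neg.neg).image Neg.neg
    rw [GradedSpace.degs_dual, Finset.image_image (f := Neg.neg) (g := Neg.neg)]
    simp
  equiv_proj j (y : Module.Dual k (A.obj.obj ⟨U.space⟩)) := by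
    -- The index `- -j` comes from the two graded duals applied to `A^#(U^*)`, each of which negates
    -- the degree.
    have h₁ : U.dual.weight s (- -j) = transposeDiv (U.weight s (-j)) := by
      rw [U.dual_weight, neg_neg]
    have h₂ := evalSpaceIso_naturality A (U.weight s (-j))
    rw [← h₁] at h₂
    have h₃ : y ∘ₗ (A.obj.map (U.weight s (-j))).hom.hom ∘ₗ
        (evalSpaceIso A U.space).symm.toLinearMap =
      y ∘ₗ (evalSpaceIso A U.space).symm.toLinearMap ∘ₗ
        (A.obj.map (transposeDiv (U.dual.weight s (- -j)))).hom.hom := by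
      refine LinearMap.ext fun v => congrArg (fun w => y w) ?_
      obtain ⟨x, rfl⟩ := (evalSpaceIso A U.space).surjective v
      refine (congrArg _ ((evalSpaceIso A U.space).symm_apply_apply x)).trans ?_
      exact (((evalSpaceIso A U.space).symm_apply_apply _).symm).trans
        (congrArg (evalSpaceIso A U.space).symm (h₂ x))
    exact LinearMap.ext fun (z : Module.Dual k (Module.Dual k
      (A.obj.obj ⟨dualObj (dualObj U.space)⟩))) => congrArg (fun w => z w) h₃

end KuhnTwist

end StrictPoly

namespace StrictPoly

open Limits Opposite

/-! ### Multiplicativity of the Kuhn dual and the isomorphism for the left adjoint. -/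

section KuhnTensor

variable {k : Type u} [Field k] {d s : ℕ}

theorem dualDistrib_map {V V' W W' : Type u} [AddCommGroup V] [Module k V]
    [AddCommGroup V'] [Module k V'] [AddCommGroup W] [Module k W]
    [AddCommGroup W'] [Module k W'] (f : V →ₗ[k] V') (g : W →ₗ[k] W')
    (z : Module.Dual k V' ⊗[k] Module.Dual k W') :
    TensorProduct.dualDistrib k V W (TensorProduct.map f.dualMap g.dualMap z) =
      (TensorProduct.map f g).dualMap (TensorProduct.dualDistrib k V' W' z) := by
  induction z with
  | zero => simp
  | add x y hx hy => simp only [map_add, hx, hy]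
  | tmul x y =>
    refine TensorProduct.ext' fun v w => ?_
    simp

/-- The isomorphism `V^* ⊗ W^* ≃ (V ⊗ W)^*` of `Γ^d 𝒱`. -/
def dualDistribIso (V W : DivCat.{u} k d) :
    tensorObj (dualDiv V) (dualDiv W) ≅ dualDiv (tensorObj V W) :=
  diagIso (V := tensorObj (dualDiv V) (dualDiv W)) (W := dualDiv (tensorObj V W))
    (TensorProduct.dualDistribEquiv k V.space W.space)

/-- Linear maps which are natural with respect to tensor products of linear maps induce morphisms
of `Γ^d 𝒱` which are natural with respect to external products. -/
theorem tensorHom_comp_diagHom {V V' W W' P P' Q Q' T T' : DivCat.{u} k d}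
    (p : (V.space →ₗ[k] V'.space) →ₗ[k] (P.space →ₗ[k] P'.space))
    (q : (W.space →ₗ[k] W'.space) →ₗ[k] (Q.space →ₗ[k] Q'.space))
    (r : ((tensorObj V W).space →ₗ[k] (tensorObj V' W').space) →ₗ[k] (T.space →ₗ[k] T'.space))
    (a : (tensorObj P Q).space →ₗ[k] T.space) (b : (tensorObj P' Q').space →ₗ[k] T'.space)
    (h : ∀ f g, b ∘ₗ TensorProduct.map (p f) (q g) = r (TensorProduct.map f g) ∘ₗ a)
    (f : V ⟶ V') (g : W ⟶ W') {f' : P ⟶ P'} {g' : Q ⟶ Q'} {y : T ⟶ T'}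
    (hf : f' = divPowMap d p f) (hg : g' = divPowMap d q g)
    (hy : y = divPowMap d r (tensorHom f g)) :
    tensorHom f' g' ≫ diagHom b = diagHom a ≫ y := by
  subst hf hg hy
  refine (comp_diagHom _ _).trans (Eq.trans ?_ (diagHom_comp _ _).symm)
  refine Eq.trans ?_ (divPowMap_divPowMap _ _ _).symm
  exact (divPowMap_map₂ (TensorProduct.mapBilinear (RingHom.id k) V.space W.space V'.space W'.space)
    (TensorProduct.mapBilinear (RingHom.id k) P.space Q.space P'.space Q'.space) p q
    (LinearMap.lcomp k T'.space a ∘ₗ r)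
    (LinearMap.llcomp k (tensorObj P Q).space (tensorObj P' Q').space T'.space b)
    (fun x y => (h x y).symm) f g).symm

theorem dualDistribIso_naturality {V V' W W' : DivCat.{u} k d} (f : V ⟶ V') (g : W ⟶ W') :
    tensorHom (transposeDiv f) (transposeDiv g) ≫ (dualDistribIso V W).hom =
      (dualDistribIso V' W').hom ≫ transposeDiv (tensorHom f g) :=
  tensorHom_comp_diagHom (P := dualDiv V') (P' := dualDiv V) (Q := dualDiv W') (Q' := dualDiv W)
    (T := dualDiv (tensorObj V' W')) (T' := dualDiv (tensorObj V W))
    (Module.Dual.transpose (R := k) (M := V.space) (M' := V'.space))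
    (Module.Dual.transpose (R := k) (M := W.space) (M' := W'.space))
    (Module.Dual.transpose (R := k) (M := (tensorObj V W).space) (M' := (tensorObj V' W').space))
    (TensorProduct.dualDistribEquiv k V'.space W'.space).toLinearMap
    (TensorProduct.dualDistribEquiv k V.space W.space).toLinearMap
    (fun f g => LinearMap.ext fun z => dualDistrib_map f g z) f g rfl rfl rfl

/-- The Kuhn dual of a multiplicative strict polynomial functor is multiplicative. -/
def TensorIso.kuhn {A : PolyFunctor.{u} k s} (φ : TensorIso A) : TensorIso (kuhnObj A) where
  iso V W :=
    -- The chain is `A((V ⊗ W)^*)^* ≃ A(V^* ⊗ W^*)^* ≃ (A(V^*) ⊗ A(W^*))^* ≃ A(V^*)^* ⊗ A(W^*)^*`.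
    (FGModuleCat.isoToLinearEquiv (A.obj.mapIso (dualDistribIso V W))).dualMap ≪≫ₗ
      (φ.iso (dualDiv V) (dualDiv W)).symm.dualMap ≪≫ₗ
      (TensorProduct.dualDistribEquiv k (A.obj.obj (dualDiv V)) (A.obj.obj (dualDiv W))).symm
  naturality {V V' W W'} f g x := by
    refine (LinearEquiv.symm_apply_eq _).2 (Eq.trans ?_ (dualDistrib_map
      (A.obj.map (transposeDiv f)).hom.hom (A.obj.map (transposeDiv g)).hom.hom _).symm)
    refine Eq.trans ?_ (congrArg _ (LinearEquiv.apply_symm_apply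
      (TensorProduct.dualDistribEquiv k (A.obj.obj (dualDiv V)) (A.obj.obj (dualDiv W))) _).symm)
    refine LinearMap.ext fun z => ?_
    -- Since `φ` enters through its inverse, the argument is written as an image so that the
    -- naturality of `φ` applies.
    obtain ⟨y, rfl⟩ := (φ.iso (dualDiv V') (dualDiv W')).surjective z
    have h := congrArg A.obj.map (dualDistribIso_naturality f g)
    rw [CategoryTheory.Functor.map_comp, CategoryTheory.Functor.map_comp] at h
    have h' := φ.naturality (transposeDiv f) (transposeDiv g) y
    have h₁ : (A.obj.map (transposeDiv (tensorHom f g))).hom.hom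
        ((A.obj.map (dualDistribIso V' W').hom).hom.hom ((φ.iso (dualDiv V') (dualDiv W')).symm
          (φ.iso (dualDiv V') (dualDiv W') y))) =
      (A.obj.map (dualDistribIso V W).hom).hom.hom ((φ.iso (dualDiv V) (dualDiv W)).symm
        (TensorProduct.map (A.obj.map (transposeDiv f)).hom.hom
          (A.obj.map (transposeDiv g)).hom.hom (φ.iso (dualDiv V') (dualDiv W') y))) := by
      rw [LinearEquiv.symm_apply_apply, ← h', LinearEquiv.symm_apply_apply]
      exact (congrArg (fun m => m.hom.hom y) h).symm
    exact congrArg (fun w => Module.Dual.eval k _ w x) h₁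

/-- `𝐊^l_A(F_U) ≃ 𝐊^l_A(F)_{A(U)}`. -/
theorem nonempty_leftK_twist_iso (d : ℕ) {A : PolyFunctor.{u} k s} (φ : TensorIso A)
    (U : GradedSpace.{u} k) :
    Nonempty (twistBounded (d * s) U ⋙ leftK d A ≅ leftK d A ⋙ twist d (U.eval A)) := by
  obtain ⟨e⟩ := nonempty_rightK_twist_iso d φ.kuhn U.dual
  -- The successive identifications are `(F_U)^# ≃ (F^#)_{U^*}`, then the result for `𝐊^r_{A^#}`,
  -- then the dual of a twist by `A^#(U^*)` as a twist by `A(U)`.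
  exact ⟨Functor.isoWhiskerRight (kuhnTwistBoundedIso (d * s) U)
      ((rightK d (kuhnObj A)).op ⋙ kuhnDerived k d) ≪≫
    Functor.isoWhiskerLeft (kuhnBounded k (d * s)).rightOp
      (Functor.isoWhiskerRight (NatIso.op e).symm (kuhnDerived k d)) ≪≫
    Functor.isoWhiskerLeft ((kuhnBounded k (d * s)).rightOp ⋙ (rightK d (kuhnObj A)).op)
      (kuhnTwistIso d (gradedDualityEval A U))⟩

end KuhnTensor

end StrictPoly

end

theorem proposition3p1 {k : Type u} [Field k] (d s : ℕ) (A : StrictPoly.PolyFunctor.{u} k s)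
    (φ : StrictPoly.TensorIso A) (U : StrictPoly.GradedSpace.{u} k) :
    Nonempty (StrictPoly.twistBounded (d * s) U ⋙ StrictPoly.rightK d A ≅
      StrictPoly.rightK d A ⋙ StrictPoly.twist d (U.eval A)) ∧
    Nonempty (StrictPoly.twistBounded (d * s) U ⋙ StrictPoly.leftK d A ≅
      StrictPoly.leftK d A ⋙ StrictPoly.twist d (U.eval A)) :=
  ⟨StrictPoly.nonempty_rightK_twist_iso d φ U, StrictPoly.nonempty_leftK_twist_iso d φ U⟩
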